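/- All graphs are finite and simple; $K_n$ is the complete graph on $n$ vertices, $\bar K_n$ its edgeless complement, $\dot\cup$ denotes disjoint union and $+$ denotes join. A map $p:V\to\mathbb R^k$ on a finite set $V$ is *generic* if the family of its $k|V|$ coordinates is algebraically independent over $\mathbb Q$. For $|V|=n$ and generic $p:V\to\mathbb R^t$, the symmetric $t$-tensor matroid $\mathcal S_t(K_n)$ is the linear matroid on $E(K_n)$ in which the edge $ij$ is represented by $p_i\otimes p_j+p_j\otimes p_i$. For generic $q:V\to\mathbb R^d$, the generic $d$-dimensional rigidity matroid $\mathcal R_d(K_n)$ is the row matroid of the rigidity matrix of $(K_n,q)$: the row of the edge $ij$ has $q_i-q_j$ in the columns of $i$, $q_j-q_i$ in the columns of $j$, and zeros elsewhere. A graph has a property in such a matroid if its edge set has it; a graph with $n$ vertices is generically rigid in $\mathbb R^d$ if it spans $\mathcal R_d(K_n)$. Families $\mathcal C_{n,t}$ of graphs on $n$ vertices, with weights $c_t$, are defined recursively. For $n\le t+1$ put $\mathcal C_{n,t}=\{\bar K_n\}$; for $n\ge 3$ put $\mathcal C_{n,1}=\{K_n,\bar K_n\}$; and for $t\ge 2$,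 $n\ge t+2$ put $$\mathcal C_{n,t}=\{\bar K_n\}\cup\{G+K_1: G\in\mathcal C_{n-1,t-1}\}\cup\{K_{a,b}\,\dot\cup\,\bar K_{n-a-b}: 3\le a,b\le t-1,\ t+2\le a+b\le n\}.$$ The weights are $c_t(\bar K_n)=0$, $c_1(K_n)=1$ for $n\ge3$, $c_t(G+K_1)=c_{t-1}(G)+t$, and $c_t(K_{a,b}\,\dot\cup\,\bar K_{n-a-b})=ab-\binom{a+b-t}{2}$. A graph $G$ on $n$ vertices is *$\mathcal C_t$-independent* if $|E(H)|\le c_t(F)$ for every subgraph $H$ of $G$ and every $F\in\mathcal C_{n,t}$ that has a subgraph isomorphic to $H$. A matroid on $E(K_n)$, $n\ge t+1$, is an *abstract symmetric $t$-tensor matroid* if its rank is $\binom{t+1}{2}$ and every copy of $K_{1,t+1}$ in $K_n$ is a circuit. Such matroids are compared in the weak order: $M\preceq N$ if every independent set of $M$ is independent in $N$. **Theorem.** Let $t$ be an integer with $1\le t\le 5$. 1. A graph $G$ on $n$ vertices is independent in $\mathcal S_t(K_n)$ if and only if it is $\mathcal C_t$-independent. 2. Let $d\ge 0$ and $n=d+t+1$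 (so that $2\le n-d\le 6$). A graph $G$ on $n$ vertices is generically rigid in $\mathbb R^d$ if and only if its complement $\bar G$ is $\mathcal C_t$-independent. 3. For every $n\ge t+1$, $\mathcal S_t(K_n)$ is the unique maximal abstract symmetric $t$-tensor matroid on $E(K_n)$; moreover $M\preceq\mathcal S_t(K_n)$ for every abstract symmetric $t$-tensor matroid $M$ on $E(K_n)$. -/

import Mathlib

open scoped TensorProduct

universe u v

/-- The linear matroid on a finite set `E`: a subset of `E` is independent iff the family of
vectors that `f` assigns to it is linearly independent over `ℝ`. -/
noncomputable def linearMatroid {α : Type u} {W : Type v} [AddCommGroup W] [Module ℝ W]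
    (E : Set α) (hE : E.Finite) (f : α → W) : Matroid α :=
  (IndepMatroid.ofFinite hE (fun I => I ⊆ E ∧ LinearIndepOn ℝ f I)
    ⟨Set.empty_subset E, linearIndepOn_empty ℝ f⟩
    (fun _ _ hJ hIJ => ⟨hIJ.trans hJ.1, hJ.2.mono hIJ⟩)
    (by
      rintro I J ⟨hIE, hI⟩ ⟨hJE, hJ⟩ hlt
      have hIf := hE.subset hIE
      have hJf := hE.subset hJE
      by_contra hcon0
      have hcon : ∀ e ∈ J, e ∉ I → ¬ (insert e I ⊆ E ∧ LinearIndepOn ℝ f (insert e I)) :=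
        fun e he heI h => hcon0 ⟨e, he, heI, h⟩
      have hsub : f '' J ⊆ (Submodule.span ℝ (f '' I) : Set W) := by
        rintro _ ⟨e, he, rfl⟩
        by_cases heI : e ∈ I
        · exact Submodule.subset_span ⟨e, heI, rfl⟩
        · by_contra hns
          exact hcon e he heI ⟨Set.insert_subset (hJE he) hIE, hI.insert hns⟩
      have h1 : Set.finrank ℝ (f '' J) ≤ Set.finrank ℝ (f '' I) := by
        have : FiniteDimensional ℝ (Submodule.span ℝ (f '' I)) :=
          FiniteDimensional.span_of_finite ℝ (hIf.image f)
        exact Submodule.finrank_mono (Submodule.span_le.2 hsub)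
      have key : ∀ K : Set α, K.Finite → LinearIndepOn ℝ f K →
          Set.finrank ℝ (f '' K) = K.ncard := by
        intro K hK hKi
        have := hK.fintype
        have := finrank_span_eq_card (R := ℝ) (b := fun x : K => f x) hKi
        rw [Set.finrank, Set.image_eq_range, this, ← Nat.card_eq_fintype_card,
          Nat.card_coe_set_eq]
      rw [key J hJf hJ, key I hIf hI] at h1
      omega)
    (fun _ h => h.1)).matroid

/-- The edge set of the complete graph on `V`. -/
abbrev completeEdges (V : Type u) : Set (Sym2 V) := (⊤ : SimpleGraph V).edgeSet

/-- A realisation `p : V → ℝᵏ` is generic if the family of all its coordinates is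
algebraically independent over `ℚ`. -/
def IsGeneric {V : Type u} {k : ℕ} (p : V → Fin k → ℝ) : Prop :=
  AlgebraicIndependent ℚ (fun x : V × Fin k => p x.1 x.2)

/-- Generic realisations exist. -/
theorem exists_isGeneric (V : Type u) [Finite V] (k : ℕ) : ∃ p : V → Fin k → ℝ, IsGeneric p := by
  obtain ⟨s, hs⟩ := exists_isTranscendenceBasis ℚ ℝ
  have hinf : s.Infinite := by
    intro hfin
    have := hs.isAlgebraic
    have : Countable s := hfin.countable
    have : Countable (MvPolynomial s ℚ) := by
      rw [← Cardinal.mk_le_aleph0_iff]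
      exact MvPolynomial.cardinalMk_le_max.trans (by simp)
    have hc : Cardinal.mk (Algebra.adjoin ℚ (Set.range ((↑) : s → ℝ))) ≤ Cardinal.aleph0 := by
      rw [Cardinal.mk_le_aleph0_iff]
      exact hs.1.aevalEquiv.symm.injective.countable
    have h := Algebra.IsAlgebraic.cardinalMk_le_max
      (Algebra.adjoin ℚ (Set.range ((↑) : s → ℝ))) ℝ
    rw [Cardinal.mk_real] at h
    exact absurd (h.trans (max_le hc le_rfl)) (not_le.2 Cardinal.aleph0_lt_continuum)
  have := hinf.to_subtype
  obtain ⟨g⟩ : Nonempty ((V × Fin k) ↪ s) := by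
    obtain ⟨m, ⟨e⟩⟩ := Finite.exists_equiv_fin (V × Fin k)
    exact ⟨(e.toEmbedding.trans Fin.valEmbedding).trans (Infinite.natEmbedding s)⟩
  exact ⟨fun v i => (g (v, i) : ℝ), hs.1.comp g g.injective⟩

/-- The vector `pᵢ ⊗ pⱼ + pⱼ ⊗ pᵢ` of an edge `ij`. -/
noncomputable def symTensor {V : Type u} {t : ℕ} (p : V → Fin t → ℝ) :
    Sym2 V → (Fin t → ℝ) ⊗[ℝ] (Fin t → ℝ) :=
  Sym2.lift ⟨fun i j => p i ⊗ₜ[ℝ] p j + p j ⊗ₜ[ℝ] p i, fun _ _ => add_comm _ _⟩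

/-- The symmetric `t`-tensor matroid of the complete graph on `V`, realised by `p`.
For generic `p` this is `𝒮_t(K_n)`. -/
noncomputable def symTensorMatroid {V : Type u} [Finite V] {t : ℕ} (p : V → Fin t → ℝ) :
    Matroid (Sym2 V) :=
  linearMatroid (completeEdges V) (Set.toFinite _) (symTensor p)

open Classical in
/-- The row of the rigidity matrix of `(K_n, q)` indexed by the edge `ij`: it has `qᵢ - qⱼ` in the
columns of `i`, `qⱼ - qᵢ` in the columns of `j`, and zeros elsewhere. -/
noncomputable def rigidityRow {V : Type u} {d : ℕ} (q : V → Fin d → ℝ) :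
    Sym2 V → (V → Fin d → ℝ) :=
  Sym2.lift ⟨fun i j => Pi.single i (q i - q j) + Pi.single j (q j - q i),
    fun _ _ => add_comm _ _⟩

/-- The bar-joint rigidity matroid of the framework `(K_n, q)`; for generic `q` this is the
generic `d`-dimensional rigidity matroid `ℛ_d(K_n)`. -/
noncomputable def rigidityMatroid {V : Type u} [Finite V] {d : ℕ} (q : V → Fin d → ℝ) :
    Matroid (Sym2 V) :=
  linearMatroid (completeEdges V) (Set.toFinite _) (rigidityRow q)

/-- The join `G + H`. -/
def graphJoin {V : Type u} {W : Type v} (G : SimpleGraph V) (H : SimpleGraph W) :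
    SimpleGraph (V ⊕ W) :=
  (G ⊕g H) ⊔ completeBipartiteGraph V W

/-- The members of the family `𝒞_{n,t}`, each given by its recursive construction;
`CGraph.graph` below is the graph itself, and `CGraph.weight` is its weight `c_t`. -/
inductive CGraph : ℕ → ℕ → Type
  /-- The edgeless graph on `n` vertices. -/
  | empty (n t : ℕ) : CGraph n t
  /-- `K_n`, for `t = 1` and `n ≥ 3`. -/
  | complete (n : ℕ) (hn : 3 ≤ n) : CGraph n 1
  /-- `G + K_1`, where `G` is in `𝒞_{n,t}`; it lies in `𝒞_{n+1,t+1}`, with `t + 1 ≥ 2` and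
  `n + 1 ≥ (t + 1) + 2`. -/
  | cone {n t : ℕ} (ht : 2 ≤ t + 1) (hn : (t + 1) + 2 ≤ n + 1) (G : CGraph n t) :
      CGraph (n + 1) (t + 1)
  /-- `K_{a,b}` together with `n - a - b` isolated vertices. -/
  | bipartite (n t a b : ℕ) (ha : 3 ≤ a) (hat : a ≤ t - 1) (hb : 3 ≤ b) (hbt : b ≤ t - 1)
      (hab : t + 2 ≤ a + b) (habn : a + b ≤ n) : CGraph n t

/-- The vertex set (of `n` elements) of a member of `𝒞_{n,t}`. -/
def CGraph.Vertex : {n t : ℕ} → CGraph n t → Type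
  | _, _, .empty n _ => Fin n
  | _, _, .complete n _ => Fin n
  | _, _, .cone _ _ G => G.Vertex ⊕ Fin 1
  | _, _, .bipartite n _ a b _ _ _ _ _ _ => (Fin a ⊕ Fin b) ⊕ Fin (n - a - b)

/-- The underlying graph of a member of `𝒞_{n,t}`. -/
def CGraph.graph : {n t : ℕ} → (F : CGraph n t) → SimpleGraph F.Vertex
  | _, _, .empty n _ => (⊥ : SimpleGraph (Fin n))
  | _, _, .complete n _ => (⊤ : SimpleGraph (Fin n))
  | _, _, .cone _ _ G => graphJoin G.graph (⊤ : SimpleGraph (Fin 1))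
  | _, _, .bipartite n _ a b _ _ _ _ _ _ =>
      completeBipartiteGraph (Fin a) (Fin b) ⊕g (⊥ : SimpleGraph (Fin (n - a - b)))

/-- The weight `c_t` of a member of `𝒞_{n,t}`. -/
def CGraph.weight : {n t : ℕ} → CGraph n t → ℤ
  | _, _, .empty _ _ => 0
  | _, _, .complete _ _ => 1
  | _, _, .cone (t := t) _ _ G => G.weight + ((t + 1 : ℕ) : ℤ)
  | _, _, .bipartite _ t a b _ _ _ _ _ _ => (a : ℤ) * b - ((a + b - t).choose 2 : ℤ)

/-- `G` on `n` vertices is `𝒞_t`-independent if `|E(H)| ≤ c_t(F)` for all subgraphs `H` of `G` and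
all `F ∈ 𝒞_{n,t}` that have a subgraph isomorphic to `H`. -/
def CIndependent {V : Type u} [Fintype V] (t : ℕ) (G : SimpleGraph V) : Prop :=
  ∀ (H : G.Subgraph) (F : CGraph (Fintype.card V) t),
    H.coe.IsContained F.graph → (H.edgeSet.ncard : ℤ) ≤ F.weight

/-- `M` is an abstract symmetric `t`-tensor matroid on the edge set of the complete graph on `V`:
its rank is `(t + 1 choose 2)` and every copy of the star `K_{1,t+1}` is a circuit. -/
structure IsAbstractSymTensorMatroid {V : Type u} (t : ℕ) (M : Matroid (Sym2 V)) : Prop where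
  ground_eq : M.E = completeEdges V
  rank_eq : M.eRank = ((t + 1).choose 2 : ℕ)
  isCircuit_star : ∀ (v : V) (U : Finset V), v ∉ U → U.card = t + 1 →
    M.IsCircuit ((fun u => s(v, u)) '' (U : Set V))

/-- The weak order on matroids with the same ground set. -/
def WeakLE {α : Type u} (M N : Matroid α) : Prop :=
  M.E = N.E ∧ ∀ I : Set α, M.Indep I → N.Indep I

/-- `M` is a maximal element, in the weak order, of the family of matroids satisfying `P`. -/
def IsWeakMaximal {α : Type u} (P : Matroid α → Prop) (M : Matroid α) : Prop :=
  P M ∧ ∀ N, P N → WeakLE M N → N = M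

/-! Two implications carry the theorem. For every `t`, a graph on at least `t + 1` vertices that is
independent in some abstract symmetric `t`-tensor matroid is `𝒞_t`-independent
(`IsAbstractSymTensorMatroid.cIndependent`). For `1 ≤ t ≤ 5`, a `𝒞_t`-independent graph is
independent at every generic point (`CIndependent.indep`). Since the generic tensor matroid is
itself abstract, statements 1 and 3 follow.

The first implication says that the weights are rank bounds. In an abstract matroid any `t` edges at
a vertex span all edges there, so the edges meeting `s ≤ t` vertices have rank at most `t + (t - 1)
+ ⋯ + (t - s + 1)`; this accounts for the cones. The edges of `K_{a,b}` lie in the intersection of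
the edges meeting one side with those meeting the other, and the union of these two sets has full
rank, so submodularity gives the bipartite weight.

The second implication is by passing from `t - 1` to `t`. Place a vertex `v` on a new coordinate
axis. If `deg v ≤ t` and `E - v` is independent for `t - 1`, then `E` is independent for `t`
(`TIndep.cone`). If `deg v ≤ t - 1`, the square of the new coordinate is free to absorb one edge
with no end adjacent to `v`; hence it is enough that `E - v` is independent up to one edge and that
no dependent subset of `E - v` is covered by the neighbours of `v` (`TIndep.step`). A covered
dependent subset is ruled out by degree counts: it would force a pattern in `E` that a member of
`𝒞_{n,t}` forbids. When all degrees are too low, letting the point of `v` tend to that of `w` moves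
edges from `v` to `w` and raises a degree (`TIndep.of_shift`). For `t = 5` the disjoint union of
`K_{3,3}` and `K_4` is left over and gets explicit points.

Statement 2 is Gale duality: the stresses of `K_n` at `q` are the symmetric bilinear forms evaluated
on pairs of points of a Gale dual `p`, so `G` spans at `q` exactly if the complement is independent
at `p` (`IsGaleDual.spanning_iff`). Duals of generic points are not shown to be generic;
independence and spanning are transferred to generic points separately in each direction. -/

/-! ### Matrix form of the edge vectors -/

/-- The matrix form of the vector `pᵢ ⊗ pⱼ + pⱼ ⊗ pᵢ`. -/
def edgeMat {V : Type u} {t : ℕ} (p : V → Fin t → ℝ) : Sym2 V → (Fin t × Fin t → ℝ) :=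
  Sym2.lift ⟨fun i j x => p i x.1 * p j x.2 + p j x.1 * p i x.2, fun _ _ => by
    funext x; ring⟩

@[simp] lemma edgeMat_mk {V : Type u} {t : ℕ} (p : V → Fin t → ℝ) (i j : V) (x : Fin t × Fin t) :
    edgeMat p s(i, j) x = p i x.1 * p j x.2 + p j x.1 * p i x.2 := rfl

/-- Coordinates on `ℝᵗ ⊗ ℝᵗ`. -/
noncomputable def tensorCoord (t : ℕ) :
    ((Fin t → ℝ) ⊗[ℝ] (Fin t → ℝ)) ≃ₗ[ℝ] (Fin t × Fin t → ℝ) :=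
  ((Pi.basisFun ℝ (Fin t)).tensorProduct (Pi.basisFun ℝ (Fin t))).equivFun

lemma tensorCoord_symTensor {V : Type u} {t : ℕ} (p : V → Fin t → ℝ) (e : Sym2 V) :
    tensorCoord t (symTensor p e) = edgeMat p e := by
  induction e with
  | _ i j =>
    funext ⟨a, b⟩
    simp [tensorCoord, symTensor, Module.Basis.tensorProduct_repr_tmul_apply, mul_comm]

lemma linearIndepOn_symTensor_iff {V : Type u} {t : ℕ} (p : V → Fin t → ℝ) (s : Set (Sym2 V)) :
    LinearIndepOn ℝ (symTensor p) s ↔ LinearIndepOn ℝ (edgeMat p) s := by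
  have h := (tensorCoord t).toLinearMap.linearIndependent_iff (v := fun e : s => symTensor p e)
    (LinearEquiv.ker _)
  have h2 : ((tensorCoord t).toLinearMap ∘ fun e : s => symTensor p e) =
      fun e : s => edgeMat p e := by
    funext e; exact tensorCoord_symTensor p e
  rw [h2] at h
  exact h.symm

lemma linearMatroid_indep_iff {α : Type u} {W : Type v} [AddCommGroup W] [Module ℝ W]
    {E : Set α} {hE : E.Finite} {f : α → W} {I : Set α} :
    (linearMatroid E hE f).Indep I ↔ I ⊆ E ∧ LinearIndepOn ℝ f I := Iff.rfl

/-! ### Generic points -/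

/-- Linear independence of vectors with polynomial coordinates passes from one point to every
generic point. -/
lemma linearIndepOn_of_algebraicIndependent {X α κ : Type*} [Fintype κ]
    (P : α → κ → MvPolynomial X ℚ) {s : Set α} (hs : s.Finite) {x y : X → ℝ}
    (hx : LinearIndepOn ℝ (fun a k => MvPolynomial.aeval x (P a k)) s)
    (hy : AlgebraicIndependent ℚ y) :
    LinearIndepOn ℝ (fun a k => MvPolynomial.aeval y (P a k)) s := by
  classical
  have := hs.fintype
  -- Over the reals a Gram determinant detects linear independence. It is a single polynomial over
  -- `ℚ`, so it vanishes at an algebraically independent point only if it is zero.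
  let D : MvPolynomial X ℚ :=
    (Matrix.of fun a b : s => ∑ k, P a k * P b k).det
  have key : ∀ z : X → ℝ, LinearIndepOn ℝ (fun a k => MvPolynomial.aeval z (P a k)) s ↔
      MvPolynomial.aeval z D ≠ 0 := by
    intro z
    let w : s → EuclideanSpace ℝ κ := fun a => WithLp.toLp 2 fun k => MvPolynomial.aeval z (P a k)
    have h1 : LinearIndepOn ℝ (fun a k => MvPolynomial.aeval z (P a k)) s ↔
        LinearIndependent ℝ w := by
      exact ((WithLp.linearEquiv 2 ℝ (κ → ℝ)).symm.toLinearMap.linearIndependent_iff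
        (v := fun a : s => fun k => MvPolynomial.aeval z (P a k)) (LinearEquiv.ker _)).symm
    rw [h1, ← Matrix.det_gram_ne_zero_iff_linearIndependent (𝕜 := ℝ)]
    have h2 : MvPolynomial.aeval z D = (Matrix.gram ℝ w).det := by
      simp only [D]
      rw [AlgHom.map_det]
      congr 1
      ext a b
      simp [Matrix.gram, w, PiLp.inner_apply, mul_comm]
    rw [h2]
  rw [key] at hx ⊢
  intro h0
  apply hx
  have : D = 0 := by
    apply hy
    simpa using h0
  rw [this, map_zero]

/-- The entries of `edgeMat` are rational polynomials in the coordinates. This is what allows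
`TIndep` to ask for just one realisation, however special. -/
lemma IsGeneric.linearIndepOn_edgeMat {V : Type u} {t : ℕ} {p q : V → Fin t → ℝ}
    (hp : IsGeneric p) {s : Set (Sym2 V)} (hs : s.Finite) (hq : LinearIndepOn ℝ (edgeMat q) s) :
    LinearIndepOn ℝ (edgeMat p) s := by
  let P : Sym2 V → Fin t × Fin t → MvPolynomial (V × Fin t) ℚ :=
    Sym2.lift ⟨fun i j x => .X (i, x.1) * .X (j, x.2) + .X (j, x.1) * .X (i, x.2), fun _ _ => by
      funext x; ring⟩
  have key : ∀ r : V → Fin t → ℝ, edgeMat r =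
      fun a k => MvPolynomial.aeval (fun x : V × Fin t => r x.1 x.2) (P a k) := by
    intro r
    funext e
    induction e with
    | _ i j => funext x; simp [P]
  rw [key] at hq ⊢
  exact linearIndepOn_of_algebraicIndependent P hs hq hp

lemma IsGeneric.linearIndepOn {V : Type u} {t : ℕ} {p q : V → Fin t → ℝ}
    (hp : IsGeneric p) {s : Set V} (hs : s.Finite) (hq : LinearIndepOn ℝ q s) :
    LinearIndepOn ℝ p s := by
  have := linearIndepOn_of_algebraicIndependent (fun v k => .X (v, k))
    (x := fun x : V × Fin t => q x.1 x.2) hs (by simpa using hq) hp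
  simpa using this

/-- At most `t` points in generic position in `ℝᵗ` are linearly independent. -/
lemma IsGeneric.linearIndepOn_of_card_le {V : Type u} {t : ℕ} {p : V → Fin t → ℝ}
    (hp : IsGeneric p) (s : Finset V) (hs : s.card ≤ t) : LinearIndepOn ℝ p (s : Set V) := by
  classical
  obtain ⟨g⟩ : Nonempty (s ↪ Fin t) := by
    apply Function.Embedding.nonempty_of_card_le; simpa using hs
  let q : V → Fin t → ℝ := fun v => if h : v ∈ s then Pi.single (g ⟨v, h⟩) 1 else 0
  refine hp.linearIndepOn s.finite_toSet (q := q) ?_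
  have : (fun x : (s : Set V) => q x) = (fun i : Fin t => (Pi.single i 1 : Fin t → ℝ)) ∘ g := by
    funext x
    have : (x : V) ∈ s := x.2
    simp [q, this]
  rw [LinearIndepOn, this]
  exact (Pi.linearIndependent_single_one (Fin t) ℝ).comp g g.injective

/-- The induction deletes vertices and adjoins fresh ones, so it runs on the one infinite vertex set
`ℕ`, to which `exists_isGeneric` does not apply. -/
lemma exists_isGeneric_nat (k : ℕ) : ∃ p : ℕ → Fin k → ℝ, IsGeneric p := by
  obtain ⟨s, hs⟩ := exists_isTranscendenceBasis ℚ ℝ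
  have hinf : s.Infinite := by
    intro hfin
    have := hs.isAlgebraic
    have : Countable s := hfin.countable
    have : Countable (MvPolynomial s ℚ) := by
      rw [← Cardinal.mk_le_aleph0_iff]
      exact MvPolynomial.cardinalMk_le_max.trans (by simp)
    have hc : Cardinal.mk (Algebra.adjoin ℚ (Set.range ((↑) : s → ℝ))) ≤ Cardinal.aleph0 := by
      rw [Cardinal.mk_le_aleph0_iff]
      exact hs.1.aevalEquiv.symm.injective.countable
    have h := Algebra.IsAlgebraic.cardinalMk_le_max
      (Algebra.adjoin ℚ (Set.range ((↑) : s → ℝ))) ℝ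
    rw [Cardinal.mk_real] at h
    exact absurd (h.trans (max_le hc le_rfl)) (not_le.2 Cardinal.aleph0_lt_continuum)
  have := hinf.to_subtype
  obtain ⟨e⟩ : Nonempty ((ℕ × Fin k) ↪ ℕ) := nonempty_embedding_nat _
  let g := e.trans (Infinite.natEmbedding s)
  exact ⟨fun v i => (g (v, i) : ℝ), hs.1.comp g g.injective⟩

open Finset

/-! ### Finite edge sets on the vertex set `ℕ` -/

/-- The edges of `E` that avoid the vertex `v`. -/
def del (E : Finset (Sym2 ℕ)) (v : ℕ) : Finset (Sym2 ℕ) := E.filter (v ∉ ·)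

/-- The neighbours of `v`. -/
def nb (E : Finset (Sym2 ℕ)) (v : ℕ) : Finset ℕ :=
  (E.biUnion Sym2.toFinset).filter (fun u => s(v, u) ∈ E)

/-- The degree of `v`. -/
def dg (E : Finset (Sym2 ℕ)) (v : ℕ) : ℕ := #(nb E v)

/-- No edge of `E` is a loop. -/
def NoLoop (E : Finset (Sym2 ℕ)) : Prop := ∀ v, s(v, v) ∉ E

/-- `E` is independent in the symmetric `t`-tensor matroid of some, equivalently every generic,
realisation. -/
def TIndep (t : ℕ) (E : Finset (Sym2 ℕ)) : Prop :=
  ∃ p : ℕ → Fin t → ℝ, LinearIndepOn ℝ (edgeMat p) (E : Set (Sym2 ℕ))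

@[simp] lemma mem_nb {E : Finset (Sym2 ℕ)} {v u : ℕ} : u ∈ nb E v ↔ s(v, u) ∈ E := by
  simp only [nb, mem_filter, mem_biUnion, and_iff_right_iff_imp]
  exact fun h => ⟨_, h, by simp⟩

@[simp] lemma mem_del {E : Finset (Sym2 ℕ)} {v : ℕ} {e : Sym2 ℕ} :
    e ∈ del E v ↔ e ∈ E ∧ v ∉ e := by simp [del]

lemma mem_nb_comm {E : Finset (Sym2 ℕ)} {v u : ℕ} : u ∈ nb E v ↔ v ∈ nb E u := by
  simp [Sym2.eq_swap]

lemma NoLoop.mono {E F : Finset (Sym2 ℕ)} (hE : NoLoop E) (h : F ⊆ E) : NoLoop F :=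
  fun v hv => hE v (h hv)

lemma del_subset (E : Finset (Sym2 ℕ)) (v : ℕ) : del E v ⊆ E := filter_subset _ _

lemma NoLoop.del {E : Finset (Sym2 ℕ)} (hE : NoLoop E) (v : ℕ) : NoLoop (del E v) :=
  hE.mono (del_subset E v)

lemma NoLoop.notMem_nb {E : Finset (Sym2 ℕ)} (hE : NoLoop E) (v : ℕ) : v ∉ nb E v := by
  simpa using hE v

lemma filter_mem_eq_image (E : Finset (Sym2 ℕ)) (v : ℕ) :
    E.filter (v ∈ ·) = (nb E v).image (fun u => s(v, u)) := by
  ext e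
  simp only [mem_filter, mem_image, mem_nb]
  constructor
  · rintro ⟨h, u, rfl⟩
    exact ⟨u, h, rfl⟩
  · rintro ⟨u, h, rfl⟩
    exact ⟨h, by simp⟩

lemma mk_injective (v : ℕ) : Function.Injective (fun u => s(v, u)) := by
  intro a b h
  exact Sym2.congr_right.1 h

lemma card_del_add_dg (E : Finset (Sym2 ℕ)) (v : ℕ) : #(del E v) + dg E v = #E := by
  have h := card_filter_add_card_filter_not (s := E) (v ∈ ·)
  rw [filter_mem_eq_image, card_image_of_injective _ (mk_injective v)] at h
  simp only [del, dg]
  omega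

lemma TIndep.mono {t : ℕ} {E F : Finset (Sym2 ℕ)} (h : TIndep t E) (hF : F ⊆ E) : TIndep t F := by
  obtain ⟨p, hp⟩ := h
  exact ⟨p, LinearIndepOn.mono hp (by exact_mod_cast hF)⟩

lemma TIndep.generic {t : ℕ} {E : Finset (Sym2 ℕ)} (h : TIndep t E) {p : ℕ → Fin t → ℝ}
    (hp : IsGeneric p) : LinearIndepOn ℝ (edgeMat p) (E : Set (Sym2 ℕ)) := by
  obtain ⟨q, hq⟩ := h
  exact hp.linearIndepOn_edgeMat E.finite_toSet hq

lemma tIndep_empty (t : ℕ) : TIndep t ∅ := ⟨0, by simp⟩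

/-! ### Constructions that preserve independence: extension, degeneration, exchange. -/

/-- Extension: place `v` on a new coordinate axis; one further edge `ij` whose ends are not
adjacent to `v` may use the square of the new coordinate. -/
lemma TIndep.extend {t : ℕ} {E : Finset (Sym2 ℕ)} (hE : NoLoop E) (v i j : ℕ) (he : s(i, j) ∈ E)
    (hN : dg (E.erase s(i, j)) v ≤ t) (hi : i ∉ nb (E.erase s(i, j)) v)
    (hj : j ∉ nb (E.erase s(i, j)) v) (hR : TIndep t (del (E.erase s(i, j)) v)) :
    TIndep (t + 1) E := by
  obtain ⟨q, hq⟩ := exists_isGeneric_nat t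
  have hR' := hR.generic hq
  have hN' := hq.linearIndepOn_of_card_le _ hN
  set E₀ := E.erase s(i, j) with hE₀
  -- The last coordinate is 1 at `v`, `i`, `j` and 0 elsewhere. The vertex `v` may coincide with `i`
  -- or `j`, as happens in `TIndep.cone`.
  let p : ℕ → Fin (t + 1) → ℝ := fun u => if u = v then Pi.single (Fin.last t) 1 else
    Fin.snoc (q u) (if u = i ∨ u = j then 1 else 0)
  have pvl : p v (Fin.last t) = 1 := by simp [p]
  have pvc : ∀ a : Fin t, p v a.castSucc = 0 := fun a => by simp [p]
  have pl : ∀ u, u ≠ v → p u (Fin.last t) = if u = i ∨ u = j then 1 else 0 := fun u hu => by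
    simp [p, hu]
  have pc : ∀ u, u ≠ v → ∀ a : Fin t, p u a.castSucc = q u a := fun u hu a => by
    simp [p, hu]
  refine ⟨p, linearIndepOn_finset_iff.2 fun ω hω => ?_⟩
  have hco : ∀ x, ∑ f ∈ E, ω f * edgeMat p f x = 0 := fun x => by
    have := congrFun hω x
    simpa using this
  have hone : ∀ u, u = i ∨ u = j → p u (Fin.last t) = 1 := fun u hu => by
    by_cases huv : u = v
    · rw [huv, pvl]
    · rw [pl u huv, if_pos hu]
  -- The corner entry of an edge is twice the product of the last coordinates of its ends, which is
  -- nonzero on `ij` only.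
  have h1 : ω s(i, j) = 0 := by
    have h := hco (Fin.last t, Fin.last t)
    rw [Finset.sum_eq_single_of_mem _ he] at h
    · rw [edgeMat_mk, hone i (.inl rfl), hone j (.inr rfl)] at h
      linarith
    · intro f hf hne
      have hf0 : f ∈ E₀ := by rw [hE₀]; exact mem_erase.2 ⟨hne, hf⟩
      induction f with
      | _ a b =>
        have hab : a ≠ b := by rintro rfl; exact hE _ hf
        have hprod : p a (Fin.last t) * p b (Fin.last t) = 0 := by
          by_cases hav : a = v
          · subst hav
            rw [pl b hab.symm, if_neg]
            · simp
            · rintro (rfl | rfl)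
              · exact hi (by simpa using hf0)
              · exact hj (by simpa using hf0)
          · by_cases hbv : b = v
            · subst hbv
              rw [pl a hab, if_neg]
              · simp
              · rintro (rfl | rfl)
                · exact hi (by rw [mem_nb, Sym2.eq_swap]; exact hf0)
                · exact hj (by rw [mem_nb, Sym2.eq_swap]; exact hf0)
            · rw [pl a hav, pl b hbv]
              by_cases ha : a = i ∨ a = j
              · by_cases hb : b = i ∨ b = j
                · exfalso
                  apply hne
                  rcases ha with rfl | rfl <;> rcases hb with rfl | rfl
                  · exact absurd rfl hab
                  · rfl
                  · exact Sym2.eq_swap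
                  · exact absurd rfl hab
                · simp [hb]
              · simp [ha]
        rw [edgeMat_mk]
        linear_combination (2 * ω s(a, b)) * hprod
  have hco' : ∀ x, ∑ f ∈ del E₀ v, ω f * edgeMat p f x +
      ∑ u ∈ nb E₀ v, ω s(v, u) * edgeMat p s(v, u) x = 0 := fun x => by
    have h := hco x
    rw [← Finset.add_sum_erase _ _ he, h1, zero_mul, zero_add, ← hE₀,
      ← Finset.sum_filter_add_sum_filter_not _ (v ∈ ·), filter_mem_eq_image,
      Finset.sum_image (fun _ _ _ _ h => mk_injective v h)] at h
    rw [add_comm]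
    exact h
  have hnv : ∀ u ∈ nb E₀ v, u ≠ v := by
    rintro u hu rfl
    exact hE u (erase_subset _ _ (mem_nb.1 hu))
  -- The leading block does not see edges at `v`, and on the others it is the realisation `q`.
  -- Afterwards the last column of an edge `vu` is `q u`, and at most `t` generic points are
  -- independent.
  have h2 : ∀ f ∈ del E₀ v, ω f = 0 := by
    refine linearIndepOn_finset_iff.1 hR' ω ?_
    funext ⟨a, b⟩
    have h := hco' (a.castSucc, b.castSucc)
    rw [Finset.sum_eq_zero (s := nb E₀ v), add_zero] at h
    · simp only [Finset.sum_apply, Pi.smul_apply, smul_eq_mul, Pi.zero_apply]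
      rw [← h]
      refine Finset.sum_congr rfl fun f hf => ?_
      have hvf := (mem_del.1 hf).2
      induction f with
      | _ c d =>
        have hc : c ≠ v := by rintro rfl; simp at hvf
        have hd : d ≠ v := by rintro rfl; simp at hvf
        simp [pc c hc, pc d hd]
    · intro u hu
      simp [pvc]
  have h3 : ∀ u ∈ nb E₀ v, ω s(v, u) = 0 := by
    refine linearIndepOn_finset_iff.1 hN' (fun u => ω s(v, u)) ?_
    funext a
    have h := hco' (a.castSucc, Fin.last t)
    rw [Finset.sum_eq_zero (s := del E₀ v), zero_add] at h
    · simp only [Finset.sum_apply, Pi.smul_apply, smul_eq_mul, Pi.zero_apply]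
      rw [← h]
      refine Finset.sum_congr rfl fun u hu => ?_
      simp [pvc, pvl, pc u (hnv u hu)]
    · intro f hf
      rw [h2 f hf, zero_mul]
  intro f hf
  by_cases hfe : f = s(i, j)
  · rw [hfe, h1]
  · have hf0 : f ∈ E₀ := by rw [hE₀]; exact mem_erase.2 ⟨hfe, hf⟩
    by_cases hv : v ∈ f
    · obtain ⟨u, rfl⟩ := hv
      exact h3 u (mem_nb.2 hf0)
    · exact h2 f (mem_del.2 ⟨hf0, hv⟩)

/-- A dimension count: the span of `g` on `s` contains `#s` independent vectors, so the `#s` vectors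
`g a` generating it are independent. -/
lemma linearIndepOn_of_mem_span {α W : Type*} [AddCommGroup W] [Module ℝ W] {s : Finset α}
    {f g : α → W} (hf : LinearIndepOn ℝ f (s : Set α))
    (h : ∀ a ∈ s, f a ∈ Submodule.span ℝ (g '' (s : Set α))) : LinearIndepOn ℝ g (s : Set α) := by
  rw [LinearIndepOn, linearIndependent_iff_card_le_finrank_span]
  have h1 := finrank_span_eq_card (R := ℝ) (b := fun x : (s : Set α) => f x) hf
  rw [← h1, Set.finrank, ← Set.image_eq_range, ← Set.image_eq_range]
  have : FiniteDimensional ℝ (Submodule.span ℝ (g '' (s : Set α))) :=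
    FiniteDimensional.span_of_finite ℝ (s.finite_toSet.image g)
  apply Submodule.finrank_mono
  rw [Submodule.span_le]
  rintro _ ⟨a, ha, rfl⟩
  exact h a ha

/-- The edges at `v` whose other end is not adjacent to `w`. -/
def moved (E : Finset (Sym2 ℕ)) (v w : ℕ) : Finset (Sym2 ℕ) :=
  (nb E v \ nb E w).image (fun u => s(v, u))

/-- Replace each edge `vu` with `u` not adjacent to `w` by `wu`. -/
def shift (E : Finset (Sym2 ℕ)) (v w : ℕ) : Finset (Sym2 ℕ) :=
  (E \ moved E v w) ∪ (nb E v \ nb E w).image (fun u => s(w, u))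

/-- The edge map underlying `shift`. -/
def shiftEdge (E : Finset (Sym2 ℕ)) (v w : ℕ) (f : Sym2 ℕ) : Sym2 ℕ :=
  if f ∈ moved E v w then f.map (fun x => if x = v then w else x) else f

lemma shiftEdge_of_mem {E : Finset (Sym2 ℕ)} (hE : NoLoop E) {v w u : ℕ}
    (hu : u ∈ nb E v \ nb E w) : shiftEdge E v w s(v, u) = s(w, u) := by
  have h1 : s(v, u) ∈ moved E v w := mem_image_of_mem _ hu
  have h2 : u ≠ v := by
    rintro rfl
    exact hE.notMem_nb u (mem_sdiff.1 hu).1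
  simp [shiftEdge, h1, h2]

lemma image_shiftEdge {E : Finset (Sym2 ℕ)} (hE : NoLoop E) (v w : ℕ) :
    E.image (shiftEdge E v w) = shift E v w := by
  ext f
  simp only [mem_image, shift, mem_union, mem_sdiff]
  constructor
  · rintro ⟨g, hg, rfl⟩
    by_cases hm : g ∈ moved E v w
    · right
      simp only [moved, mem_image] at hm
      obtain ⟨u, hu, rfl⟩ := hm
      exact ⟨u, by simpa using hu, (shiftEdge_of_mem hE hu).symm⟩
    · left
      simp only [shiftEdge, hm, if_false]
      exact ⟨hg, not_false⟩
  · rintro (⟨hf, hm⟩ | ⟨u, hu, rfl⟩)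
    · exact ⟨f, hf, by simp [shiftEdge, hm]⟩
    · exact ⟨s(v, u), by simpa using hu.1, shiftEdge_of_mem hE (by simpa using hu)⟩

lemma shiftEdge_injOn {E : Finset (Sym2 ℕ)} (hE : NoLoop E) (v w : ℕ) :
    Set.InjOn (shiftEdge E v w) (E : Set (Sym2 ℕ)) := by
  intro f hf g hg h
  have key : ∀ f ∈ E, ∀ u ∈ nb E v \ nb E w, f ∉ moved E v w →
      shiftEdge E v w f ≠ shiftEdge E v w s(v, u) := by
    intro f hf u hu hfm h
    rw [shiftEdge_of_mem hE hu, shiftEdge, if_neg hfm] at h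
    rw [h] at hf
    exact (mem_sdiff.1 hu).2 (mem_nb.2 hf)
  by_cases hfm : f ∈ moved E v w <;> by_cases hgm : g ∈ moved E v w
  · obtain ⟨a, ha, rfl⟩ := mem_image.1 hfm
    obtain ⟨b, hb, rfl⟩ := mem_image.1 hgm
    rw [shiftEdge_of_mem hE ha, shiftEdge_of_mem hE hb] at h
    rw [mk_injective w h]
  · obtain ⟨a, ha, rfl⟩ := mem_image.1 hfm
    exact absurd h.symm (key g hg a ha hgm)
  · obtain ⟨b, hb, rfl⟩ := mem_image.1 hgm
    exact absurd h (key f hf b hb hfm)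
  · simpa [shiftEdge, hfm, hgm] using h

lemma card_shift {E : Finset (Sym2 ℕ)} (hE : NoLoop E) (v w : ℕ) : #(shift E v w) = #E := by
  rw [← image_shiftEdge hE, card_image_of_injOn (shiftEdge_injOn hE v w)]

/-- Moving the point of `v` towards the point of `w` degenerates `E` to `shift E v w`. -/
lemma TIndep.of_shift {t : ℕ} {E : Finset (Sym2 ℕ)} (hE : NoLoop E) {v w : ℕ} (hvw : v ≠ w)
    (hn : s(v, w) ∉ E) (h : TIndep t (shift E v w)) : TIndep t E := by
  classical
  obtain ⟨p, hp⟩ := h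
  -- At `ε = 0` these are the vectors of `shift E v w`. Linear independence is an open condition, so
  -- it survives for some `ε ≠ 0`.
  let k : ℝ → Sym2 ℕ → (Fin t × Fin t → ℝ) := fun ε f =>
    edgeMat p (shiftEdge E v w f) + ε • (if f ∈ moved E v w then edgeMat p f else 0)
  have hk0 : LinearIndependent ℝ (fun f : (E : Set (Sym2 ℕ)) => k 0 f) := by
    rw [← image_shiftEdge hE, coe_image] at hp
    have h2 : LinearIndepOn ℝ (edgeMat p ∘ shiftEdge E v w) (E : Set (Sym2 ℕ)) :=
      hp.comp_of_image (shiftEdge_injOn hE v w)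
    simp only [k, zero_smul, add_zero]
    exact h2
  have hcont : Filter.Tendsto (fun ε : ℝ => fun f : (E : Set (Sym2 ℕ)) => k ε f) (nhds 0)
      (nhds (fun f : (E : Set (Sym2 ℕ)) => k 0 f)) := by
    have : Continuous (fun ε : ℝ => fun f : (E : Set (Sym2 ℕ)) => k ε f) := by
      apply continuous_pi
      intro f
      simp only [k]
      fun_prop
    exact this.tendsto 0
  have hev := hcont.eventually hk0.eventually
  obtain ⟨ε, hε, hε0⟩ : ∃ ε : ℝ, LinearIndependent ℝ (fun f : (E : Set (Sym2 ℕ)) => k ε f) ∧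
      ε ≠ 0 := by
    have h1 := hev.filter_mono (nhdsWithin_le_nhds (s := {0}ᶜ))
    exact (h1.and self_mem_nhdsWithin).exists
  let r : ℕ → Fin t → ℝ := Function.update p v (p w + ε • p v)
  have hr : ∀ u, u ≠ v → edgeMat r s(v, u) = edgeMat p s(w, u) + ε • edgeMat p s(v, u) := by
    intro u hu
    funext x
    simp [r, hu]
    ring
  have hr' : ∀ f, v ∉ f → edgeMat r f = edgeMat p f := by
    intro f hf
    induction f with
    | _ a b =>
      have ha : a ≠ v := by rintro rfl; simp at hf
      have hb : b ≠ v := by rintro rfl; simp at hf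
      funext x
      simp [r, ha, hb]
  have hsame : ∀ f ∈ E, v ∉ f → k ε f = edgeMat r f := by
    intro f hf hv
    have hm : f ∉ moved E v w := by
      intro hm
      obtain ⟨u, -, rfl⟩ := mem_image.1 hm
      simp at hv
    simp [k, hm, shiftEdge, hr' f hv]
  refine ⟨r, linearIndepOn_of_mem_span (f := k ε) hε fun f hf => ?_⟩
  have hmem : ∀ g ∈ E, edgeMat r g ∈ Submodule.span ℝ (edgeMat r '' (E : Set (Sym2 ℕ))) :=
    fun g hg => Submodule.subset_span ⟨g, hg, rfl⟩
  by_cases hv : v ∈ f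
  · obtain ⟨u, rfl⟩ := hv
    have huv : u ≠ v := by rintro rfl; exact hE _ hf
    by_cases hw : s(w, u) ∈ E
    · have hm : s(v, u) ∉ moved E v w := by
        intro hm
        obtain ⟨a, ha, h⟩ := mem_image.1 hm
        obtain rfl := mk_injective v h
        exact (mem_sdiff.1 ha).2 (mem_nb.2 hw)
      -- When `u` is adjacent to both `v` and `w`, the edge `vu` is not moved; its old vector is
      -- recovered as a difference quotient of the two new ones.
      have h1 : k ε s(v, u) = ε⁻¹ • (edgeMat r s(v, u) - edgeMat r s(w, u)) := by
        have hv' : v ∉ s(w, u) := by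
          simp [hvw, huv.symm]
        rw [hr u huv, hr' _ hv', add_sub_cancel_left, smul_smul, inv_mul_cancel₀ hε0, one_smul]
        simp [k, hm, shiftEdge]
      rw [h1]
      exact Submodule.smul_mem _ _ (Submodule.sub_mem _ (hmem _ hf) (hmem _ hw))
    · have hu : u ∈ nb E v \ nb E w := by
        simp only [mem_sdiff, mem_nb]
        exact ⟨hf, hw⟩
      have h1 : k ε s(v, u) = edgeMat r s(v, u) := by
        have hm : s(v, u) ∈ moved E v w := mem_image_of_mem _ hu
        rw [hr u huv]
        simp only [k]
        rw [shiftEdge_of_mem hE hu, if_pos hm]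
      rw [h1]
      exact hmem _ hf
  · rw [hsame f hf hv]
    exact hmem _ hf

/-- If `R` minus some edge is independent and `R` is not, every edge of some dependent subset of
`R` may be removed instead. -/
lemma exists_circuit {t : ℕ} {R : Finset (Sym2 ℕ)} {e : Sym2 ℕ} (he : e ∈ R)
    (h : TIndep t (R.erase e)) (hR : ¬ TIndep t R) :
    ∃ C ⊆ R, ¬ TIndep t C ∧ ∀ f ∈ C, TIndep t (R.erase f) := by
  classical
  obtain ⟨p, hp⟩ := exists_isGeneric_nat t
  let M := linearMatroid (R : Set (Sym2 ℕ)) R.finite_toSet (edgeMat p)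
  have hM : ∀ F : Finset (Sym2 ℕ), F ⊆ R → (M.Indep (F : Set (Sym2 ℕ)) ↔ TIndep t F) := by
    intro F hF
    refine ⟨fun h => ⟨p, h.2⟩, fun h => ⟨by exact_mod_cast hF, h.generic hp⟩⟩
  have hI : M.Indep ((R.erase e : Finset _) : Set (Sym2 ℕ)) := (hM _ (erase_subset _ _)).2 h
  have heI : e ∉ ((R.erase e : Finset _) : Set (Sym2 ℕ)) := by simp
  have hins : insert e ((R.erase e : Finset _) : Set (Sym2 ℕ)) = (R : Set (Sym2 ℕ)) := by
    rw [← coe_insert, insert_erase he]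
  have hdep : ¬ M.Indep (insert e ((R.erase e : Finset _) : Set (Sym2 ℕ))) := by
    rw [hins, hM R subset_rfl]
    exact hR
  have hcl : e ∈ M.closure ((R.erase e : Finset _) : Set (Sym2 ℕ)) := by
    rw [hI.mem_closure_iff]
    left
    exact ⟨hdep, by rw [hins]; exact subset_rfl⟩
  have hsub : M.fundCircuit e ((R.erase e : Finset _) : Set (Sym2 ℕ)) ⊆ (R : Set (Sym2 ℕ)) := by
    refine (M.fundCircuit_subset_insert e _).trans ?_
    rw [hins]
  -- The witness is the fundamental circuit of `e`: exchanging `e` for any of its elements keeps the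
  -- set independent.
  refine ⟨R.filter (· ∈ M.fundCircuit e ((R.erase e : Finset _) : Set (Sym2 ℕ))),
    filter_subset _ _, ?_, ?_⟩
  · rw [← hM _ (filter_subset _ _)]
    have hc := hI.fundCircuit_isCircuit hcl heI
    have : ((R.filter (· ∈ M.fundCircuit e ((R.erase e : Finset _) : Set (Sym2 ℕ)))) :
        Set (Sym2 ℕ)) = M.fundCircuit e ((R.erase e : Finset _) : Set (Sym2 ℕ)) := by
      ext f
      simp only [coe_filter, Set.mem_ofPred_eq, and_iff_right_iff_imp]
      exact fun hf => hsub hf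
    rw [this]
    exact hc.not_indep
  · intro f hf
    have hf' := (mem_filter.1 hf).2
    rw [hI.mem_fundCircuit_iff hcl heI, hins] at hf'
    rw [← hM _ (erase_subset _ _)]
    simpa using hf'

lemma dg_mono {E F : Finset (Sym2 ℕ)} (h : F ⊆ E) (v : ℕ) : dg F v ≤ dg E v :=
  card_le_card fun _ hu => mem_nb.2 (h (mem_nb.1 hu))

lemma del_mono {E F : Finset (Sym2 ℕ)} (h : F ⊆ E) (v : ℕ) : del F v ⊆ del E v :=
  filter_subset_filter _ h

/-- Some vertex beyond any given finite set. -/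
lemma exists_fresh (E : Finset (Sym2 ℕ)) (w : ℕ) : ∃ z, z ≠ w ∧ ∀ f ∈ E, z ∉ f := by
  obtain ⟨z, hz⟩ := Infinite.exists_notMem_finset (insert w (E.biUnion Sym2.toFinset))
  simp only [mem_insert, mem_biUnion, not_or, not_exists, not_and, Sym2.mem_toFinset] at hz
  exact ⟨z, hz.1, hz.2⟩

lemma NoLoop.insert {E : Finset (Sym2 ℕ)} (hE : NoLoop E) {a b : ℕ} (h : a ≠ b) :
    NoLoop (insert s(a, b) E) := by
  intro v hv
  rcases mem_insert.1 hv with hv | hv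
  · rw [Sym2.eq_iff] at hv
    rcases hv with ⟨rfl, rfl⟩ | ⟨rfl, rfl⟩ <;> exact h rfl
  · exact hE v hv

/-- Here the free edge of `TIndep.extend` is taken at `v` itself, which raises the admissible degree
from `t` to `t + 1`. If `v` has smaller degree, a pendant edge to a fresh vertex plays that role and
is discarded afterwards. -/
lemma TIndep.cone {t : ℕ} {E : Finset (Sym2 ℕ)} (hE : NoLoop E) {v : ℕ} (hd : dg E v ≤ t + 1)
    (h : TIndep t (del E v)) : TIndep (t + 1) E := by
  rcases hd.lt_or_eq with hd | hd
  · obtain ⟨z, hz, hzE⟩ := exists_fresh E v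
    have hnot : s(v, z) ∉ E := fun h => hzE _ h (by simp)
    have her : (insert s(v, z) E).erase s(v, z) = E := erase_insert hnot
    refine TIndep.mono (TIndep.extend (hE.insert hz.symm) v v z (mem_insert_self _ _) ?_ ?_ ?_ ?_)
      (subset_insert s(v, z) E)
    · rw [her]; omega
    · rw [her]; exact hE.notMem_nb v
    · rw [her]; simpa using hnot
    · rw [her]; exact h
  · obtain ⟨u, hu⟩ : (nb E v).Nonempty := by
      rw [← card_pos]; simp only [dg] at hd; omega
    have huE := mem_nb.1 hu
    have hnb : nb (E.erase s(v, u)) v = (nb E v).erase u := by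
      ext x
      simp only [mem_nb, mem_erase, ne_eq]
      rw [Sym2.congr_right]
    refine TIndep.extend hE v v u huE ?_ ?_ ?_ ?_
    · rw [dg, hnb, card_erase_of_mem hu]
      simp only [dg] at hd; omega
    · exact fun h => hE.notMem_nb v (by rw [hnb] at h; exact mem_of_mem_erase h)
    · rw [hnb]; simp
    · exact h.mono (del_mono (erase_subset _ _) v)

/-- Induction step at a vertex of degree at most `t`. -/
lemma TIndep.step {t : ℕ} {E : Finset (Sym2 ℕ)} (hE : NoLoop E) {v : ℕ} (hd : dg E v ≤ t)
    (h1 : TIndep t (del E v) ∨ ∃ e ∈ del E v, TIndep t ((del E v).erase e))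
    (h2 : ∀ C ⊆ del E v, ¬ TIndep t C → ∃ f ∈ C, ∀ u ∈ nb E v, u ∉ f) : TIndep (t + 1) E := by
  by_cases hR : TIndep t (del E v)
  · exact TIndep.cone hE (by omega) hR
  -- The circuit inside `E - v` is broken at an edge with no end adjacent to `v`; that edge comes
  -- back as the free edge of `TIndep.extend`.
  obtain ⟨e, he, h⟩ := h1.resolve_left hR
  obtain ⟨C, hC, hCn, hCe⟩ := exists_circuit he h hR
  obtain ⟨f, hf, hfN⟩ := h2 C hC hCn
  have hfR := mem_del.1 (hC hf)
  induction f with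
  | _ i j =>
    have hdel : del (E.erase s(i, j)) v = (del E v).erase s(i, j) := by
      simp only [del, filter_erase]
    have hnb : nb (E.erase s(i, j)) v = nb E v := by
      ext x
      simp only [mem_nb, mem_erase, ne_eq, and_iff_right_iff_imp]
      rintro - h
      exact hfR.2 (by rw [← h]; simp)
    refine TIndep.extend hE v i j hfR.1 (by rwa [dg, hnb]) ?_ ?_ ?_
    · rw [hnb]; exact fun h => hfN i h (by simp)
    · rw [hnb]; exact fun h => hfN j h (by simp)
    · rw [hdel]; exact hCe _ hf

/-! ### Degrees -/

lemma nb_mono {E F : Finset (Sym2 ℕ)} (h : F ⊆ E) (v : ℕ) : nb F v ⊆ nb E v :=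
  fun _ hu => mem_nb.2 (h (mem_nb.1 hu))

lemma nb_del_self (E : Finset (Sym2 ℕ)) (x : ℕ) : nb (del E x) x = ∅ := by
  ext u; simp

lemma dg_del_self (E : Finset (Sym2 ℕ)) (x : ℕ) : dg (del E x) x = 0 := by
  simp [dg, nb_del_self]

lemma nb_del {E : Finset (Sym2 ℕ)} {x y : ℕ} (h : x ≠ y) : nb (del E x) y = (nb E y).erase x := by
  ext u
  simp only [mem_nb, mem_del, Sym2.mem_iff, not_or, mem_erase]
  tauto

lemma dg_del_of_notMem {E : Finset (Sym2 ℕ)} {x y : ℕ} (hxy : x ≠ y) (h : s(x, y) ∉ E) :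
    dg (del E x) y = dg E y := by
  rw [dg, nb_del hxy, erase_eq_of_notMem, dg]
  rw [mem_nb, Sym2.eq_swap]
  exact h

lemma dg_del_of_mem {E : Finset (Sym2 ℕ)} {x y : ℕ} (hxy : x ≠ y) (h : s(x, y) ∈ E) :
    dg (del E x) y + 1 = dg E y := by
  rw [dg, nb_del hxy, dg, card_erase_add_one]
  rw [mem_nb, Sym2.eq_swap]
  exact h

lemma dg_del_le (E : Finset (Sym2 ℕ)) (x y : ℕ) : dg (del E x) y ≤ dg E y :=
  dg_mono (del_subset E x) y

lemma nb_erase (E : Finset (Sym2 ℕ)) (v u : ℕ) : nb (E.erase s(v, u)) v = (nb E v).erase u := by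
  ext x
  simp only [mem_nb, mem_erase, ne_eq]
  rw [Sym2.congr_right]

lemma dg_erase_add_one {E : Finset (Sym2 ℕ)} {v u : ℕ} (h : s(v, u) ∈ E) :
    dg (E.erase s(v, u)) v + 1 = dg E v := by
  rw [dg, nb_erase, card_erase_add_one (mem_nb.2 h), dg]

lemma del_erase (E : Finset (Sym2 ℕ)) (f : Sym2 ℕ) (v : ℕ) :
    del (E.erase f) v = (del E v).erase f := by
  simp only [del, filter_erase]

lemma del_erase_of_mem (E : Finset (Sym2 ℕ)) {f : Sym2 ℕ} {v : ℕ} (h : v ∈ f) :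
    del (E.erase f) v = del E v := by
  rw [del_erase, erase_eq_of_notMem]
  simp [h]

lemma exists_mk_mem {E : Finset (Sym2 ℕ)} {v : ℕ} (h : 0 < dg E v) : ∃ u, s(v, u) ∈ E := by
  obtain ⟨u, hu⟩ := card_pos.1 h
  exact ⟨u, mem_nb.1 hu⟩

lemma dg_pos {E : Finset (Sym2 ℕ)} {v u : ℕ} (h : s(v, u) ∈ E) : 0 < dg E v :=
  card_pos.2 ⟨u, mem_nb.2 h⟩

lemma eq_empty_of_dg_eq_zero {E : Finset (Sym2 ℕ)} (h : ∀ v, dg E v = 0) : E = ∅ := by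
  rw [eq_empty_iff_forall_notMem]
  intro f hf
  induction f with
  | _ a b => exact (dg_pos hf).ne' (h a)

lemma dg_le_card (E : Finset (Sym2 ℕ)) (v : ℕ) : dg E v ≤ #E := by
  have := card_del_add_dg E v
  omega

/-- A neighbour of `v` loses at least one edge when `v` is deleted. -/
lemma dg_add_one_le_of_mem_nb {E C : Finset (Sym2 ℕ)} (hE : NoLoop E) {v u : ℕ}
    (hC : C ⊆ del E v) (hu : u ∈ nb E v) : dg C u + 1 ≤ dg E u := by
  have h1 := dg_mono hC u
  have h2 : v ≠ u := by rintro rfl; exact hE.notMem_nb _ hu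
  have h3 := dg_del_of_mem h2 (mem_nb.1 hu)
  omega

lemma card_le_sum_of_cover {C : Finset (Sym2 ℕ)} {B : Finset ℕ}
    (h : ∀ f ∈ C, ∃ u ∈ B, u ∈ f) : #C ≤ ∑ u ∈ B, dg C u := by
  have : C ⊆ B.biUnion (fun u => C.filter (u ∈ ·)) := by
    intro f hf
    obtain ⟨u, hu, huf⟩ := h f hf
    exact mem_biUnion.2 ⟨u, hu, mem_filter.2 ⟨hf, huf⟩⟩
  refine (card_le_card this).trans (card_biUnion_le.trans (sum_le_sum fun u _ => ?_))
  rw [filter_mem_eq_image]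
  exact card_image_le

lemma nb_subset_of_cover {C : Finset (Sym2 ℕ)} {B : Finset ℕ}
    (h : ∀ f ∈ C, ∃ u ∈ B, u ∈ f) {x : ℕ} (hx : x ∉ B) : nb C x ⊆ B := by
  intro u hu
  obtain ⟨b, hb, hbf⟩ := h _ (mem_nb.1 hu)
  rcases Sym2.mem_iff.1 hbf with rfl | rfl
  · exact absurd hb hx
  · exact hb

/-! ### Adding an edge and shifting -/

lemma mem_shift {E : Finset (Sym2 ℕ)} {v w : ℕ} {f : Sym2 ℕ} :
    f ∈ shift E v w ↔ (f ∈ E ∧ ¬ ∃ u, s(v, u) ∈ E ∧ s(w, u) ∉ E ∧ f = s(v, u)) ∨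
      ∃ u, s(v, u) ∈ E ∧ s(w, u) ∉ E ∧ f = s(w, u) := by
  simp only [shift, moved, mem_union, mem_sdiff, mem_image, mem_nb, and_assoc, eq_comm]

lemma nb_shift_right {E : Finset (Sym2 ℕ)} {v w : ℕ} (hvw : v ≠ w)
    (hn : s(v, w) ∉ E) : nb (shift E v w) w = nb E v ∪ nb E w := by
  ext x
  simp only [mem_nb, mem_shift, mem_union]
  constructor
  · rintro (⟨h, -⟩ | ⟨u, h1, -, h3⟩)
    · exact .inr h
    · rw [Sym2.congr_right] at h3
      subst h3
      exact .inl h1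
  · intro h
    by_cases hw : s(w, x) ∈ E
    · refine .inl ⟨hw, ?_⟩
      rintro ⟨u, h1, h2, h3⟩
      rw [Sym2.eq_iff] at h3
      rcases h3 with ⟨rfl, -⟩ | ⟨rfl, rfl⟩
      · exact hvw rfl
      · exact hn h1
    · exact .inr ⟨x, h.resolve_right hw, hw, rfl⟩

lemma nb_shift_left {E : Finset (Sym2 ℕ)} (hE : NoLoop E) {v w : ℕ} (hvw : v ≠ w) :
    nb (shift E v w) v = nb E v ∩ nb E w := by
  ext x
  simp only [mem_nb, mem_shift, mem_inter]
  constructor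
  · rintro (⟨h, h2⟩ | ⟨u, h1, h2, h3⟩)
    · refine ⟨h, ?_⟩
      by_contra hw
      exact h2 ⟨x, h, hw, rfl⟩
    · rw [Sym2.eq_iff] at h3
      rcases h3 with ⟨rfl, -⟩ | ⟨rfl, rfl⟩
      · exact absurd rfl hvw
      · exact absurd h1 (hE _)
  · rintro ⟨h1, h2⟩
    refine .inl ⟨h1, ?_⟩
    rintro ⟨u, h3, h4, h5⟩
    rw [Sym2.congr_right] at h5
    subst h5
    exact h4 h2

lemma mem_of_mem_shift {E : Finset (Sym2 ℕ)} {v w : ℕ} {f : Sym2 ℕ} (hf : f ∈ shift E v w)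
    (hw : w ∉ f) : f ∈ E := by
  rcases mem_shift.1 hf with h | ⟨u, -, -, rfl⟩
  · exact h.1
  · simp at hw

lemma dg_shift_le {E : Finset (Sym2 ℕ)} {v w u : ℕ} (huw : u ≠ w) (huv : u ≠ v) :
    dg (shift E v w) u ≤ dg E u := by
  by_cases h : s(v, u) ∈ E ∧ s(w, u) ∉ E
  · have hsub : nb (shift E v w) u ⊆ insert w ((nb E u).erase v) := by
      intro x hx
      simp only [mem_nb, mem_shift] at hx
      simp only [mem_insert, mem_erase, mem_nb]
      rcases hx with ⟨h1, h2⟩ | ⟨a, -, -, h3⟩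
      · right
        refine ⟨?_, h1⟩
        rintro rfl
        exact h2 ⟨u, h.1, h.2, Sym2.eq_swap⟩
      · rw [Sym2.eq_iff] at h3
        rcases h3 with ⟨rfl, -⟩ | ⟨-, rfl⟩
        · exact absurd rfl huw
        · exact .inl rfl
    refine (card_le_card hsub).trans ((card_insert_le _ _).trans ?_)
    rw [card_erase_add_one (by rw [mem_nb, Sym2.eq_swap]; exact h.1), dg]
  · refine card_le_card fun x hx => ?_
    simp only [mem_nb, mem_shift] at hx ⊢
    rcases hx with ⟨h1, -⟩ | ⟨a, h1, h2, h3⟩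
    · exact h1
    · rw [Sym2.eq_iff] at h3
      rcases h3 with ⟨rfl, -⟩ | ⟨rfl, rfl⟩
      · exact absurd rfl huw
      · exact absurd ⟨h1, h2⟩ h

lemma dg_shift_left_le {E : Finset (Sym2 ℕ)} (hE : NoLoop E) {v w : ℕ} (hvw : v ≠ w) :
    dg (shift E v w) v ≤ dg E v := by
  rw [dg, nb_shift_left hE hvw]
  exact card_le_card inter_subset_left

lemma dg_shift_le_of_ne {E : Finset (Sym2 ℕ)} (hE : NoLoop E) {v w u : ℕ} (hvw : v ≠ w)
    (huw : u ≠ w) : dg (shift E v w) u ≤ dg E u := by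
  by_cases huv : u = v
  · subst huv
    exact dg_shift_left_le hE hvw
  · exact dg_shift_le huw huv

lemma NoLoop.shift {E : Finset (Sym2 ℕ)} (hE : NoLoop E) {v w : ℕ}
    (hn : s(v, w) ∉ E) : NoLoop (shift E v w) := by
  intro x hx
  rcases mem_shift.1 hx with h | ⟨u, h1, -, h2⟩
  · exact hE x h.1
  · rw [Sym2.eq_iff] at h2
    rcases h2 with ⟨rfl, rfl⟩ | ⟨rfl, rfl⟩ <;> exact hn h1

/-- An edge with no end in the closed neighbourhood of `w`. -/
lemma exists_far_edge {E : Finset (Sym2 ℕ)} {w k : ℕ} (hk : ∀ u, dg E u ≤ k)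
    (hw : 0 < dg E w) (hE : k * k < #E) :
    ∃ v v', s(v, v') ∈ E ∧ v ≠ w ∧ v' ≠ w ∧ v ∉ nb E w ∧ v' ∉ nb E w := by
  by_contra! hcon
  -- Otherwise the at most `k` neighbours of `w` cover every edge, including those at `w`, which
  -- allows at most `k * k` edges.
  have hcov : ∀ f ∈ E, ∃ u ∈ nb E w, u ∈ f := by
    intro f hf
    induction f with
    | _ a b =>
      by_cases ha : a = w
      · subst ha
        exact ⟨b, mem_nb.2 hf, by simp⟩
      by_cases hb : b = w
      · subst hb
        exact ⟨a, by rw [mem_nb, Sym2.eq_swap]; exact hf, by simp⟩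
      by_cases ha' : a ∈ nb E w
      · exact ⟨a, ha', by simp⟩
      · exact ⟨b, hcon a b hf ha hb ha', by simp⟩
  have h1 := card_le_sum_of_cover hcov
  have h2 : ∑ u ∈ nb E w, dg E u ≤ #(nb E w) * k := by
    rw [← smul_eq_mul]
    exact sum_le_card_nsmul _ _ _ fun u _ => hk u
  have h3 : #(nb E w) * k ≤ k * k := Nat.mul_le_mul_right _ (hk w)
  omega

lemma dg_insert_fresh {E : Finset (Sym2 ℕ)} {w z : ℕ} (hz : z ≠ w) (hzE : ∀ f ∈ E, z ∉ f) :
    dg (insert s(w, z) E) w = dg E w + 1 ∧ ∀ u, u ≠ w → dg (insert s(w, z) E) u ≤ max 1 (dg E u) := by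
  have hnot : s(w, z) ∉ E := fun h => hzE _ h (by simp)
  constructor
  · have := dg_erase_add_one (mem_insert_self s(w, z) E)
    rw [erase_insert hnot] at this
    exact this.symm
  · intro u hu
    by_cases huz : u = z
    · subst huz
      have : nb (insert s(w, u) E) u ⊆ {w} := by
        intro x hx
        rw [mem_nb, mem_insert] at hx
        rcases hx with hx | hx
        · rw [Sym2.eq_iff] at hx
          rcases hx with ⟨rfl, rfl⟩ | ⟨-, rfl⟩ <;> simp
        · exact absurd (by simp) (hzE _ hx)
      exact (card_le_card this).trans (by simp)
    · have : nb (insert s(w, z) E) u ⊆ nb E u := by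
        intro x hx
        rw [mem_nb, mem_insert] at hx
        rcases hx with hx | hx
        · rw [Sym2.eq_iff] at hx
          rcases hx with ⟨rfl, rfl⟩ | ⟨rfl, rfl⟩ <;> contradiction
        · exact mem_nb.2 hx
      exact (card_le_card this).trans (le_max_right _ _)

/-- The degree of one vertex can be raised, at the cost of a more special edge set. -/
lemma exists_raise {E : Finset (Sym2 ℕ)} (hE : NoLoop E) {w k m : ℕ} (hk : ∀ u, dg E u ≤ k)
    (hk1 : 1 ≤ k) (hw : dg E w = k) (hm : #E ≤ m) (hkm : k * k < m) :
    ∃ E', NoLoop E' ∧ #E' ≤ m ∧ (∀ u, u ≠ w → dg E' u ≤ k) ∧ k + 1 ≤ dg E' w ∧ dg E' w ≤ 2 * k ∧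
      ∀ t, TIndep t E' → TIndep t E := by
  rcases hm.lt_or_eq with hlt | heq
  -- There is room for a pendant edge at `w`.
  · obtain ⟨z, hz, hzE⟩ := exists_fresh E w
    obtain ⟨h1, h2⟩ := dg_insert_fresh hz hzE
    refine ⟨insert s(w, z) E, hE.insert hz.symm, (card_insert_le _ _).trans hlt, ?_, by omega,
      by omega, fun t h => h.mono (subset_insert _ _)⟩
    intro u hu
    exact (h2 u hu).trans (max_le hk1 (hk u))
  -- No edge may be added, so `v` is shifted to `w`. This gives `w` the new neighbour `v'` and
  -- raises no other degree.
  · obtain ⟨v, v', hvE, hvw, hvw', hv, hv'⟩ := exists_far_edge (w := w) hk (by omega)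
      (by omega)
    have hn : s(v, w) ∉ E := by
      rw [Sym2.eq_swap]; simpa using hv
    refine ⟨shift E v w, hE.shift hn, (card_shift hE v w).trans_le hm, ?_, ?_, ?_,
      fun t h => h.of_shift hE hvw hn⟩
    · intro u hu
      exact (dg_shift_le_of_ne hE hvw hu).trans (hk u)
    · rw [dg, nb_shift_right hvw hn]
      have : insert v' (nb E w) ⊆ nb E v ∪ nb E w := by
        intro x hx
        rcases mem_insert.1 hx with rfl | hx
        · exact mem_union_left _ (mem_nb.2 hvE)
        · exact mem_union_right _ hx
      have h2 := card_le_card this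
      rw [card_insert_of_notMem hv'] at h2
      simp only [dg] at hw
      omega
    · rw [dg, nb_shift_right hvw hn]
      refine (card_union_le _ _).trans ?_
      have := hk v
      have := hk w
      simp only [dg] at *
      omega

/-! ### Sufficient conditions for independence, `t ≤ 4` -/

/-- All pairs in `A × B` are edges. -/
def CompleteBetween (E : Finset (Sym2 ℕ)) (A B : Finset ℕ) : Prop :=
  ∀ a ∈ A, ∀ b ∈ B, s(a, b) ∈ E

lemma CompleteBetween.symm {E : Finset (Sym2 ℕ)} {A B : Finset ℕ} (h : CompleteBetween E A B) :
    CompleteBetween E B A := fun b hb a ha => by rw [Sym2.eq_swap]; exact h a ha b hb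

lemma CompleteBetween.mono {E F : Finset (Sym2 ℕ)} {A B : Finset ℕ} (h : CompleteBetween E A B)
    (hF : E ⊆ F) : CompleteBetween F A B := fun a ha b hb => hF (h a ha b hb)

lemma CompleteBetween.subset_nb {E : Finset (Sym2 ℕ)} {A B : Finset ℕ} (h : CompleteBetween E A B)
    {a : ℕ} (ha : a ∈ A) : B ⊆ nb E a := fun b hb => mem_nb.2 (h a ha b hb)

lemma CompleteBetween.card_le {E : Finset (Sym2 ℕ)} {A B : Finset ℕ} (h : CompleteBetween E A B)
    {a : ℕ} (ha : a ∈ A) : #B ≤ dg E a := card_le_card (h.subset_nb ha)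

lemma tIndep_one {E : Finset (Sym2 ℕ)} (hE : NoLoop E) (h : #E ≤ 1) : TIndep 1 E := by
  rcases E.eq_empty_or_nonempty with rfl | ⟨f, hf⟩
  · exact tIndep_empty 1
  induction f with
  | _ a b =>
    refine TIndep.cone hE (v := a) ((dg_le_card E a).trans h) ?_
    have h1 := card_del_add_dg E a
    have h2 := dg_pos hf
    have : del E a = ∅ := by rw [← card_eq_zero]; omega
    rw [this]
    exact tIndep_empty 0

/-- A vertex of degree two is a cone vertex over at most one edge. Otherwise `E` is a matching, and
the neighbour of `v` covers nothing once `v` is deleted. -/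
lemma tIndep_two {E : Finset (Sym2 ℕ)} (hE : NoLoop E) (hd : ∀ v, dg E v ≤ 2) (h : #E ≤ 3) :
    TIndep 2 E := by
  by_cases h2 : ∃ v, dg E v = 2
  · obtain ⟨v, hv⟩ := h2
    refine TIndep.cone hE (hd v) (tIndep_one (hE.del v) ?_)
    have := card_del_add_dg E v
    omega
  have hd1 : ∀ v, dg E v ≤ 1 := fun v => by
    have := hd v
    have : dg E v ≠ 2 := fun h => h2 ⟨v, h⟩
    omega
  rcases E.eq_empty_or_nonempty with rfl | ⟨f, hf⟩
  · exact tIndep_empty 2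
  induction f with
  | _ v u =>
    have hc := card_del_add_dg E v
    have hp := dg_pos hf
    refine TIndep.step hE (hd1 v) ?_ ?_
    · rcases (del E v).eq_empty_or_nonempty with h0 | ⟨e, he⟩
      · rw [h0]; exact .inl (tIndep_empty 1)
      · refine .inr ⟨e, he, tIndep_one ((hE.del v).mono (erase_subset _ _)) ?_⟩
        rw [card_erase_of_mem he]
        omega
    · intro C hC hCn
      rcases C.eq_empty_or_nonempty with rfl | ⟨f, hf⟩
      · exact absurd (tIndep_empty 1) hCn
      refine ⟨f, hf, ?_⟩
      rintro x hx ⟨y, rfl⟩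
      have h1 := dg_add_one_le_of_mem_nb hE hC hx
      have h2 := hd1 x
      have h3 := dg_pos hf
      omega

/-- Deleting `v` leaves at most four edges. A dependent subset must contain four, but each of the
two neighbours of `v` covers at most one. -/
lemma tIndep_three_of_dg_two {E : Finset (Sym2 ℕ)} (hE : NoLoop E) (hd : ∀ v, dg E v ≤ 2)
    (h : #E ≤ 6) {v : ℕ} (hv : dg E v = 2) : TIndep 3 E := by
  have hc := card_del_add_dg E v
  refine TIndep.step hE (hd v) ?_ ?_
  · rcases (del E v).eq_empty_or_nonempty with h0 | ⟨e, he⟩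
    · rw [h0]; exact .inl (tIndep_empty 2)
    · refine .inr ⟨e, he, tIndep_two ((hE.del v).mono (erase_subset _ _)) (fun u => ?_) ?_⟩
      · exact (dg_mono ((erase_subset _ _).trans (del_subset E v)) u).trans (hd u)
      · rw [card_erase_of_mem he]; omega
  · intro C hC hCn
    by_contra! hcov
    have hC4 : 4 ≤ #C := by
      by_contra! h4
      exact hCn (tIndep_two ((hE.del v).mono hC)
        (fun u => (dg_mono (hC.trans (del_subset E v)) u).trans (hd u)) (by omega))
    have h1 := card_le_sum_of_cover hcov
    have h2 : ∑ u ∈ nb E v, dg C u ≤ #(nb E v) • 1 := sum_le_card_nsmul _ _ _ fun u hu => by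
      have := dg_add_one_le_of_mem_nb hE hC hu
      have := hd u
      omega
    have h3 : #(nb E v) = dg E v := rfl
    rw [smul_eq_mul] at h2
    omega

/-- The last hypothesis forbids two vertices that meet six edges; after a cone vertex of degree
three it becomes the degree bound of `tIndep_two`. If all degrees are at most one, a vertex is first
raised to degree two. -/
lemma tIndep_three {E : Finset (Sym2 ℕ)} (hE : NoLoop E) (hd : ∀ v, dg E v ≤ 3) (h : #E ≤ 6)
    (h2 : ∀ x y, dg E x + dg (del E x) y ≤ 5) : TIndep 3 E := by
  by_cases hv : ∃ v, dg E v = 3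
  · obtain ⟨v, hv⟩ := hv
    refine TIndep.cone hE (hd v) (tIndep_two (hE.del v) (fun u => ?_) ?_)
    · have := h2 v u; omega
    · have := card_del_add_dg E v; omega
  have hd2 : ∀ v, dg E v ≤ 2 := fun v => by
    have := hd v
    have : dg E v ≠ 3 := fun h => hv ⟨v, h⟩
    omega
  by_cases hv : ∃ v, dg E v = 2
  · obtain ⟨v, hv⟩ := hv
    exact tIndep_three_of_dg_two hE hd2 h hv
  have hd1 : ∀ v, dg E v ≤ 1 := fun v => by
    have := hd2 v
    have : dg E v ≠ 2 := fun h => hv ⟨v, h⟩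
    omega
  by_cases hv : ∃ v, dg E v = 1
  · obtain ⟨w, hw⟩ := hv
    obtain ⟨E', hE', hm, hu, hw1, hw2, hT⟩ := exists_raise hE hd1 le_rfl hw h (by norm_num)
    refine hT 3 (tIndep_three_of_dg_two hE' (fun u => ?_) hm (v := w) (by omega))
    by_cases huw : u = w
    · subst huw; omega
    · have := hu u huw; omega
  have : E = ∅ := eq_empty_of_dg_eq_zero fun v => by
    have := hd1 v
    have : dg E v ≠ 1 := fun h => hv ⟨v, h⟩
    omega
  rw [this]
  exact tIndep_empty 3

/-- Seven edges with maximum degree three are independent for `t = 3` up to one edge. -/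
lemma tIndep_three_erase {Q : Finset (Sym2 ℕ)} (hQ : NoLoop Q) (hd : ∀ v, dg Q v ≤ 3)
    (h : #Q ≤ 7) : TIndep 3 Q ∨ ∃ e ∈ Q, TIndep 3 (Q.erase e) := by
  rcases Q.eq_empty_or_nonempty with rfl | ⟨e, he⟩
  · exact .inl (tIndep_empty 3)
  right
  by_cases h2 : ∃ y z, 6 ≤ dg Q y + dg (del Q y) z
  -- Two vertices meeting six edges are nonadjacent and of degree three. Without one edge at `y` and
  -- the cone vertex `z`, at most three edges remain, two of them at `y`, so no vertex has degree
  -- three.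
  · obtain ⟨y, z, hyz⟩ := h2
    have hy := hd y
    have hz := hd z
    have hz' := dg_del_le Q y z
    have hne : y ≠ z := by
      rintro rfl
      rw [dg_del_self] at hyz
      omega
    have hnadj : s(y, z) ∉ Q := by
      intro hm
      have := dg_del_of_mem hne hm
      omega
    obtain ⟨u, hu⟩ := exists_mk_mem (E := Q) (v := y) (by omega)
    have huz : u ≠ z := by rintro rfl; exact hnadj hu
    refine ⟨s(y, u), hu, ?_⟩
    have hQ' := hQ.mono (erase_subset s(y, u) Q)
    refine TIndep.cone hQ' (v := z) ((dg_mono (erase_subset _ _) z).trans hz) ?_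
    have hzmem : s(y, u) ∈ del Q z := by
      simp [hu, hne.symm, huz.symm]
    set T := del (Q.erase s(y, u)) z with hT
    have hcT : #T ≤ 3 := by
      rw [hT, del_erase, card_erase_of_mem hzmem]
      have := card_del_add_dg Q z
      omega
    have hyT : dg T y = 2 := by
      have h1 : dg (Q.erase s(y, u)) y + 1 = dg Q y := dg_erase_add_one hu
      have h3 : dg T y = dg (Q.erase s(y, u)) y := by
        refine dg_del_of_notMem hne.symm fun hm => hnadj ?_
        rw [Sym2.eq_swap]
        exact mem_of_mem_erase hm
      omega
    refine tIndep_two (hQ'.del z) (fun c => ?_) hcT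
    by_contra! hc
    have hcy : c ≠ y := by rintro rfl; omega
    have h0 := card_del_add_dg T c
    have h1 := card_del_add_dg (del T c) y
    have h3 : dg T y ≤ dg (del T c) y + 1 := by
      by_cases hm : s(c, y) ∈ T
      · exact (dg_del_of_mem hcy hm).ge
      · rw [dg_del_of_notMem hcy hm]; omega
    omega
  · push Not at h2
    refine ⟨e, he, tIndep_three (hQ.mono (erase_subset _ _))
      (fun v => (dg_mono (erase_subset _ _) v).trans (hd v)) ?_ fun x y => ?_⟩
    · rw [card_erase_of_mem he]; omega
    · have h1 := h2 x y
      have h3 := dg_mono (erase_subset e Q) x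
      have h4 := dg_mono (del_mono (erase_subset e Q) x) y
      omega

/-- Only `w` may exceed degree `k`, as after raising or shifting; it is counted at most once because
deleting a vertex reduces its degree to zero. The same holds for the triple and quadruple versions.
-/
lemma dg_add_dg_del_le {E : Finset (Sym2 ℕ)} {w k K : ℕ} (hk : ∀ u, u ≠ w → dg E u ≤ k)
    (hw : dg E w ≤ K) (hkK : k ≤ K) (x y : ℕ) : dg E x + dg (del E x) y ≤ K + k := by
  by_cases hxy : x = y
  · subst hxy
    rw [dg_del_self]
    by_cases hx : x = w
    · subst hx; omega
    · have := hk x hx; omega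
  · have h := dg_del_le E x y
    by_cases hx : x = w
    · have := hk y (by rintro rfl; exact hxy hx)
      subst hx; omega
    · have := hk x hx
      by_cases hy : y = w
      · subst hy; omega
      · have := hk y hy; omega

lemma dg_del_le_of_le {E : Finset (Sym2 ℕ)} {w k : ℕ} (hk : ∀ u, u ≠ w → dg E u ≤ k) (x : ℕ) :
    ∀ u, u ≠ w → dg (del E x) u ≤ k := fun u hu => (dg_del_le E x u).trans (hk u hu)

lemma dg_triple_le {E : Finset (Sym2 ℕ)} {w k K : ℕ} (hk : ∀ u, u ≠ w → dg E u ≤ k)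
    (hw : dg E w ≤ K) (hkK : k ≤ K) (x y z : ℕ) :
    dg E x + dg (del E x) y + dg (del (del E x) y) z ≤ K + 2 * k := by
  by_cases hx : x = w
  · subst hx
    have h0 : ∀ u, dg (del E x) u ≤ k := fun u => by
      by_cases hu : u = x
      · subst hu; rw [dg_del_self]; omega
      · exact dg_del_le_of_le hk x u hu
    have h1 := h0 y
    have h2 := (dg_del_le (del E x) y z).trans (h0 z)
    omega
  · have h1 := dg_add_dg_del_le (dg_del_le_of_le hk x) ((dg_del_le E x w).trans hw) hkK y z
    have h2 := hk x hx
    omega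

lemma dg_quad_le {E : Finset (Sym2 ℕ)} {w k K : ℕ} (hk : ∀ u, u ≠ w → dg E u ≤ k)
    (hw : dg E w ≤ K) (hkK : k ≤ K) (x y z u : ℕ) :
    dg E x + dg (del E x) y + dg (del (del E x) y) z + dg (del (del (del E x) y) z) u
      ≤ K + 3 * k := by
  by_cases hx : x = w
  · subst hx
    have h0 : ∀ u, dg (del E x) u ≤ k := fun u => by
      by_cases hu : u = x
      · subst hu; rw [dg_del_self]; omega
      · exact dg_del_le_of_le hk x u hu
    have h1 := h0 y
    have h2 := (dg_del_le (del E x) y z).trans (h0 z)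
    have h3 := (dg_del_le _ z u).trans ((dg_del_le (del E x) y u).trans (h0 u))
    omega
  · have h1 := dg_triple_le (dg_del_le_of_le hk x) ((dg_del_le E x w).trans hw) hkK y z u
    have h2 := hk x hx
    omega

/-- The induction step for `t = 4` at a vertex of degree three. -/
lemma tIndep_four_of_dg_three {E : Finset (Sym2 ℕ)} (hE : NoLoop E) (hd : ∀ v, dg E v ≤ 3)
    (h : #E ≤ 10) (hK : ∀ A B, #A = 3 → #B = 3 → ¬ CompleteBetween E A B) {v : ℕ}
    (hv : dg E v = 3) : TIndep 4 E := by
  have hc := card_del_add_dg E v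
  refine TIndep.step hE (hd v) (tIndep_three_erase (hE.del v)
    (fun u => (dg_del_le E v u).trans (hd u)) (by omega)) ?_
  intro C hC hCn
  by_contra! hcov
  have hCE : C ⊆ E := hC.trans (del_subset E v)
  have hdC : ∀ u, dg C u ≤ 3 := fun u => (dg_mono hCE u).trans (hd u)
  -- Each of the three neighbours of `v` has lost its edge to `v`, so a set which they cover has at
  -- most `3 * 2` edges.
  have hC7 : #C ≤ 6 := by
    have h1 := card_le_sum_of_cover hcov
    have h2 : ∑ u ∈ nb E v, dg C u ≤ #(nb E v) • 2 := sum_le_card_nsmul _ _ _ fun u hu => by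
      have := dg_add_one_le_of_mem_nb hE hC hu
      have := hd u
      omega
    have h3 : #(nb E v) = dg E v := rfl
    rw [smul_eq_mul] at h2
    omega
  refine hCn (tIndep_three (hE.mono hCE) hdC hC7 fun x y => ?_)
  by_contra! hxy
  -- Two vertices meeting six edges of `C` therefore have the same neighbours as `v`, and the three
  -- form one side of a `K_{3,3}`.
  have key : ∀ z, 3 ≤ dg C z → z ∉ nb E v ∧ nb C z = nb E v ∧ z ≠ v := by
    intro z hz
    have h1 : z ∉ nb E v := fun hz' => by
      have := dg_add_one_le_of_mem_nb hE hC hz'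
      have := hd z
      omega
    refine ⟨h1, eq_of_subset_of_card_le (nb_subset_of_cover hcov h1) ?_, ?_⟩
    · simp only [dg] at hv hz; omega
    · rintro rfl
      have := dg_mono hC z
      rw [dg_del_self] at this
      omega
  have hx := hdC x
  have hy := hdC y
  have hy' := dg_del_le C x y
  have hne : x ≠ y := by
    rintro rfl
    rw [dg_del_self] at hxy
    omega
  obtain ⟨-, hx2, hx3⟩ := key x (by omega)
  obtain ⟨-, hy2, hy3⟩ := key y (by omega)
  refine hK {v, x, y} (nb E v) (card_eq_three.2 ⟨v, x, y, hx3.symm, hy3.symm, hne, rfl⟩) hv ?_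
  intro a ha b hb
  simp only [mem_insert, mem_singleton] at ha
  rcases ha with rfl | rfl | rfl
  · exact mem_nb.1 hb
  · exact hCE (mem_nb.1 (hx2 ▸ hb))
  · exact hCE (mem_nb.1 (hy2 ▸ hb))

lemma tIndep_four_of_three_le_dg {E : Finset (Sym2 ℕ)} (hE : NoLoop E) (hd : ∀ v, dg E v ≤ 4)
    (h : #E ≤ 10) (h2 : ∀ x y, dg E x + dg (del E x) y ≤ 7)
    (h3 : ∀ x y z, dg E x + dg (del E x) y + dg (del (del E x) y) z ≤ 9)
    (hK : ∀ A B, #A = 3 → #B = 3 → ¬ CompleteBetween E A B) {v : ℕ} (hv : 3 ≤ dg E v) :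
    TIndep 4 E := by
  by_cases hv : ∃ v, dg E v = 4
  · obtain ⟨v, hv⟩ := hv
    have hc := card_del_add_dg E v
    refine TIndep.cone hE (hd v) (tIndep_three (hE.del v) (fun u => ?_) (by omega) fun x y => ?_)
    · have := h2 v u; omega
    · have := h3 v x y; omega
  have hd3 : ∀ v, dg E v ≤ 3 := fun v => by
    have := hd v
    have : dg E v ≠ 4 := fun h => hv ⟨v, h⟩
    omega
  exact tIndep_four_of_dg_three hE hd3 h hK (v := v) (le_antisymm (hd3 v) ‹_›)

/-- The descent is on the maximum degree: four is a cone vertex, three is the exchange step, two and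
one are raised. After raising only one vertex exceeds degree two, which excludes `K_{3,3}`. -/
lemma tIndep_four {E : Finset (Sym2 ℕ)} (hE : NoLoop E) (hd : ∀ v, dg E v ≤ 4)
    (h : #E ≤ 10) (h2 : ∀ x y, dg E x + dg (del E x) y ≤ 7)
    (h3 : ∀ x y z, dg E x + dg (del E x) y + dg (del (del E x) y) z ≤ 9)
    (hK : ∀ A B, #A = 3 → #B = 3 → ¬ CompleteBetween E A B) : TIndep 4 E := by
  by_cases hv : ∃ v, 3 ≤ dg E v
  · obtain ⟨v, hv⟩ := hv
    exact tIndep_four_of_three_le_dg hE hd h h2 h3 hK hv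
  push Not at hv
  have two : ∀ F : Finset (Sym2 ℕ), NoLoop F → #F ≤ 10 → (∀ u, dg F u ≤ 2) → ∀ w, dg F w = 2 →
      TIndep 4 F := by
    intro F hF hFc hFd w hw
    obtain ⟨E', hE', hm, hu, hw1, hw2, hT⟩ := exists_raise hF hFd (by norm_num) hw hFc
      (by norm_num)
    refine hT 4 (tIndep_four_of_three_le_dg hE' (fun u => ?_) hm (fun x y => ?_)
      (fun x y z => ?_) (fun A B hA hB hAB => ?_) hw1)
    · by_cases huw : u = w
      · subst huw; exact hw2
      · exact (hu u huw).trans (by norm_num)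
    · exact (dg_add_dg_del_le hu hw2 (by norm_num) x y).trans (by norm_num)
    · exact (dg_triple_le hu hw2 (by norm_num) x y z).trans (by norm_num)
    · have hAw : ∀ a ∈ A, a = w := fun a ha => by
        by_contra hne
        have h1 := hAB.card_le ha
        have h2 := hu a hne
        omega
      have : #A ≤ 1 := card_le_one.2 fun a ha b hb => (hAw a ha).trans (hAw b hb).symm
      omega
  by_cases hv2 : ∃ v, dg E v = 2
  · obtain ⟨w, hw⟩ := hv2
    exact two E hE h (fun u => by have := hv u; omega) w hw
  have hd1 : ∀ v, dg E v ≤ 1 := fun v => by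
    have := hv v
    have : dg E v ≠ 2 := fun h => hv2 ⟨v, h⟩
    omega
  by_cases hv1 : ∃ v, dg E v = 1
  · obtain ⟨w, hw⟩ := hv1
    obtain ⟨E', hE', hm, hu, hw1, hw2, hT⟩ := exists_raise hE hd1 le_rfl hw h (by norm_num)
    refine hT 4 (two E' hE' hm (fun u => ?_) w (by omega))
    by_cases huw : u = w
    · subst huw; omega
    · have := hu u huw; omega
  have : E = ∅ := eq_empty_of_dg_eq_zero fun v => by
    have := hd1 v
    have : dg E v ≠ 1 := fun h => hv1 ⟨v, h⟩
    omega
  rw [this]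
  exact tIndep_empty 4

/-! ### Sufficient conditions for independence, `t = 5` -/

lemma CompleteBetween.disjoint {E : Finset (Sym2 ℕ)} (hE : NoLoop E) {A B : Finset ℕ}
    (h : CompleteBetween E A B) : Disjoint A B := by
  rw [disjoint_left]
  exact fun x ha hb => hE x (h x ha x hb)

lemma CompleteBetween.card_mul_le {E : Finset (Sym2 ℕ)} (hE : NoLoop E) {A B : Finset ℕ}
    (h : CompleteBetween E A B) : #A * #B ≤ #E := by
  rw [← card_product]
  refine card_le_card_of_injOn (fun x => s(x.1, x.2)) ?_ ?_
  · rintro ⟨a, b⟩ hab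
    have hab := mem_product.1 (mem_coe.1 hab)
    exact h a hab.1 b hab.2
  · rintro ⟨a, b⟩ hab ⟨c, d⟩ hcd hh
    have hab := mem_product.1 (mem_coe.1 hab)
    have hcd := mem_product.1 (mem_coe.1 hcd)
    have hdis := disjoint_left.1 (h.disjoint hE)
    simp only [Sym2.eq_iff] at hh
    rcases hh with ⟨rfl, rfl⟩ | ⟨rfl, rfl⟩
    · rfl
    · exact absurd hcd.2 (hdis hab.1)

lemma CompleteBetween.nb_eq {E : Finset (Sym2 ℕ)} {A B : Finset ℕ} {k : ℕ}
    (h : CompleteBetween E A B) (hd : ∀ v, dg E v ≤ k) (hB : #B = k) {a : ℕ} (ha : a ∈ A) :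
    nb E a = B :=
  (eq_of_subset_of_card_le (h.subset_nb ha) (hB ▸ hd a)).symm

lemma CompleteBetween.card_mul_add_le {E : Finset (Sym2 ℕ)} (hE : NoLoop E)
    {A B A' B' : Finset ℕ} (h : CompleteBetween E A B) (h' : CompleteBetween E A' B')
    (h1 : ∀ x ∈ A', x ∉ A) (h2 : ∀ x ∈ B', x ∉ A) : #A * #B + #A' * #B' ≤ #E := by
  rw [← card_filter_add_card_filter_not (s := E) (fun f => ∃ x ∈ A, x ∈ f)]
  refine add_le_add (CompleteBetween.card_mul_le (hE.mono (filter_subset _ _)) ?_)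
    (CompleteBetween.card_mul_le (hE.mono (filter_subset _ _)) ?_)
  · exact fun a ha b hb => mem_filter.2 ⟨h a ha b hb, a, ha, by simp⟩
  · refine fun a ha b hb => mem_filter.2 ⟨h' a ha b hb, ?_⟩
    rintro ⟨x, hx, hxf⟩
    rcases Sym2.mem_iff.1 hxf with rfl | rfl
    · exact h1 _ ha hx
    · exact h2 _ hb hx

/-- Eleven edges of maximum degree four, no three vertices covering all of them, are independent
for `t = 4` up to one edge. -/
lemma tIndep_four_erase {R : Finset (Sym2 ℕ)} (hR : NoLoop R) (hd : ∀ v, dg R v ≤ 4)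
    (h : #R ≤ 11) (h3 : ∀ x y z, dg R x + dg (del R x) y + dg (del (del R x) y) z ≤ 10) :
    TIndep 4 R ∨ ∃ e ∈ R, TIndep 4 (R.erase e) := by
  by_cases hx : ∃ x, dg R x = 4
  · obtain ⟨x, hx⟩ := hx
    have hc := card_del_add_dg R x
    have lift : ∀ e ∈ del R x, TIndep 3 ((del R x).erase e) → ∃ e ∈ R, TIndep 4 (R.erase e) := by
      intro e he hT
      refine ⟨e, del_subset R x he, TIndep.cone (hR.mono (erase_subset _ _)) (v := x)
        ((dg_mono (erase_subset _ _) x).trans (hd x)) ?_⟩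
      rwa [del_erase]
    -- At most seven edges avoid `x`. If four of them meet `y`, one is sacrificed to make `y` a cone
    -- vertex for `t = 3`; the triple bound controls the at most three edges left.
    by_cases hy : ∃ y, dg (del R x) y = 4
    · obtain ⟨y, hy⟩ := hy
      obtain ⟨u, hu⟩ := exists_mk_mem (E := del R x) (v := y) (by omega)
      refine .inr (lift _ hu ?_)
      have hQ := (hR.del x).mono (erase_subset s(y, u) _)
      have hc2 := card_del_add_dg (del R x) y
      have h1 := dg_erase_add_one hu
      refine TIndep.cone hQ (v := y) (by omega) ?_
      rw [del_erase_of_mem _ (Sym2.mem_mk_left y u)]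
      refine tIndep_two ((hR.del x).del y) (fun z => ?_) (by omega)
      have := h3 x y z
      omega
    · have hd3 : ∀ y, dg (del R x) y ≤ 3 := fun y => by
        have h1 := (dg_del_le R x y).trans (hd y)
        have h2 : dg (del R x) y ≠ 4 := fun h => hy ⟨y, h⟩
        omega
      rcases tIndep_three_erase (hR.del x) hd3 (by omega) with hT | ⟨e, he, hT⟩
      · exact .inl (TIndep.cone hR (hd x) hT)
      · exact .inr (lift e he hT)
  have hd3 : ∀ y, dg R y ≤ 3 := fun y => by
    have h1 := hd y
    have h2 : dg R y ≠ 4 := fun h => hx ⟨y, h⟩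
    omega
  rcases R.eq_empty_or_nonempty with rfl | ⟨e, he⟩
  · exact .inl (tIndep_empty 4)
  right
  have main : ∀ e ∈ R, (∀ A B, #A = 3 → #B = 3 → ¬ CompleteBetween (R.erase e) A B) →
      TIndep 4 (R.erase e) := by
    intro e he hK
    have hd' : ∀ u, dg (R.erase e) u ≤ 3 := fun u => (dg_mono (erase_subset e R) u).trans (hd3 u)
    refine tIndep_four (hR.mono (erase_subset _ _)) (fun u => (hd' u).trans (by norm_num)) ?_
      (fun x y => ?_) (fun x y z => ?_) hK
    · rw [card_erase_of_mem he]; omega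
    · exact (dg_add_dg_del_le (w := 0) (fun u _ => hd' u) (hd' 0) le_rfl x y).trans (by norm_num)
    · exact (dg_triple_le (w := 0) (fun u _ => hd' u) (hd' 0) le_rfl x y z).trans (by norm_num)
  -- With maximum degree three a `K_{3,3}` is a component. Removing one of its edges destroys it,
  -- and eleven edges have no room for another copy.
  by_cases hK : ∃ A B, #A = 3 ∧ #B = 3 ∧ CompleteBetween R A B
  · obtain ⟨A, B, hA, hB, hAB⟩ := hK
    obtain ⟨a, ha⟩ : A.Nonempty := by rw [← card_pos]; omega
    obtain ⟨b, hb⟩ : B.Nonempty := by rw [← card_pos]; omega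
    refine ⟨s(a, b), hAB a ha b hb, main _ (hAB a ha b hb) ?_⟩
    -- a second copy would have to be disjoint from `A ∪ B`
    have half : ∀ A' B', #A' = 3 → #B' = 3 → CompleteBetween (R.erase s(a, b)) A' B' →
        ∀ x ∈ A', x ∉ A ∧ x ∉ B := by
      intro A' B' hA' hB' h
      have hR' := h.mono (erase_subset _ _)
      have hnb : ∀ x ∈ A', nb R x = B' := fun x hx => hR'.nb_eq hd3 hB' hx
      have hnb' : ∀ x ∈ B', nb R x = A' := fun x hx => hR'.symm.nb_eq hd3 hA' hx
      have hA1 : ∀ x ∈ A, nb R x = B := fun x hx => hAB.nb_eq hd3 hB hx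
      have hB1 : ∀ x ∈ B, nb R x = A := fun x hx => hAB.symm.nb_eq hd3 hA hx
      intro x hx
      constructor
      · intro hxA
        have h1 : B' = B := (hnb x hx).symm.trans (hA1 x hxA)
        have hb' : b ∈ B' := h1 ▸ hb
        have h2 : A' = A := (hnb' b hb').symm.trans (hB1 b hb)
        exact absurd (h a (h2 ▸ ha) b hb') (by simp)
      · intro hxB
        have h1 : B' = A := (hnb x hx).symm.trans (hB1 x hxB)
        have ha' : a ∈ B' := h1 ▸ ha
        have h2 : A' = B := (hnb' a ha').symm.trans (hA1 a ha)
        have := h b (h2 ▸ hb) a ha'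
        rw [Sym2.eq_swap] at this
        exact absurd this (by simp)
    intro A' B' hA' hB' h
    have hd1 := half A' B' hA' hB' h
    have hd2 := half B' A' hB' hA' h.symm
    have := hAB.card_mul_add_le hR (h.mono (erase_subset _ _)) (fun x hx => (hd1 x hx).1)
      (fun x hx => (hd2 x hx).1)
    rw [hA, hB, hA', hB'] at this
    omega
  · push Not at hK
    exact ⟨e, he, main e he fun A B hA hB h => hK A B hA hB (h.mono (erase_subset _ _))⟩

/-- The induction step for `t = 5` at a vertex of degree four. -/
lemma tIndep_five_of_dg_four {E : Finset (Sym2 ℕ)} (hE : NoLoop E) (hd : ∀ v, dg E v ≤ 4)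
    (h : #E ≤ 15)
    (h4 : ∀ x y z u, dg E x + dg (del E x) y + dg (del (del E x) y) z +
      dg (del (del (del E x) y) z) u ≤ 14)
    (hK34 : ∀ A B, #A = 3 → #B = 4 → ¬ CompleteBetween E A B)
    (hK44 : ∀ A B, #A = 4 → #B = 4 → Disjoint A B → (∀ x ∈ A ∪ B, 0 < dg E x) →
      ∑ x ∈ A, #(nb E x ∩ B) ≤ 13)
    {v : ℕ} (hv : dg E v = 4) : TIndep 5 E := by
  have hc := card_del_add_dg E v
  refine TIndep.step hE (hd v) (tIndep_four_erase (hE.del v)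
    (fun u => (dg_del_le E v u).trans (hd u)) (by omega) fun x y z => ?_) ?_
  · have := h4 v x y z
    omega
  intro C hC hCn
  by_contra! hcov
  have hCE : C ⊆ E := hC.trans (del_subset E v)
  have hdC : ∀ u, dg C u ≤ 4 := fun u => (dg_mono hCE u).trans (hd u)
  have hB4 : #(nb E v) = 4 := hv
  have hvB := hE.notMem_nb v
  have hvC : ∀ z u, s(z, u) ∈ C → z ≠ v := by
    rintro z u hzu rfl
    exact (mem_del.1 (hC hzu)).2 (by simp)
  -- Neighbours of `v` have lost an edge, so a vertex of degree four in `C` lies outside `nb E v`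
  -- and, `C` being covered, is joined to all of it.
  have key : ∀ z, 4 ≤ dg C z → z ∉ nb E v ∧ nb C z = nb E v ∧ z ≠ v := by
    intro z hz
    have h1 : z ∉ nb E v := fun hz' => by
      have := dg_add_one_le_of_mem_nb hE hC hz'
      have := hd z
      omega
    refine ⟨h1, eq_of_subset_of_card_le (nb_subset_of_cover hcov h1) ?_, ?_⟩
    · simp only [dg] at hz; omega
    · obtain ⟨u, hu⟩ := exists_mk_mem (E := C) (v := z) (by omega)
      exact hvC z u hu
  -- Together with `v` these would form a `K_{3,4}`.
  have key2 : ∀ x y, x ≠ y → 4 ≤ dg C x → 4 ≤ dg C y → False := by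
    intro x y hne hx hy
    obtain ⟨-, hx2, hx3⟩ := key x hx
    obtain ⟨-, hy2, hy3⟩ := key y hy
    refine hK34 {v, x, y} (nb E v) (card_eq_three.2 ⟨v, x, y, hx3.symm, hy3.symm, hne, rfl⟩) hv ?_
    intro a ha b hb
    simp only [mem_insert, mem_singleton] at ha
    rcases ha with rfl | rfl | rfl
    · exact mem_nb.1 hb
    · exact hCE (mem_nb.1 (hx2 ▸ hb))
    · exact hCE (mem_nb.1 (hy2 ▸ hb))
  -- The four vertices `v, x, y, z` would send `4 + 4 + 3 + 3 = 14` edges to `nb E v`, one more than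
  -- a subgraph of `K_{4,4}` may have.
  have key3 : ∀ x y z, x ≠ y → x ≠ z → y ≠ z → 4 ≤ dg C x → 3 ≤ dg C y → 3 ≤ dg C z →
      s(x, y) ∉ C → s(x, z) ∉ C → False := by
    intro x y z hxy hxz hyz hx hy hz hnxy hnxz
    obtain ⟨hx1, hx2, hx3⟩ := key x hx
    have hyB : y ∉ nb E v := by rw [← hx2]; simpa using hnxy
    have hzB : z ∉ nb E v := by rw [← hx2]; simpa using hnxz
    obtain ⟨u, hu⟩ := exists_mk_mem (E := C) (v := y) (by omega)
    have hyv := hvC y u hu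
    obtain ⟨u', hu'⟩ := exists_mk_mem (E := C) (v := z) (by omega)
    have hzv := hvC z u' hu'
    have hcard : #({v, x, y, z} : Finset ℕ) = 4 := by
      rw [card_insert_of_notMem, card_insert_of_notMem, card_insert_of_notMem, card_singleton] <;>
        simp [hxy, hxz, hyz, hx3.symm, hyv.symm, hzv.symm]
    have := hK44 {v, x, y, z} (nb E v) hcard hv (by
      rw [disjoint_left]
      intro a ha
      simp only [mem_insert, mem_singleton] at ha
      rcases ha with rfl | rfl | rfl | rfl <;> assumption) (by
      intro a ha
      rcases mem_union.1 ha with ha | ha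
      · have hmono := dg_mono hCE a
        simp only [mem_insert, mem_singleton] at ha
        rcases ha with rfl | rfl | rfl | rfl <;> omega
      · exact dg_pos (mem_nb.1 (mem_nb_comm.1 ha)))
    rw [sum_insert (by simp [hx3.symm, hyv.symm, hzv.symm]), sum_insert (by simp [hxy, hxz]),
      sum_insert (by simp [hyz]), sum_singleton] at this
    have hle : ∀ a, a ∉ nb E v → dg C a ≤ #(nb E a ∩ nb E v) := fun a ha =>
      card_le_card (subset_inter (nb_mono hCE a) (nb_subset_of_cover hcov ha))
    have h1 := hle x hx1
    have h2 := hle y hyB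
    have h3 := hle z hzB
    rw [inter_self] at this
    omega
  refine hCn (tIndep_four (hE.mono hCE) hdC ?_ (fun x y => ?_) (fun x y z => ?_)
    fun A B hA hB hAB => ?_)
  -- Eleven edges force `C = E - v`. Then the four neighbours of `v` cover all fifteen edges of `E`,
  -- against the quadruple bound 14.
  · by_contra! hC11
    have hCR : C = del E v := eq_of_subset_of_card_le hC (by omega)
    have hcovE : ∀ f ∈ E, ∃ u ∈ nb E v, u ∈ f := by
      intro f hf
      by_cases hvf : v ∈ f
      · obtain ⟨u, rfl⟩ := hvf
        exact ⟨u, mem_nb.2 hf, by simp⟩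
      · exact hcov f (hCR ▸ mem_del.2 ⟨hf, hvf⟩)
    obtain ⟨b₁, b₂, b₃, b₄, -, -, -, -, -, -, hB⟩ := card_eq_four.1 hB4
    have h0 := h4 b₁ b₂ b₃ b₄
    have c1 := card_del_add_dg E b₁
    have c2 := card_del_add_dg (del E b₁) b₂
    have c3 := card_del_add_dg (del (del E b₁) b₂) b₃
    have c4 := card_del_add_dg (del (del (del E b₁) b₂) b₃) b₄
    have hemp : del (del (del (del E b₁) b₂) b₃) b₄ = ∅ := by
      rw [eq_empty_iff_forall_notMem]
      intro f hf
      simp only [mem_del] at hf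
      obtain ⟨u, hu, huf⟩ := hcovE f hf.1.1.1.1
      rw [hB] at hu
      simp only [mem_insert, mem_singleton] at hu
      rcases hu with rfl | rfl | rfl | rfl <;> tauto
    rw [hemp, card_empty] at c4
    have c5 := congrArg card hCR
    omega
  · by_contra! hxy
    have hx := hdC x
    have hy := hdC y
    have hy' := dg_del_le C x y
    have hne : x ≠ y := by
      rintro rfl
      rw [dg_del_self] at hxy
      omega
    exact key2 x y hne (by omega) (by omega)
  · by_contra! hxyz
    have hx := hdC x
    have hy := hdC y
    have hz := hdC z
    have hy' := dg_del_le C x y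
    have hz' := dg_del_le (del C x) y z
    have hz'' := dg_del_le C x z
    have hxy : x ≠ y := by
      rintro rfl
      rw [dg_del_self] at hxyz
      omega
    have hyz : y ≠ z := by
      rintro rfl
      rw [dg_del_self] at hxyz
      omega
    have hxz : x ≠ z := by
      rintro rfl
      have := dg_del_self C x
      omega
    -- At most one of the three degrees is four, so meeting ten edges forces degrees 4, 3, 3 and
    -- pairwise nonadjacency.
    have n1 : ¬ (4 ≤ dg C x ∧ 4 ≤ dg C y) := fun h => key2 x y hxy h.1 h.2
    have n2 : ¬ (4 ≤ dg C x ∧ 4 ≤ dg C z) := fun h => key2 x z hxz h.1 h.2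
    have n3 : ¬ (4 ≤ dg C y ∧ 4 ≤ dg C z) := fun h => key2 y z hyz h.1 h.2
    have a1 : s(x, y) ∉ C := fun hm => by
      have := dg_del_of_mem hxy hm
      omega
    have a2 : s(x, z) ∉ C := fun hm => by
      have := dg_del_of_mem hxz hm
      omega
    have a3 : s(y, z) ∉ C := fun hm => by
      have := dg_del_of_mem (E := del C x) hyz (by simp [hm, hxy, hxz])
      omega
    by_cases hx4 : dg C x = 4
    · exact key3 x y z hxy hxz hyz (by omega) (by omega) (by omega) a1 a2
    · by_cases hy4 : dg C y = 4
      · exact key3 y x z hxy.symm hyz hxz (by omega) (by omega) (by omega)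
          (by rwa [Sym2.eq_swap]) a3
      · exact key3 z x y hxz.symm hyz.symm hxy (by omega) (by omega) (by omega)
          (by rwa [Sym2.eq_swap]) (by rwa [Sym2.eq_swap])
  -- Since `nb E v` covers `C`, one side of a `K_{3,3}` lies in it; adding `v` to the other side
  -- gives a `K_{3,4}`.
  · have half : ∀ A B : Finset ℕ, #A = 3 → #B = 3 → CompleteBetween C A B → A ⊆ nb E v → False := by
      intro A B hA hB hAB hsub
      obtain ⟨a, ha⟩ : A.Nonempty := by rw [← card_pos]; omega
      have hvB : v ∉ B := fun hv' => hvC v a (hAB.symm v hv' a ha) rfl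
      refine hK34 A (insert v B) hA (by rw [card_insert_of_notMem hvB, hB]) ?_
      intro x hx b hb
      rcases mem_insert.1 hb with rfl | hb
      · rw [Sym2.eq_swap]; exact mem_nb.1 (hsub hx)
      · exact hCE (hAB x hx b hb)
    by_cases hAs : A ⊆ nb E v
    · exact half A B hA hB hAB hAs
    · obtain ⟨a, ha, hna⟩ := not_subset.1 hAs
      refine half B A hB hA hAB.symm ?_
      exact (hAB.subset_nb ha).trans (nb_subset_of_cover hcov hna)

/-- One vertex of degree four among degrees at most three makes every density condition automatic:
four vertices meet at most `4 + 3 * 3 = 13` edges, the same count bounds subgraphs of `K_{4,4}`, and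
`K_{3,4}` would need three vertices of degree four. -/
lemma tIndep_five_of_single_dg_four {E : Finset (Sym2 ℕ)} (hE : NoLoop E) (h : #E ≤ 15) {w : ℕ}
    (hw : dg E w = 4) (hd : ∀ u, u ≠ w → dg E u ≤ 3) : TIndep 5 E := by
  refine tIndep_five_of_dg_four hE (fun u => ?_) h (fun x y z u => ?_) (fun A B hA hB hAB => ?_)
    (fun A B hA hB _ _ => ?_) hw
  · by_cases hu : u = w
    · subst hu; exact hw.le
    · exact (hd u hu).trans (by norm_num)
  · exact (dg_quad_le hd hw.le (by norm_num) x y z u).trans (by norm_num)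
  · have hAw : ∀ a ∈ A, a = w := fun a ha => by
      by_contra hne
      have h1 := hAB.card_le ha
      have h2 := hd a hne
      omega
    have : #A ≤ 1 := card_le_one.2 fun a ha b hb => (hAw a ha).trans (hAw b hb).symm
    omega
  · have hle : ∀ a, #(nb E a ∩ B) ≤ dg E a := fun a => card_le_card inter_subset_left
    by_cases hwA : w ∈ A
    · rw [← add_sum_erase _ _ hwA]
      have h1 : ∑ x ∈ A.erase w, #(nb E x ∩ B) ≤ #(A.erase w) • 3 :=
        sum_le_card_nsmul _ _ _ fun x hx => (hle x).trans (hd x (ne_of_mem_erase hx))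
      rw [card_erase_of_mem hwA, hA, smul_eq_mul] at h1
      have := hle w
      omega
    · have h1 : ∑ x ∈ A, #(nb E x ∩ B) ≤ #A • 3 :=
        sum_le_card_nsmul _ _ _ fun x hx => (hle x).trans (hd x (by rintro rfl; exact hwA hx))
      rw [hA, smul_eq_mul] at h1
      omega

/-! ### The case `t = 5` with all degrees at most three. -/

/-- An enumeration of a finite set of known size. -/
lemma exists_enum {A : Finset ℕ} {k : ℕ} (h : #A = k) :
    ∃ f : Fin k → ℕ, Function.Injective f ∧ (∀ i, f i ∈ A) ∧ ∀ a ∈ A, ∃ i, f i = a := by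
  refine ⟨A.orderEmbOfFin h, (A.orderEmbOfFin h).injective, fun i => A.orderEmbOfFin_mem h i, ?_⟩
  intro a ha
  have := A.range_orderEmbOfFin h
  have ha' : a ∈ Set.range (A.orderEmbOfFin h) := by rw [this]; exact ha
  exact ha'

/-- The disjoint union of `K_{3,3}` and `K_4` is independent for `t = 5`, by an explicit
realisation. -/
lemma tIndep_five_completeBipartite_union_complete {A B D : Finset ℕ} (hA : #A = 3) (hB : #B = 3)
    (hD : #D = 4) (hAB : Disjoint A B) (hAD : Disjoint A D) (hBD : Disjoint B D)
    {E : Finset (Sym2 ℕ)} (hE : ∀ f ∈ E, (∃ a ∈ A, ∃ b ∈ B, f = s(a, b)) ∨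
      ∃ c ∈ D, ∃ d ∈ D, c ≠ d ∧ f = s(c, d)) : TIndep 5 E := by
  obtain ⟨a, ha, haA, hAa⟩ := exists_enum hA
  obtain ⟨b, hb, hbB, hBb⟩ := exists_enum hB
  obtain ⟨d, hd, hdD, hDd⟩ := exists_enum hD
  let g : (Fin 3 ⊕ Fin 3) ⊕ Fin 4 → ℕ := Sum.elim (Sum.elim a b) d
  have hg : Function.Injective g := by
    refine Function.Injective.sumElim (Function.Injective.sumElim ha hb fun i j h => ?_) hd ?_
    · exact disjoint_left.1 hAB (haA i) (h ▸ hbB j)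
    · rintro (i | i) j h
      · exact disjoint_left.1 hAD (haA i) (by simp only [Sum.elim_inl] at h; exact h ▸ hdD j)
      · exact disjoint_left.1 hBD (hbB i)
          (by simp only [Sum.elim_inr] at h; exact h ▸ hdD j)
  -- The `K_4` sits on four basis vectors and uses up the six off-diagonal entries among the first
  -- four coordinates. The third points of `A` and `B` are both the fifth basis vector: their edges
  -- fill the last column, because the other four points are independent. The four remaining edges
  -- are separated by the first four diagonal entries.
  let P : (Fin 3 ⊕ Fin 3) ⊕ Fin 4 → Fin 5 → ℝ := Sum.elim (Sum.elim
    ![![0, 0, 1, 1, 0], ![1, 1, 0, 0, 0], ![0, 0, 0, 0, 1]]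
    ![![1, 1, 0, 1, 0], ![0, 1, 1, 0, 0], ![0, 0, 0, 0, 1]])
    ![![1, 0, 0, 0, 0], ![0, 1, 0, 0, 0], ![0, 0, 1, 0, 0], ![0, 0, 0, 1, 0]]
  let p : ℕ → Fin 5 → ℝ := Function.extend g P 0
  have hp : ∀ i, p (g i) = P i := fun i => hg.extend_apply P 0 i
  have hpa : ∀ i, p (a i) = P (.inl (.inl i)) := fun i => hp (.inl (.inl i))
  have hpb : ∀ i, p (b i) = P (.inl (.inr i)) := fun i => hp (.inl (.inr i))
  have hpd : ∀ i, p (d i) = P (.inr i) := fun i => hp (.inr i)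
  let edge : Fin 15 → Sym2 ℕ := ![s(a 0, b 0), s(a 0, b 1), s(a 0, b 2), s(a 1, b 0), s(a 1, b 1),
    s(a 1, b 2), s(a 2, b 0), s(a 2, b 1), s(a 2, b 2), s(d 0, d 1), s(d 0, d 2), s(d 0, d 3),
    s(d 1, d 2), s(d 1, d 3), s(d 2, d 3)]
  have hli : LinearIndependent ℝ (fun k => edgeMat p (edge k)) := by
    rw [Fintype.linearIndependent_iff]
    intro c hc
    have hco : ∀ i j, ∑ k, c k * edgeMat p (edge k) (i, j) = 0 := fun i j => by
      simpa using congrFun hc (i, j)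
    simp only [Fin.sum_univ_succ, Fin.sum_univ_zero, edge] at hco
    have e00 := hco 0 0
    have e01 := hco 0 1
    have e02 := hco 0 2
    have e03 := hco 0 3
    have e04 := hco 0 4
    have e11 := hco 1 1
    have e12 := hco 1 2
    have e13 := hco 1 3
    have e14 := hco 1 4
    have e22 := hco 2 2
    have e23 := hco 2 3
    have e24 := hco 2 4
    have e33 := hco 3 3
    have e34 := hco 3 4
    have e44 := hco 4 4
    clear hco hc
    simp [hpa, hpb, hpd, P] at e00 e01 e02 e03 e04 e11 e12 e13 e14 e22 e23 e24 e33 e34 e44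
    intro k
    fin_cases k <;> simp <;> linarith
  have hinj : Function.Injective edge := by
    intro i j h
    exact hli.injective (by simp only [h])
  refine ⟨p, LinearIndepOn.mono
    ((linearIndepOn_range_iff hinj (edgeMat p)).2 hli) ?_⟩
  intro f hf
  have h2 : ∀ i j : Fin 4, i ≠ j → s(d i, d j) ∈ Set.range edge := by
    intro i j hij
    fin_cases i <;> fin_cases j <;> first
      | exact absurd rfl hij
      | exact ⟨9, rfl⟩
      | exact ⟨10, rfl⟩
      | exact ⟨11, rfl⟩
      | exact ⟨12, rfl⟩
      | exact ⟨13, rfl⟩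
      | exact ⟨14, rfl⟩
      | exact ⟨9, Sym2.eq_swap⟩
      | exact ⟨10, Sym2.eq_swap⟩
      | exact ⟨11, Sym2.eq_swap⟩
      | exact ⟨12, Sym2.eq_swap⟩
      | exact ⟨13, Sym2.eq_swap⟩
      | exact ⟨14, Sym2.eq_swap⟩
  rcases hE f hf with ⟨x, hx, y, hy, rfl⟩ | ⟨x, hx, y, hy, hxy, rfl⟩
  · obtain ⟨i, rfl⟩ := hAa x hx
    obtain ⟨j, rfl⟩ := hBb y hy
    fin_cases i <;> fin_cases j
    exacts [⟨0, rfl⟩, ⟨1, rfl⟩, ⟨2, rfl⟩, ⟨3, rfl⟩, ⟨4, rfl⟩, ⟨5, rfl⟩, ⟨6, rfl⟩, ⟨7, rfl⟩, ⟨8, rfl⟩]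
  · obtain ⟨i, rfl⟩ := hDd x hx
    obtain ⟨j, rfl⟩ := hDd y hy
    exact h2 i j (by rintro rfl; exact hxy rfl)

/-- Two nonadjacent vertices with four neighbours together. -/
lemma tIndep_five_of_union_four {E : Finset (Sym2 ℕ)} (hE : NoLoop E) (hd : ∀ u, dg E u ≤ 3)
    (h : #E ≤ 15) {v w : ℕ} (hvw : v ≠ w) (hn : s(v, w) ∉ E) (hu : #(nb E v ∪ nb E w) = 4) :
    TIndep 5 E := by
  refine TIndep.of_shift hE hvw hn (tIndep_five_of_single_dg_four (hE.shift hn)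
    ((card_shift hE v w).trans_le h) (w := w) ?_ fun u huw => ?_)
  · rw [dg, nb_shift_right hvw hn, hu]
  · exact (dg_shift_le_of_ne hE hvw huw).trans (hd u)

/-- Two nonadjacent vertices with five neighbours together. -/
lemma tIndep_five_of_union_five {E : Finset (Sym2 ℕ)} (hE : NoLoop E) (hd : ∀ u, dg E u ≤ 3)
    (h : #E ≤ 15) {v w : ℕ} (hvw : v ≠ w) (hn : s(v, w) ∉ E) (hu : #(nb E v ∪ nb E w) = 5)
    (hK : ∀ A B, #A = 3 → #B = 3 → ¬ CompleteBetween (del (del E v) w) A B) :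
    TIndep 5 E := by
  refine TIndep.of_shift hE hvw hn ?_
  have hw5 : dg (shift E v w) w = 5 := by rw [dg, nb_shift_right hvw hn, hu]
  -- Only common neighbours stay at `v`, and there are at most `3 + 3 - 5` of them. So `v` is in no
  -- `K_{3,3}` of the shifted set, and a copy avoiding `v` and `w` was already present in `E`.
  have hv1 : dg (shift E v w) v ≤ 1 := by
    rw [dg, nb_shift_left hE hvw]
    have h1 := card_union_add_card_inter (nb E v) (nb E w)
    have h2 := hd v
    have h3 := hd w
    simp only [dg] at h2 h3
    omega
  have hd' : ∀ u, dg (del (shift E v w) w) u ≤ 3 := by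
    intro u
    by_cases huw : u = w
    · subst huw; rw [dg_del_self]; omega
    · exact (dg_del_le _ _ _).trans ((dg_shift_le_of_ne hE hvw huw).trans (hd u))
  refine TIndep.cone (hE.shift hn) hw5.le (tIndep_four ((hE.shift hn).del w)
    (fun u => (hd' u).trans (by norm_num)) ?_ (fun x y => ?_) (fun x y z => ?_)
    fun A B hA hB hAB => ?_)
  · have := card_del_add_dg (shift E v w) w
    have := card_shift hE v w
    omega
  · exact (dg_add_dg_del_le (w := 0) (fun u _ => hd' u) (hd' 0) le_rfl x y).trans (by norm_num)
  · exact (dg_triple_le (w := 0) (fun u _ => hd' u) (hd' 0) le_rfl x y z).trans (by norm_num)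
  · have hv' : dg (del (shift E v w) w) v ≤ 1 := (dg_del_le _ _ _).trans hv1
    have hvA : v ∉ A := fun hv => by
      have := hAB.card_le hv
      omega
    have hvB : v ∉ B := fun hv => by
      have := hAB.symm.card_le hv
      omega
    refine hK A B hA hB fun a ha b hb => ?_
    have hab := mem_del.1 (hAB a ha b hb)
    have hva : v ≠ a := by rintro rfl; exact hvA ha
    have hvb : v ≠ b := by rintro rfl; exact hvB hb
    exact mem_del.2 ⟨mem_del.2 ⟨mem_of_mem_shift hab.1 hab.2, by simp [hva, hvb]⟩, hab.2⟩

/-- Fifteen edges of maximum degree three, containing a copy of `K_{3,3}`. -/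
lemma tIndep_five_of_completeBetween {E : Finset (Sym2 ℕ)} (hE : NoLoop E)
    (hd : ∀ u, dg E u ≤ 3) (h : #E = 15) {A B : Finset ℕ} (hA : #A = 3) (hB : #B = 3)
    (hAB : CompleteBetween E A B) : TIndep 5 E := by
  have hnA : ∀ a ∈ A, nb E a = B := fun a ha => hAB.nb_eq hd hB ha
  have hnB : ∀ b ∈ B, nb E b = A := fun b hb => hAB.symm.nb_eq hd hA hb
  have hdis := hAB.disjoint hE
  obtain ⟨a₁, a₂, a₃, h12, h13, h23, hAe⟩ := card_eq_three.1 hA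
  have ha₁ : a₁ ∈ A := by rw [hAe]; simp
  have ha₂ : a₂ ∈ A := by rw [hAe]; simp
  have ha₃ : a₃ ∈ A := by rw [hAe]; simp
  have nadj : ∀ x ∈ A, ∀ y ∈ A, s(x, y) ∉ E := fun x hx y hy hm => by
    have : y ∈ B := by rw [← hnA x hx]; exact mem_nb.2 hm
    exact disjoint_left.1 hdis hy this
  -- By the degree bound the `K_{3,3}` is a component.
  have out : ∀ v, v ∉ A → v ∉ B → ∀ u ∈ nb E v, u ∉ A ∧ u ∉ B := by
    intro v hvA hvB u hu
    rw [mem_nb_comm] at hu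
    exact ⟨fun h => hvB (hnA u h ▸ hu), fun h => hvA (hnB u h ▸ hu)⟩
  -- An outside vertex of degree one or two has four or five neighbours jointly with `a₁`, so a
  -- shift applies.
  by_cases hv : ∃ v, v ∉ A ∧ v ∉ B ∧ (dg E v = 1 ∨ dg E v = 2)
  · obtain ⟨v, hvA, hvB, hdv⟩ := hv
    have hva : v ≠ a₁ := by rintro rfl; exact hvA ha₁
    have hn : s(v, a₁) ∉ E := fun hm => hvB (by
      rw [← hnA a₁ ha₁, mem_nb, Sym2.eq_swap]; exact hm)
    have hu : #(nb E v ∪ nb E a₁) = dg E v + 3 := by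
      rw [hnA a₁ ha₁, card_union_of_disjoint, hB, dg]
      rw [disjoint_left]
      exact fun u hu => (out v hvA hvB u hu).2
    rcases hdv with hdv | hdv
    · exact tIndep_five_of_union_four hE hd h.le hva hn (by omega)
    · refine tIndep_five_of_union_five hE hd h.le hva hn (by omega) fun A' B' hA' hB' hK => ?_
      have hKE : CompleteBetween E A' B' := hK.mono ((del_subset _ _).trans (del_subset _ _))
      have half : ∀ A' B' : Finset ℕ, #A' = 3 → #B' = 3 →
          CompleteBetween (del (del E v) a₁) A' B' → ∀ x ∈ A', x ∉ B := by
        intro A' B' hA' hB' hK x hx hxB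
        have h1 : B' ⊆ A.erase a₁ := by
          intro y hy
          have hxy := mem_del.1 (hK x hx y hy)
          refine mem_erase.2 ⟨?_, ?_⟩
          · rintro rfl; exact hxy.2 (by simp)
          · rw [← hnB x hxB]; exact mem_nb.2 (mem_del.1 hxy.1).1
        have h2 := card_le_card h1
        rw [card_erase_of_mem ha₁] at h2
        omega
      have half2 : ∀ A' B' : Finset ℕ, #A' = 3 → #B' = 3 →
          CompleteBetween (del (del E v) a₁) A' B' → ∀ x ∈ A', x ∉ A := by
        intro A' B' hA' hB' hK x hx hxA
        obtain ⟨y, hy⟩ : B'.Nonempty := by rw [← card_pos]; omega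
        refine half B' A' hB' hA' hK.symm y hy ?_
        rw [← hnA x hxA]
        exact mem_nb.2 (mem_del.1 (mem_del.1 (hK x hx y hy)).1).1
      have := hAB.card_mul_add_le hE hKE (half2 A' B' hA' hB' hK) (half2 B' A' hB' hA' hK.symm)
      rw [hA, hB, hA', hB'] at this
      omega
  have h03 : ∀ v, v ∉ A → v ∉ B → 0 < dg E v → dg E v = 3 := by
    intro v hvA hvB hpos
    have h1 := hd v
    have h2 : ¬ (dg E v = 1 ∨ dg E v = 2) := fun h => hv ⟨v, hvA, hvB, h⟩
    omega
  set E₃ := del (del (del E a₁) a₂) a₃ with hE₃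
  have hmem₃ : ∀ f, f ∈ E₃ ↔ f ∈ E ∧ ∀ a ∈ A, a ∉ f := by
    intro f
    simp only [hE₃, mem_del, hAe, mem_insert, mem_singleton, forall_eq_or_imp, forall_eq, and_assoc]
  have hdA : ∀ a ∈ A, dg E a = 3 := fun a ha => by rw [dg, hnA a ha, hB]
  -- Six edges remain, on vertices of degree three. Deleting one such vertex leaves three edges with
  -- degree two at each of its three neighbours, hence a triangle: the remainder is a `K_4`.
  have hc₃ : #E₃ = 6 := by
    have c1 := card_del_add_dg E a₁
    have c2 := card_del_add_dg (del E a₁) a₂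
    have c3 := card_del_add_dg (del (del E a₁) a₂) a₃
    rw [hdA a₁ ha₁] at c1
    rw [dg_del_of_notMem h12 (nadj _ ha₁ _ ha₂), hdA a₂ ha₂] at c2
    rw [dg_del_of_notMem h23 (fun hm => nadj _ ha₂ _ ha₃ (del_subset _ _ hm)),
      dg_del_of_notMem h13 (nadj _ ha₁ _ ha₃), hdA a₃ ha₃, ← hE₃] at c3
    omega
  obtain ⟨f, hf⟩ : E₃.Nonempty := by rw [← card_pos]; omega
  induction f with
  | _ v u₀ =>
    have hf' := (hmem₃ _).1 hf
    have hvA : v ∉ A := fun hm => hf'.2 v hm (by simp)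
    have hvB : v ∉ B := fun hm => hf'.2 u₀ (by
      rw [← hnB v hm]; exact mem_nb.2 hf'.1) (by simp)
    have hv3 := h03 v hvA hvB (dg_pos hf'.1)
    -- away from `A ∪ B` nothing changes in `E₃`
    have hnb₃ : ∀ x, x ∉ A → x ∉ B → nb E₃ x = nb E x := by
      intro x hxA hxB
      ext y
      rw [mem_nb, mem_nb, hmem₃]
      refine and_iff_left_of_imp fun hm a ha haf => ?_
      rcases Sym2.mem_iff.1 haf with rfl | rfl
      · exact hxA ha
      · exact (out x hxA hxB a (mem_nb.2 hm)).1 ha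
    have hE₃l : NoLoop E₃ := hE.mono fun f hf => ((hmem₃ f).1 hf).1
    have hc₄ : #(del E₃ v) = 3 := by
      have c := card_del_add_dg E₃ v
      rw [dg, hnb₃ v hvA hvB] at c
      simp only [dg] at hv3
      omega
    have hx2 : ∀ x ∈ nb E v, dg (del E₃ v) x = 2 := by
      intro x hx
      obtain ⟨hxA, hxB⟩ := out v hvA hvB x hx
      have hvx : v ≠ x := by rintro rfl; exact hE.notMem_nb _ hx
      have h1 := dg_del_of_mem (E := E₃) hvx (by rw [← mem_nb, hnb₃ v hvA hvB]; exact hx)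
      have h2 : dg E₃ x = dg E x := by rw [dg, hnb₃ x hxA hxB, dg]
      have h3 := h03 x hxA hxB (dg_pos (mem_nb.1 (mem_nb_comm.1 hx)))
      omega
    have adj : ∀ x ∈ nb E v, ∀ y ∈ nb E v, x ≠ y → s(x, y) ∈ del E₃ v ∧
        del (del (del E₃ v) x) y = ∅ := by
      intro x hx y hy hxy
      have c1 := card_del_add_dg (del E₃ v) x
      have c2 := card_del_add_dg (del (del E₃ v) x) y
      have d1 := hx2 x hx
      have d2 := hx2 y hy
      by_cases hm : s(x, y) ∈ del E₃ v
      · have d3 := dg_del_of_mem hxy hm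
        refine ⟨hm, ?_⟩
        rw [← card_eq_zero]
        omega
      · have d3 := dg_del_of_notMem hxy hm
        omega
    have hnx : ∀ x ∈ nb E v, nb E x = (insert v (nb E v)).erase x := by
      intro x hx
      have hxv : x ≠ v := by rintro rfl; exact hE.notMem_nb _ hx
      have hsub : (insert v (nb E v)).erase x ⊆ nb E x := by
        intro y hy
        obtain ⟨hyx, hy⟩ := mem_erase.1 hy
        rcases mem_insert.1 hy with rfl | hy
        · exact mem_nb_comm.1 hx
        · exact mem_nb.2 ((hmem₃ _).1 (mem_del.1 (adj x hx y hy hyx.symm).1).1).1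
      refine (eq_of_subset_of_card_le hsub ?_).symm
      rw [card_erase_of_mem (mem_insert_of_mem hx), card_insert_of_notMem (hE.notMem_nb v)]
      have := hd x
      simp only [dg] at this hv3
      omega
    refine tIndep_five_completeBipartite_union_complete (D := insert v (nb E v)) hA hB ?_ hdis
      ?_ ?_ ?_
    · rw [card_insert_of_notMem (hE.notMem_nb v)]
      simp only [dg] at hv3
      omega
    · rw [disjoint_right]
      intro x hx
      rcases mem_insert.1 hx with rfl | hx
      · exact hvA
      · exact (out v hvA hvB x hx).1
    · rw [disjoint_right]
      intro x hx
      rcases mem_insert.1 hx with rfl | hx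
      · exact hvB
      · exact (out v hvA hvB x hx).2
    · intro f hfE
      by_cases hfA : ∃ a ∈ A, a ∈ f
      · obtain ⟨a, ha, b, rfl⟩ := hfA
        exact .inl ⟨a, ha, b, by rw [← hnA a ha]; exact mem_nb.2 hfE, rfl⟩
      right
      push Not at hfA
      have hf3 : f ∈ E₃ := (hmem₃ f).2 ⟨hfE, hfA⟩
      have inD : ∀ x ∈ insert v (nb E v), x ∈ f → ∃ c ∈ insert v (nb E v),
          ∃ d ∈ insert v (nb E v), c ≠ d ∧ f = s(c, d) := by
        rintro x hx ⟨y, rfl⟩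
        have hxy : x ≠ y := by rintro rfl; exact hE _ hfE
        refine ⟨x, hx, y, ?_, hxy, rfl⟩
        rcases mem_insert.1 hx with rfl | hx
        · exact mem_insert_of_mem (mem_nb.2 hfE)
        · have := mem_nb.2 hfE
          rw [hnx x hx] at this
          exact mem_of_mem_erase this
      by_cases hvf : v ∈ f
      · exact inD v (mem_insert_self _ _) hvf
      obtain ⟨x, y, z, hxy, -, -, hN⟩ := card_eq_three.1 hv3
      have hx : x ∈ nb E v := by rw [hN]; simp
      have hy : y ∈ nb E v := by rw [hN]; simp
      by_cases hxf : x ∈ f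
      · exact inD x (mem_insert_of_mem hx) hxf
      by_cases hyf : y ∈ f
      · exact inD y (mem_insert_of_mem hy) hyf
      have : f ∈ del (del (del E₃ v) x) y := by simp [hf3, hvf, hxf, hyf]
      rw [(adj x hx y hy hxy).2] at this
      exact absurd this (notMem_empty f)

/-- If each vertex has degree zero or three, and any two neighbours of a vertex are adjacent, then
six edges can be removed without leaving this class. -/
lemma exists_remove_complete {E : Finset (Sym2 ℕ)} (hE : NoLoop E)
    (hd : ∀ x, dg E x = 0 ∨ dg E x = 3)
    (hadj : ∀ w, ∀ a ∈ nb E w, ∀ b ∈ nb E w, a ≠ b → s(a, b) ∈ E) (hne : E.Nonempty) :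
    ∃ E', NoLoop E' ∧ (∀ x, dg E' x = 0 ∨ dg E' x = 3) ∧
      (∀ w, ∀ a ∈ nb E' w, ∀ b ∈ nb E' w, a ≠ b → s(a, b) ∈ E') ∧ #E = #E' + 6 := by
  obtain ⟨f, hf⟩ := hne
  induction f with
  | _ w u₀ =>
    have hw : dg E w = 3 := (hd w).resolve_left (dg_pos hf).ne'
    obtain ⟨a, b, c, hab, hac, hbc, hN⟩ := card_eq_three.1 hw
    have ha : s(w, a) ∈ E := by rw [← mem_nb, hN]; simp
    have hb : s(w, b) ∈ E := by rw [← mem_nb, hN]; simp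
    have hc : s(w, c) ∈ E := by rw [← mem_nb, hN]; simp
    have hwa : w ≠ a := by rintro rfl; exact hE _ ha
    have hwb : w ≠ b := by rintro rfl; exact hE _ hb
    have hwc : w ≠ c := by rintro rfl; exact hE _ hc
    have eab : s(a, b) ∈ E := hadj w a (mem_nb.2 ha) b (mem_nb.2 hb) hab
    have eac : s(a, c) ∈ E := hadj w a (mem_nb.2 ha) c (mem_nb.2 hc) hac
    have ebc : s(b, c) ∈ E := hadj w b (mem_nb.2 hb) c (mem_nb.2 hc) hbc
    have d3 : ∀ {x y : ℕ}, s(x, y) ∈ E → dg E x = 3 := fun h => (hd _).resolve_left (dg_pos h).ne'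
    have hda := d3 eab
    have hdb := d3 ebc
    have hdc := d3 (x := c) (y := b) (by rw [Sym2.eq_swap]; exact ebc)
    set E' := del (del (del (del E w) a) b) c with hE'
    have hmem : ∀ f, f ∈ E' ↔ f ∈ E ∧ w ∉ f ∧ a ∉ f ∧ b ∉ f ∧ c ∉ f := by
      intro f
      simp only [hE', mem_del, and_assoc]
    -- The four vertices are pairwise adjacent and have no degree left, so they span a `K_4`
    -- component, which is the part removed.
    have closed : ∀ x ∈ ({w, a, b, c} : Finset ℕ), nb E x ⊆ {w, a, b, c} := by
      intro x hx
      have hsub : ({w, a, b, c} : Finset ℕ).erase x ⊆ nb E x := by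
        intro y hy
        simp only [mem_erase, mem_insert, mem_singleton] at hx hy
        rw [mem_nb]
        obtain ⟨hyx, hy⟩ := hy
        rcases hx with rfl | rfl | rfl | rfl <;> rcases hy with rfl | rfl | rfl | rfl <;>
          first | exact absurd rfl hyx | assumption | (rw [Sym2.eq_swap]; assumption)
      have hcard : #(({w, a, b, c} : Finset ℕ).erase x) = 3 := by
        rw [card_erase_of_mem hx, card_insert_of_notMem, card_insert_of_notMem,
          card_insert_of_notMem, card_singleton] <;> simp [hab, hac, hbc, hwa, hwb, hwc]
      have h3 : dg E x ≤ 3 := by rcases hd x with h | h <;> omega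
      rw [← eq_of_subset_of_card_le hsub (by rw [hcard]; exact h3)]
      exact erase_subset _ _
    have hnb : ∀ x, nb E' x = if x ∈ ({w, a, b, c} : Finset ℕ) then ∅ else nb E x := by
      intro x
      split_ifs with hx
      · rw [eq_empty_iff_forall_notMem]
        intro y hy
        rw [mem_nb, hmem] at hy
        simp only [mem_insert, mem_singleton] at hx
        rcases hx with rfl | rfl | rfl | rfl <;> simp at hy
      · ext y
        rw [mem_nb, mem_nb, hmem]
        refine and_iff_left_of_imp fun hm => ?_
        have hy : y ∉ ({w, a, b, c} : Finset ℕ) := fun hy =>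
          hx (closed y hy (mem_nb.2 (by rw [Sym2.eq_swap]; exact hm)))
        simp only [mem_insert, mem_singleton, not_or] at hx hy
        simp only [Sym2.mem_iff, not_or]
        exact ⟨⟨Ne.symm hx.1, Ne.symm hy.1⟩, ⟨Ne.symm hx.2.1, Ne.symm hy.2.1⟩,
          ⟨Ne.symm hx.2.2.1, Ne.symm hy.2.2.1⟩, ⟨Ne.symm hx.2.2.2, Ne.symm hy.2.2.2⟩⟩
    refine ⟨E', hE.mono fun f hf => ((hmem f).1 hf).1, fun x => ?_, fun x y hy z hz hyz => ?_, ?_⟩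
    · rw [dg, hnb]
      split_ifs
      · simp
      · exact hd x
    · rw [hnb] at hy hz
      split_ifs at hy hz with hx
      · simp at hy
      · have hyz' := hadj x y hy z hz hyz
        have hy' : y ∉ ({w, a, b, c} : Finset ℕ) := fun h =>
          hx (closed y h (mem_nb_comm.1 hy))
        rw [← mem_nb, hnb, if_neg hy', mem_nb]
        exact hyz'
    · have c1 := card_del_add_dg E w
      have c2 := card_del_add_dg (del E w) a
      have c3 := card_del_add_dg (del (del E w) a) b
      have c4 := card_del_add_dg (del (del (del E w) a) b) c
      rw [← hE'] at c4
      have m1 := dg_del_of_mem hwa ha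
      have m2 := dg_del_of_mem hwb hb
      have m3 := dg_del_of_mem hwc hc
      have m4 := dg_del_of_mem (E := del E w) hab (by simp [eab, hwa, hwb])
      have m5 := dg_del_of_mem (E := del E w) hac (by simp [eac, hwa, hwc])
      have m6 := dg_del_of_mem (E := del (del E w) a) hbc (by simp [ebc, hwb, hwc, hab, hac])
      omega

/-- Fifteen edges of maximum degree three without a copy of `K_{3,3}`. -/
lemma tIndep_five_of_not_completeBetween {E : Finset (Sym2 ℕ)} (hE : NoLoop E)
    (hd : ∀ u, dg E u ≤ 3) (h : #E = 15) {w : ℕ} (hw : dg E w = 3)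
    (hK : ∀ A B, #A = 3 → #B = 3 → ¬ CompleteBetween E A B) : TIndep 5 E := by
  by_contra hT
  -- If `E` is dependent, neither shift applies. The steps below turn this into the statement that
  -- every component with an edge is a `K_4`, which fifteen edges do not allow.
  have stuck : ∀ x y, x ≠ y → s(x, y) ∉ E →
      #(nb E x ∪ nb E y) ≠ 4 ∧ #(nb E x ∪ nb E y) ≠ 5 := by
    intro x y hxy hn
    refine ⟨fun h4 => hT (tIndep_five_of_union_four hE hd h.le hxy hn h4), fun h5 =>
      hT (tIndep_five_of_union_five hE hd h.le hxy hn h5 fun A B hA hB hAB => ?_)⟩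
    exact hK A B hA hB (hAB.mono ((del_subset _ _).trans (del_subset _ _)))
  -- a vertex of small union with a vertex of degree three has its neighbours there
  have nested : ∀ x y, x ≠ y → s(x, y) ∉ E → dg E y = 3 → #(nb E x ∪ nb E y) ≤ 5 →
      nb E x ⊆ nb E y := by
    intro x y hxy hn hy hu
    have h1 := stuck x y hxy hn
    have h2 : nb E y = nb E x ∪ nb E y :=
      eq_of_subset_of_card_le subset_union_right (by simp only [dg] at hy; omega)
    rw [h2]
    exact subset_union_left
  obtain ⟨v, v', hvE, hvw, hvw', hv, hv'⟩ := exists_far_edge (w := w) hd (by omega) (by omega)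
  have hnvw : s(v, w) ∉ E := by rw [Sym2.eq_swap]; simpa using hv
  have hsum := card_union_add_card_inter (nb E v) (nb E w)
  have hdv := hd v
  have h6 : dg E v = 3 ∧ nb E v ∩ nb E w = ∅ := by
    have h1 := stuck v w hvw hnvw
    have h2 : insert v' (nb E w) ⊆ nb E v ∪ nb E w := by
      intro x hx
      rcases mem_insert.1 hx with rfl | hx
      · exact mem_union_left _ (mem_nb.2 hvE)
      · exact mem_union_right _ hx
    have h3 := card_le_card h2
    rw [card_insert_of_notMem hv'] at h3
    rw [← card_eq_zero]
    simp only [dg] at hw hdv ⊢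
    omega
  have hdisj : ∀ x, x ∈ nb E v → x ∉ nb E w := by
    intro x h1 h2
    have : x ∈ nb E v ∩ nb E w := mem_inter.2 ⟨h1, h2⟩
    rw [h6.2] at this
    exact notMem_empty x this
  -- A vertex `y` of degree one or two is adjacent to, or has its neighbours among those of, each
  -- vertex of degree three. For `v` and `w`, which are nonadjacent with disjoint neighbourhoods, no
  -- combination is possible.
  have hdeg : ∀ y, dg E y = 0 ∨ dg E y = 3 := by
    intro y
    by_contra! hy
    have hy3 := hd y
    have case : ∀ x, dg E x = 3 → y ∈ nb E x ∨ nb E y ⊆ nb E x := by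
      intro x hx
      by_cases hyx : y ∈ nb E x
      · exact .inl hyx
      · refine .inr (nested y x ?_ ?_ hx ?_)
        · rintro rfl; exact hy.2 hx
        · rw [Sym2.eq_swap]; simpa using hyx
        · refine (card_union_le _ _).trans ?_
          simp only [dg] at *
          omega
    rcases case v h6.1 with h1 | h1 <;> rcases case w hw with h2 | h2
    · exact hdisj y h1 h2
    · exact hv (h2 (mem_nb_comm.1 h1))
    · have := h1 (mem_nb_comm.1 h2)
      rw [mem_nb] at this
      exact hnvw this
    · obtain ⟨u, hu⟩ := exists_mk_mem (E := E) (v := y) (by omega)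
      exact hdisj u (h1 (mem_nb.2 hu)) (h2 (mem_nb.2 hu))
  -- vertices at distance two have the same neighbours
  have twin : ∀ x y z, x ≠ y → s(x, y) ∉ E → z ∈ nb E x → z ∈ nb E y → nb E x = nb E y := by
    intro x y z hxy hn hx hy
    have hx3 : dg E x = 3 := (hdeg x).resolve_left (dg_pos (mem_nb.1 hx)).ne'
    have hy3 : dg E y = 3 := (hdeg y).resolve_left (dg_pos (mem_nb.1 hy)).ne'
    have hi : 0 < #(nb E x ∩ nb E y) := card_pos.2 ⟨z, mem_inter.2 ⟨hx, hy⟩⟩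
    have hs := card_union_add_card_inter (nb E x) (nb E y)
    simp only [dg] at hx3 hy3
    exact eq_of_subset_of_card_le (nested x y hxy hn hy3 (by omega)) (by omega)
  -- If `ac` were missing, `a` and `c` would be twins and `b` would be saturated by `x, a, c`. The
  -- third neighbour `y` of `a` would then be a twin of `x`, hence adjacent to `b`.
  have tri : ∀ x a b c, nb E x = {a, b, c} → a ≠ b → a ≠ c → b ≠ c → s(a, b) ∈ E →
      s(a, c) ∈ E := by
    intro x a b c hN hab hac hbc hE1
    by_contra hn
    have ha : s(x, a) ∈ E := by rw [← mem_nb, hN]; simp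
    have hb : s(x, b) ∈ E := by rw [← mem_nb, hN]; simp
    have hc : s(x, c) ∈ E := by rw [← mem_nb, hN]; simp
    have hxa : x ≠ a := by rintro rfl; exact hE _ ha
    have hxb : x ≠ b := by rintro rfl; exact hE _ hb
    have hxc : x ≠ c := by rintro rfl; exact hE _ hc
    have hNac : nb E a = nb E c := twin a c x hac hn (mem_nb_comm.1 (mem_nb.2 ha))
      (mem_nb_comm.1 (mem_nb.2 hc))
    have hcb : b ∈ nb E c := by rw [← hNac]; exact mem_nb.2 hE1
    have ha3 : #(nb E a) = 3 := (hdeg a).resolve_left (dg_pos hE1).ne'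
    have hb3 : #(nb E b) = 3 := (hdeg b).resolve_left
      (dg_pos (mem_nb.1 (mem_nb_comm.1 hcb))).ne'
    have hNb : nb E b = {x, a, c} := by
      refine (eq_of_subset_of_card_le ?_ ?_).symm
      · intro y hy
        simp only [mem_insert, mem_singleton] at hy
        rcases hy with rfl | rfl | rfl
        · exact mem_nb_comm.1 (mem_nb.2 hb)
        · exact mem_nb_comm.1 (mem_nb.2 hE1)
        · exact mem_nb_comm.1 hcb
      · rw [hb3, card_eq_three.2 ⟨x, a, c, hxa, hxc, hac, rfl⟩]
    obtain ⟨y, hy, hyn⟩ : ∃ y ∈ nb E a, y ∉ ({x, b} : Finset ℕ) := by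
      by_contra! hcon
      have := card_le_card (show nb E a ⊆ {x, b} from hcon)
      rw [ha3, card_pair hxb] at this
      omega
    simp only [mem_insert, mem_singleton, not_or] at hyn
    have hya : y ≠ a := by rintro rfl; exact hE.notMem_nb _ hy
    have hyc : y ≠ c := by rintro rfl; exact hn (mem_nb.1 hy)
    have hnyx : s(y, x) ∉ E := by
      rw [Sym2.eq_swap, ← mem_nb, hN]
      simp [hya, hyn.2, hyc]
    have hNy := twin y x a hyn.1 hnyx (mem_nb_comm.1 hy) (mem_nb.2 ha)
    have hyb : b ∈ nb E y := by rw [hNy]; exact mem_nb.2 hb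
    rw [mem_nb_comm, hNb] at hyb
    simp [hyn.1, hya, hyc] at hyb
  -- By `tri` the neighbours of `x` are pairwise adjacent or pairwise nonadjacent; in the latter
  -- case they are twins and form a side of a `K_{3,3}`.
  have hadj : ∀ x, ∀ a ∈ nb E x, ∀ b ∈ nb E x, a ≠ b → s(a, b) ∈ E := by
    intro x a ha b hb hab
    have hx3 : #(nb E x) = 3 := (hdeg x).resolve_left (dg_pos (mem_nb.1 ha)).ne'
    obtain ⟨c, hc⟩ : ∃ c, ((nb E x).erase a).erase b = {c} := by
      rw [← card_eq_one, card_erase_of_mem (mem_erase.2 ⟨hab.symm, hb⟩), card_erase_of_mem ha, hx3]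
    have hc' : c ∈ ((nb E x).erase a).erase b := by rw [hc]; simp
    simp only [mem_erase] at hc'
    have hN : nb E x = {a, b, c} := by
      rw [← hc, insert_erase (mem_erase.2 ⟨hab.symm, hb⟩), insert_erase ha]
    have hxa := mem_nb_comm.1 ha
    have hxb := mem_nb_comm.1 hb
    have hxc := mem_nb_comm.1 hc'.2.2
    have hac : a ≠ c := fun h => hc'.2.1 h.symm
    have hbc : b ≠ c := fun h => hc'.1 h.symm
    by_contra hn
    by_cases hnac : s(a, c) ∈ E
    · exact hn (tri x a c b (by rw [hN]; ext; simp; tauto) hac hab hbc.symm hnac)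
    by_cases hnbc : s(b, c) ∈ E
    · refine hn ?_
      rw [Sym2.eq_swap]
      exact tri x b c a (by rw [hN]; ext; simp; tauto) hbc hab.symm hac.symm hnbc
    have e1 := twin a b x hab hn hxa hxb
    have e2 := twin a c x hac hnac hxa hxc
    have ha3 : #(nb E a) = 3 := (hdeg a).resolve_left (dg_pos (mem_nb.1 hxa)).ne'
    refine hK {a, b, c} (nb E a) (card_eq_three.2 ⟨a, b, c, hab, hac, hbc, rfl⟩) ha3 ?_
    intro y hy z hz
    simp only [mem_insert, mem_singleton] at hy
    rcases hy with rfl | rfl | rfl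
    · exact mem_nb.1 hz
    · exact mem_nb.1 (e1 ▸ hz)
    · exact mem_nb.1 (e2 ▸ hz)
  -- Fifteen is not a multiple of six.
  obtain ⟨E₁, l₁, d₁, a₁, c₁⟩ := exists_remove_complete hE hdeg hadj (card_pos.1 (by omega))
  obtain ⟨E₂, l₂, d₂, a₂, c₂⟩ := exists_remove_complete l₁ d₁ a₁ (card_pos.1 (by omega))
  obtain ⟨E₃, -, -, -, c₃⟩ := exists_remove_complete l₂ d₂ a₂ (card_pos.1 (by omega))
  omega

lemma tIndep_five_of_dg_three {E : Finset (Sym2 ℕ)} (hE : NoLoop E)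
    (hd : ∀ u, dg E u ≤ 3) (h : #E ≤ 15) {w : ℕ} (hw : dg E w = 3) : TIndep 5 E := by
  rcases h.lt_or_eq with hlt | heq
  · obtain ⟨z, hz, hzE⟩ := exists_fresh E w
    obtain ⟨h1, h2⟩ := dg_insert_fresh hz hzE
    refine (tIndep_five_of_single_dg_four (hE.insert hz.symm) ((card_insert_le _ _).trans hlt)
      (w := w) (by omega) fun u hu => ?_).mono (subset_insert _ _)
    exact (h2 u hu).trans (max_le (by norm_num) (hd u))
  · by_cases hK : ∃ A B, #A = 3 ∧ #B = 3 ∧ CompleteBetween E A B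
    · obtain ⟨A, B, hA, hB, hAB⟩ := hK
      exact tIndep_five_of_completeBetween hE hd heq hA hB hAB
    · push Not at hK
      exact tIndep_five_of_not_completeBetween hE hd heq hw hK

lemma tIndep_five_of_dg_le_three {E : Finset (Sym2 ℕ)} (hE : NoLoop E)
    (hd : ∀ u, dg E u ≤ 3) (h : #E ≤ 15) : TIndep 5 E := by
  by_cases hv3 : ∃ v, dg E v = 3
  · obtain ⟨w, hw⟩ := hv3
    exact tIndep_five_of_dg_three hE hd h hw
  have two : ∀ F : Finset (Sym2 ℕ), NoLoop F → #F ≤ 15 → (∀ u, dg F u ≤ 2) → ∀ w, dg F w = 2 →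
      TIndep 5 F := by
    intro F hF hFc hFd w hw
    obtain ⟨E', hE', hm, hu, hw1, hw2, hT⟩ := exists_raise hF hFd (by norm_num) hw hFc
      (by norm_num)
    refine hT 5 ?_
    by_cases hw4 : dg E' w = 4
    · exact tIndep_five_of_single_dg_four hE' hm hw4 fun u huw => (hu u huw).trans (by norm_num)
    · refine tIndep_five_of_dg_three hE' (fun u => ?_) hm (w := w) (by omega)
      by_cases huw : u = w
      · subst huw; omega
      · exact (hu u huw).trans (by norm_num)
  have hd2 : ∀ v, dg E v ≤ 2 := fun v => by
    have := hd v
    have : dg E v ≠ 3 := fun h => hv3 ⟨v, h⟩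
    omega
  by_cases hv2 : ∃ v, dg E v = 2
  · obtain ⟨w, hw⟩ := hv2
    exact two E hE h hd2 w hw
  have hd1 : ∀ v, dg E v ≤ 1 := fun v => by
    have := hd2 v
    have : dg E v ≠ 2 := fun h => hv2 ⟨v, h⟩
    omega
  by_cases hv1 : ∃ v, dg E v = 1
  · obtain ⟨w, hw⟩ := hv1
    obtain ⟨E', hE', hm, hu, hw1, hw2, hT⟩ := exists_raise hE hd1 le_rfl hw h (by norm_num)
    refine hT 5 (two E' hE' hm (fun u => ?_) w (by omega))
    by_cases huw : u = w
    · subst huw; omega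
    · have := hu u huw; omega
  have : E = ∅ := eq_empty_of_dg_eq_zero fun v => by
    have := hd1 v
    have : dg E v ≠ 1 := fun h => hv1 ⟨v, h⟩
    omega
  rw [this]
  exact tIndep_empty 5

/-- Each hypothesis is the bound from one kind of member of `𝒞_{n,5}`: iterated cones over the
edgeless graph, the cone over `K_{3,3}`, `K_{3,4}` and `K_{4,4}`. -/
lemma tIndep_five {E : Finset (Sym2 ℕ)} (hE : NoLoop E) (hd : ∀ v, dg E v ≤ 5)
    (h : #E ≤ 15) (h2 : ∀ x y, dg E x + dg (del E x) y ≤ 9)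
    (h3 : ∀ x y z, dg E x + dg (del E x) y + dg (del (del E x) y) z ≤ 12)
    (h4 : ∀ x y z u, dg E x + dg (del E x) y + dg (del (del E x) y) z +
      dg (del (del (del E x) y) z) u ≤ 14)
    (hK33 : ∀ v A B, dg E v = 5 → #A = 3 → #B = 3 → ¬ CompleteBetween (del E v) A B)
    (hK34 : ∀ A B, #A = 3 → #B = 4 → ¬ CompleteBetween E A B)
    (hK44 : ∀ A B, #A = 4 → #B = 4 → Disjoint A B → (∀ x ∈ A ∪ B, 0 < dg E x) →
      ∑ x ∈ A, #(nb E x ∩ B) ≤ 13) :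
    TIndep 5 E := by
  by_cases hv5 : ∃ v, dg E v = 5
  · obtain ⟨v, hv⟩ := hv5
    have hc := card_del_add_dg E v
    refine TIndep.cone hE (hd v) (tIndep_four (hE.del v) (fun u => ?_) (by omega) (fun x y => ?_)
      (fun x y z => ?_) fun A B hA hB => hK33 v A B hv hA hB)
    · have := h2 v u; omega
    · have := h3 v x y; omega
    · have := h4 v x y z; omega
  have hd4 : ∀ v, dg E v ≤ 4 := fun v => by
    have := hd v
    have : dg E v ≠ 5 := fun h => hv5 ⟨v, h⟩
    omega
  by_cases hv4 : ∃ v, dg E v = 4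
  · obtain ⟨v, hv⟩ := hv4
    exact tIndep_five_of_dg_four hE hd4 h h4 hK34 hK44 hv
  exact tIndep_five_of_dg_le_three hE (fun v => by
    have := hd4 v
    have : dg E v ≠ 4 := fun h => hv4 ⟨v, h⟩
    omega) h

/-! ### Members of `𝒞_{n,t}` inside a vertex set -/

/-- The relation `R` on `W` embeds into a member of `𝒞_{|W|,t}` of weight `c`. -/
def Fits {V : Type u} (W : Finset V) (R : V → V → Prop) (t : ℕ) (c : ℤ) : Prop :=
  ∃ m, m = #W ∧ ∃ (F : CGraph m t) (φ : W → F.Vertex), Function.Injective φ ∧ F.weight = c ∧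
    ∀ x y : W, R x y → F.graph.Adj (φ x) (φ y)

lemma Fits.mono {V : Type u} {W : Finset V} {R R' : V → V → Prop} {t : ℕ} {c : ℤ} (h : Fits W R t c)
    (hR : ∀ x ∈ W, ∀ y ∈ W, R' x y → R x y) : Fits W R' t c := by
  obtain ⟨m, hm, F, φ, hφ, hc, h⟩ := h
  exact ⟨m, hm, F, φ, hφ, hc, fun x y hxy => h x y (hR x x.2 y y.2 hxy)⟩

lemma fits_empty {V : Type u} (W : Finset V) (t : ℕ) : Fits W (fun _ _ => False) t 0 :=
  ⟨#W, rfl, .empty _ _, W.equivFin, W.equivFin.injective, rfl, fun _ _ h => h.elim⟩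

lemma fits_complete {V : Type u} (W : Finset V) (h : 3 ≤ #W) : Fits W (fun x y => x ≠ y) 1 1 := by
  refine ⟨#W, rfl, .complete _ h, W.equivFin, W.equivFin.injective, rfl, fun x y hxy => ?_⟩
  change (⊤ : SimpleGraph (Fin #W)).Adj _ _
  rw [SimpleGraph.top_adj]
  exact fun h => hxy (congrArg Subtype.val (W.equivFin.injective h))

lemma fits_bipartite {V : Type u} [DecidableEq V] {W A B : Finset V} {t : ℕ} (hAW : A ⊆ W) (hBW : B ⊆ W) (hAB : Disjoint A B)
    (ha : 3 ≤ #A) (hat : #A ≤ t - 1) (hb : 3 ≤ #B) (hbt : #B ≤ t - 1) (hab : t + 2 ≤ #A + #B) :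
    Fits W (fun x y => (x ∈ A ∧ y ∈ B) ∨ (x ∈ B ∧ y ∈ A)) t
      ((#A : ℤ) * #B - ((#A + #B - t).choose 2 : ℤ)) := by
  have hun : #A + #B ≤ #W := by
    rw [← card_union_of_disjoint hAB]
    exact card_le_card (union_subset hAW hBW)
  have hrest : #(W \ (A ∪ B)) = #W - #A - #B := by
    rw [card_sdiff_of_subset (union_subset hAW hBW), card_union_of_disjoint hAB]
    omega
  let e := (W \ (A ∪ B)).equivFinOfCardEq hrest
  let φ : W → (Fin #A ⊕ Fin #B) ⊕ Fin (#W - #A - #B) := fun x =>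
    if hA : x.1 ∈ A then .inl (.inl (A.equivFin ⟨x, hA⟩))
    else if hB : x.1 ∈ B then .inl (.inr (B.equivFin ⟨x, hB⟩))
    else .inr (e ⟨x, by simp [hA, hB]⟩)
  have hφA : ∀ x : W, ∀ h : x.1 ∈ A, φ x = .inl (.inl (A.equivFin ⟨x, h⟩)) := fun x h => by
    simp [φ, h]
  have hφB : ∀ x : W, ∀ h : x.1 ∈ B, φ x = .inl (.inr (B.equivFin ⟨x, h⟩)) := fun x h => by
    have : x.1 ∉ A := disjoint_right.1 hAB h
    simp [φ, h, this]
  have hinj : Function.Injective φ := by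
    intro x y hxy
    simp only [φ] at hxy
    split_ifs at hxy <;> simp at hxy <;> simp [hxy]
  refine ⟨#W, rfl, .bipartite _ t #A #B ha hat hb hbt hab hun, φ, hinj, rfl, ?_⟩
  · rintro x y (⟨hx, hy⟩ | ⟨hx, hy⟩)
    · change (completeBipartiteGraph (Fin #A) (Fin #B) ⊕g
        (⊥ : SimpleGraph (Fin (#W - #A - #B)))).Adj (φ x) (φ y)
      rw [hφA x hx, hφB y hy]
      simp [completeBipartiteGraph]
    · change (completeBipartiteGraph (Fin #A) (Fin #B) ⊕g
        (⊥ : SimpleGraph (Fin (#W - #A - #B)))).Adj (φ x) (φ y)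
      rw [hφB x hx, hφA y hy]
      simp [completeBipartiteGraph]

lemma Fits.cone {V : Type u} [DecidableEq V] {W : Finset V} {R : V → V → Prop} {t : ℕ} {c : ℤ}
    (h : Fits W R t c)
    (ht : 1 ≤ t) (hW : t + 2 ≤ #W) {v : V} (hv : v ∉ W) :
    Fits (insert v W) (fun x y => x ≠ y ∧ (x = v ∨ y = v ∨ R x y)) (t + 1) (c + (t + 1 : ℕ)) := by
  obtain ⟨m, rfl, F, φ, hφ, hc, hF⟩ := h
  have mem : ∀ x : {x // x ∈ insert v W}, x.1 ≠ v → x.1 ∈ W := fun x hx =>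
    (mem_insert.1 x.2).resolve_left hx
  let ψ : {x // x ∈ insert v W} → F.Vertex ⊕ Fin 1 := fun x =>
    if hx : x.1 = v then .inr 0 else .inl (φ ⟨x, mem x hx⟩)
  have hψv : ∀ x : {x // x ∈ insert v W}, x.1 = v → ψ x = .inr 0 := fun x h => by simp [ψ, h]
  have hψ : ∀ x : {x // x ∈ insert v W}, ∀ h : x.1 ≠ v, ψ x = .inl (φ ⟨x, mem x h⟩) :=
    fun x h => by simp [ψ, h]
  have h1 : 2 ≤ t + 1 := by omega
  have h2 : (t + 1) + 2 ≤ #W + 1 := by omega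
  refine ⟨#W + 1, (card_insert_of_notMem hv).symm, CGraph.cone h1 h2 F, ψ, ?_, ?_, ?_⟩
  · intro x y hxy
    apply Subtype.ext
    by_cases hx : x.1 = v <;> by_cases hy : y.1 = v
    · rw [hx, hy]
    · rw [hψv x hx, hψ y hy] at hxy; cases hxy
    · rw [hψ x hx, hψv y hy] at hxy; cases hxy
    · rw [hψ x hx, hψ y hy] at hxy
      have := hφ (Sum.inl_injective hxy)
      simpa using this
  · simp only [CGraph.weight, hc]
  · rintro x y ⟨hne, h⟩
    change (graphJoin F.graph (⊤ : SimpleGraph (Fin 1))).Adj (ψ x) (ψ y)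
    by_cases hx : x.1 = v <;> by_cases hy : y.1 = v
    · exact absurd (hx.trans hy.symm) hne
    · rw [hψv x hx, hψ y hy]; simp [graphJoin, completeBipartiteGraph]
    · rw [hψ x hx, hψv y hy]; simp [graphJoin, completeBipartiteGraph]
    · rw [hψ x hx, hψ y hy]
      have hR := (h.resolve_left hx).resolve_left hy
      simpa [graphJoin, completeBipartiteGraph] using hF ⟨x, mem x hx⟩ ⟨y, mem y hy⟩ hR

/-- The cone vertices are added one at a time, and the weight gained is the current dimension: `t +
1, t + 2, …, t + #S`. -/
lemma Fits.cones {V : Type u} [DecidableEq V] {W : Finset V} {R : V → V → Prop} {t : ℕ} {c : ℤ}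
    (h : Fits W R t c) (ht : 1 ≤ t) (hW : t + 2 ≤ #W) (S : Finset V) (hS : Disjoint W S) :
    Fits (W ∪ S) (fun x y => x ≠ y ∧ (x ∈ S ∨ y ∈ S ∨ R x y)) (t + #S)
      (c + ∑ i ∈ range #S, ((t + i + 1 : ℕ) : ℤ)) := by
  induction S using Finset.induction_on with
  | empty =>
    simp only [union_empty, card_empty, range_zero, sum_empty, add_zero, notMem_empty, false_or]
    exact h.mono fun x _ y _ hxy => hxy.2
  | insert v S hvS ih =>
    have hd : Disjoint W S := hS.mono_right (subset_insert _ _)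
    have hvW : v ∉ W := fun hm => disjoint_left.1 hS hm (mem_insert_self _ _)
    have h1 := (ih hd).cone (v := v) (by omega) (by rw [card_union_of_disjoint hd]; omega)
      (by simp [hvW, hvS])
    rw [card_insert_of_notMem hvS, sum_range_succ, union_insert, ← add_assoc, ← add_assoc]
    refine h1.mono fun x _ y _ hxy => ⟨hxy.1, ?_⟩
    simp only [mem_insert] at hxy
    tauto

/-- Isolated vertices cost nothing, so the subgraph can be taken on all of `V` and the definition
becomes a count of edges. -/
lemma CIndependent.card_le {V : Type u} [Fintype V] [DecidableEq V] {t : ℕ} {G : SimpleGraph V}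
    (hG : CIndependent t G) {R : V → V → Prop} {c : ℤ} (hR : Fits (univ : Finset V) R t c)
    (s : Finset (Sym2 V)) (hs : ∀ x y, s(x, y) ∈ s → G.Adj x y ∧ R x y) : (#s : ℤ) ≤ c := by
  obtain ⟨m, hm, F, φ, hφ, rfl, hF⟩ := hR
  rw [card_univ] at hm
  subst hm
  let H : G.Subgraph :=
    { verts := Set.univ
      Adj := fun x y => s(x, y) ∈ s
      adj_sub := fun h => (hs _ _ h).1
      edge_vert := fun _ => Set.mem_univ _
      symm := ⟨fun x y h => by rw [Sym2.eq_swap]; exact h⟩ }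
  have hH : H.edgeSet = (s : Set (Sym2 V)) := by
    ext e
    induction e with
    | _ x y => rfl
  have hcont : H.coe.IsContained F.graph := by
    refine ⟨⟨⟨fun x => φ ⟨x.1, mem_univ _⟩, ?_⟩, ?_⟩⟩
    · intro x y hxy
      exact hF _ _ (hs _ _ hxy).2
    · intro x y hxy
      have := hφ hxy
      exact Subtype.ext (by simpa using this)
  have := hG H F hcont
  rwa [hH, Set.ncard_coe_finset] at this

/-! ### From `𝒞_t`-independence to generic independence -/

/-- `𝒞_t`-independence for a finite set `E` of edges on the vertex set `W`. -/
structure Sparse {V : Type u} (t : ℕ) (W : Finset V) (E : Finset (Sym2 V)) : Prop where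
  noLoop : ∀ v, s(v, v) ∉ E
  supp : ∀ x y, s(x, y) ∈ E → x ∈ W
  card_le_of_fits : ∀ R c, Fits W R t c → ∀ s ⊆ E, (∀ x y, s(x, y) ∈ s → R x y) → (#s : ℤ) ≤ c

/-- The edges outside `D` are covered by `T`, hence lie in an iterated cone over the edgeless graph,
of weight `t + (t - 1) + ⋯`. This is the source of the degree bounds for one to four vertices. -/
lemma Sparse.card_add_le {t : ℕ} {W : Finset ℕ} {E : Finset (Sym2 ℕ)} (h : Sparse t W E)
    (hW : t + 2 ≤ #W) {T : Finset ℕ} {k : ℕ} (hT : #T ≤ k) (hk : k + 1 ≤ t)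
    {D : Finset (Sym2 ℕ)} (hD : ∀ x y, s(x, y) ∈ E → s(x, y) ∉ D → x ∈ T ∨ y ∈ T) :
    #E ≤ #D + ∑ i ∈ range k, (t - i) := by
  set S := T ∩ W with hS
  have hST : #S ≤ k := (card_le_card inter_subset_left).trans hT
  have hSW : S ⊆ W := inter_subset_right
  have hcard : #(W \ S) + #S = #W := card_sdiff_add_card_eq_card hSW
  have hf := (fits_empty (W \ S) (t - #S)).cones (by omega) (by omega) S sdiff_disjoint
  rw [sdiff_union_of_subset hSW, Nat.sub_add_cancel (by omega), zero_add] at hf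
  have := h.card_le_of_fits _ _ hf (E \ D) sdiff_subset (by
    intro x y hxy
    rw [mem_sdiff] at hxy
    refine ⟨?_, ?_⟩
    · rintro rfl
      exact h.noLoop _ hxy.1
    · have hx := h.supp x y hxy.1
      have hy := h.supp y x (by rw [Sym2.eq_swap]; exact hxy.1)
      rcases hD x y hxy.1 hxy.2 with h | h <;> simp [*])
  have hle : ∑ i ∈ range #S, (t - #S + i + 1) ≤ ∑ i ∈ range k, (t - i) := by
    rw [← sum_range_reflect]
    refine le_trans (sum_le_sum fun i hi => ?_)
      (sum_le_sum_of_subset (range_subset_range.2 hST))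
    have := mem_range.1 hi
    omega
  have h1 : #(E \ D) ≤ ∑ i ∈ range #S, (t - #S + i + 1) := by exact_mod_cast this
  have h2 : #E ≤ #(E \ D) + #D := by
    have := le_card_sdiff D E
    omega
  omega

/-- Coning the complete member for `t = 1` exactly `t - 1` times yields the whole complete graph;
its weight is the full rank `(t + 1).choose 2`. -/
lemma Sparse.card_le {t : ℕ} {W : Finset ℕ} {E : Finset (Sym2 ℕ)} (h : Sparse t W E)
    (hW : t + 2 ≤ #W) (ht : 1 ≤ t) : #E ≤ 1 + ∑ i ∈ range (t - 1), (i + 2) := by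
  obtain ⟨S, hSW, hS⟩ := exists_subset_card_eq (s := W) (n := t - 1) (by omega)
  have hcard : #(W \ S) + #S = #W := card_sdiff_add_card_eq_card hSW
  have hf := (fits_complete (W \ S) (by omega)).cones le_rfl (by omega) S sdiff_disjoint
  rw [sdiff_union_of_subset hSW, hS, Nat.add_sub_cancel' ht] at hf
  have := h.card_le_of_fits _ _ hf E subset_rfl (by
    intro x y hxy
    have : x ≠ y := by
      rintro rfl
      exact h.noLoop _ hxy
    exact ⟨this, .inr (.inr this)⟩)
  have h1 : #E ≤ 1 + ∑ i ∈ range (t - 1), (1 + i + 1) := by exact_mod_cast this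
  refine h1.trans (le_of_eq ?_)
  congr 1
  exact sum_congr rfl fun i _ => by omega

lemma Sparse.card_le_bipartite {t r : ℕ} {W A B S : Finset ℕ} {E s : Finset (Sym2 ℕ)}
    (h : Sparse t W E) (hA : A ⊆ W) (hB : B ⊆ W) (hS : S ⊆ W) (hAB : Disjoint A B)
    (hAS : Disjoint A S) (hBS : Disjoint B S) (hr : r + #S = t)
    (ha : 3 ≤ #A) (hat : #A ≤ r - 1) (hb : 3 ≤ #B) (hbt : #B ≤ r - 1) (hab : r + 2 ≤ #A + #B)
    (hs : s ⊆ E) (hs' : ∀ x y, s(x, y) ∈ s → x ∈ S ∨ y ∈ S ∨ (x ∈ A ∧ y ∈ B) ∨ (x ∈ B ∧ y ∈ A)) :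
    (#s : ℤ) ≤ #A * #B - ((#A + #B - r).choose 2 : ℤ) +
      ∑ i ∈ range #S, ((r + i + 1 : ℕ) : ℤ) := by
  have hcard : #(W \ S) + #S = #W := card_sdiff_add_card_eq_card hS
  have hAW : A ⊆ W \ S := subset_sdiff.2 ⟨hA, hAS⟩
  have hBW : B ⊆ W \ S := subset_sdiff.2 ⟨hB, hBS⟩
  have hle := card_le_card (union_subset hAW hBW)
  rw [card_union_of_disjoint hAB] at hle
  have hf := (fits_bipartite hAW hBW hAB ha hat hb hbt hab).cones (by omega) (by omega) S
    sdiff_disjoint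
  rw [sdiff_union_of_subset hS, hr] at hf
  refine h.card_le_of_fits _ _ hf s hs fun x y hxy => ⟨?_, hs' x y hxy⟩
  rintro rfl
  exact h.noLoop _ (hs hxy)

lemma Sparse.mem_of_dg_pos {t : ℕ} {W : Finset ℕ} {E : Finset (Sym2 ℕ)} (h : Sparse t W E)
    {x : ℕ} (hx : 0 < dg E x) : x ∈ W := by
  obtain ⟨y, hy⟩ := card_pos.1 hx
  exact h.supp x y (mem_nb.1 hy)

/-- The edges of `E` joining `A` and `B`. -/
def between (E : Finset (Sym2 ℕ)) (A B : Finset ℕ) : Finset (Sym2 ℕ) :=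
  (A.sigma fun a => nb E a ∩ B).image fun x => s(x.1, x.2)

lemma between_subset (E : Finset (Sym2 ℕ)) (A B : Finset ℕ) : between E A B ⊆ E := by
  intro e he
  simp only [between, mem_image, mem_sigma, mem_inter] at he
  obtain ⟨x, ⟨_, hx, _⟩, rfl⟩ := he
  exact mem_nb.1 hx

lemma mem_between {E : Finset (Sym2 ℕ)} {A B : Finset ℕ} {x y : ℕ} (h : s(x, y) ∈ between E A B) :
    (x ∈ A ∧ y ∈ B) ∨ (x ∈ B ∧ y ∈ A) := by
  simp only [between, mem_image, mem_sigma, mem_inter] at h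
  obtain ⟨z, ⟨h1, _, h2⟩, h⟩ := h
  rcases Sym2.eq_iff.1 h with ⟨rfl, rfl⟩ | ⟨rfl, rfl⟩
  · exact .inl ⟨h1, h2⟩
  · exact .inr ⟨h2, h1⟩

lemma card_between {E : Finset (Sym2 ℕ)} {A B : Finset ℕ} (h : Disjoint A B) :
    #(between E A B) = ∑ a ∈ A, #(nb E a ∩ B) := by
  rw [between, card_image_of_injOn, card_sigma]
  rintro ⟨a, b⟩ hx ⟨a', b'⟩ hy hxy
  simp only [coe_sigma, Set.mem_sigma_iff, mem_coe, mem_inter] at hx hy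
  rcases Sym2.eq_iff.1 hxy with ⟨h1, h2⟩ | ⟨h1, h2⟩
  · simp only at h1 h2
    subst h1 h2
    rfl
  · simp only at h1 h2
    subst h1 h2
    exact absurd hy.2.2 (disjoint_left.1 h hx.1)

lemma card_between_of_completeBetween {E : Finset (Sym2 ℕ)} {A B : Finset ℕ}
    (h : Disjoint A B) (hc : CompleteBetween E A B) : #(between E A B) = #A * #B := by
  rw [card_between h, ← smul_eq_mul, ← sum_const]
  refine sum_congr rfl fun a ha => congrArg card (inter_eq_right.2 fun b hb => ?_)
  exact mem_nb.2 (hc a ha b hb)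

lemma CompleteBetween.subset_left {t : ℕ} {W A B : Finset ℕ} {E : Finset (Sym2 ℕ)}
    (h : Sparse t W E) (hc : CompleteBetween E A B) (hB : B.Nonempty) : A ⊆ W := by
  obtain ⟨b, hb⟩ := hB
  exact fun a ha => h.supp a b (hc a ha b hb)

lemma CompleteBetween.subset_right {t : ℕ} {W A B : Finset ℕ} {E : Finset (Sym2 ℕ)}
    (h : Sparse t W E) (hc : CompleteBetween E A B) (hA : A.Nonempty) : B ⊆ W :=
  hc.symm.subset_left h hA

lemma Sparse.dg_le {t : ℕ} {W : Finset ℕ} {E : Finset (Sym2 ℕ)} (h : Sparse t W E)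
    (hW : t + 2 ≤ #W) (ht : 2 ≤ t) (x : ℕ) : dg E x ≤ t := by
  have := h.card_add_le hW (T := {x}) (k := 1) (by simp) (by omega) (D := del E x)
    (by intro a b hab hD; simp [mem_del] at hD ⊢; have := hD hab; tauto)
  have h1 := card_del_add_dg E x
  simp at this
  omega

lemma Sparse.dg_pair_le {t : ℕ} {W : Finset ℕ} {E : Finset (Sym2 ℕ)} (h : Sparse t W E)
    (hW : t + 2 ≤ #W) (ht : 3 ≤ t) (x y : ℕ) : dg E x + dg (del E x) y ≤ 2 * t - 1 := by
  have := h.card_add_le hW (T := {x, y}) (k := 2) card_le_two (by omega) (D := del (del E x) y)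
    (by intro a b hab hD; simp [mem_del] at hD ⊢; grind)
  have h1 := card_del_add_dg E x
  have h2 := card_del_add_dg (del E x) y
  simp [sum_range_succ] at this
  omega

lemma Sparse.dg_triple_le {t : ℕ} {W : Finset ℕ} {E : Finset (Sym2 ℕ)} (h : Sparse t W E)
    (hW : t + 2 ≤ #W) (ht : 4 ≤ t) (x y z : ℕ) :
    dg E x + dg (del E x) y + dg (del (del E x) y) z ≤ 3 * t - 3 := by
  have := h.card_add_le hW (T := {x, y, z}) (k := 3) card_le_three (by omega)
    (D := del (del (del E x) y) z)
    (by intro a b hab hD; simp [mem_del] at hD ⊢; grind)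
  have h1 := card_del_add_dg E x
  have h2 := card_del_add_dg (del E x) y
  have h3 := card_del_add_dg (del (del E x) y) z
  simp [sum_range_succ] at this
  omega

lemma Sparse.dg_quad_le {t : ℕ} {W : Finset ℕ} {E : Finset (Sym2 ℕ)} (h : Sparse t W E)
    (hW : t + 2 ≤ #W) (ht : 5 ≤ t) (x y z w : ℕ) :
    dg E x + dg (del E x) y + dg (del (del E x) y) z + dg (del (del (del E x) y) z) w
      ≤ 4 * t - 6 := by
  have := h.card_add_le hW (T := {x, y, z, w}) (k := 4) card_le_four (by omega)
    (D := del (del (del (del E x) y) z) w)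
    (by intro a b hab hD; simp [mem_del] at hD ⊢; grind)
  have h1 := card_del_add_dg E x
  have h2 := card_del_add_dg (del E x) y
  have h3 := card_del_add_dg (del (del E x) y) z
  have h4 := card_del_add_dg (del (del (del E x) y) z) w
  simp [sum_range_succ] at this
  omega

/-- The bipartite members contradict the forbidden patterns by one edge: `K_{3,3}` has 9 edges and
weight 8 for `t = 4`; its cone with apex degree five gives 14 edges and weight 13 for `t = 5`;
`K_{3,4}` has 12 edges and weight 11; `K_{4,4}` has weight 13. -/
lemma Sparse.tIndep {t : ℕ} {W : Finset ℕ} {E : Finset (Sym2 ℕ)} (h : Sparse t W E)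
    (hW : t + 2 ≤ #W) (ht : 1 ≤ t) (ht5 : t ≤ 5) : TIndep t E := by
  have hE : NoLoop E := h.noLoop
  have hcard := h.card_le hW ht
  have ne : ∀ {A : Finset ℕ}, 3 ≤ #A → A.Nonempty := fun hA => card_pos.1 (by omega)
  interval_cases t
  · exact tIndep_one hE (by simpa using hcard)
  · exact tIndep_two hE (h.dg_le hW le_rfl) (by simpa [sum_range_succ] using hcard)
  · exact tIndep_three hE (h.dg_le hW (by omega)) (by simpa [sum_range_succ] using hcard)
      (h.dg_pair_le hW le_rfl)
  · refine tIndep_four hE (h.dg_le hW (by omega)) (by simpa [sum_range_succ] using hcard)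
      (h.dg_pair_le hW (by omega)) (h.dg_triple_le hW le_rfl) fun A B hA hB hc => ?_
    have hd := hc.disjoint hE
    have := h.card_le_bipartite (r := 4) (S := ∅) (hc.subset_left h (ne hB.ge))
      (hc.subset_right h (ne hA.ge)) (empty_subset _) hd (by simp) (by simp) (by simp)
      (by omega) (by omega) (by omega) (by omega) (by omega) (between_subset E A B)
      (fun x y hxy => .inr (.inr (mem_between hxy)))
    rw [card_between_of_completeBetween hd hc, hA, hB] at this
    norm_num [Nat.choose] at this
  · refine tIndep_five hE (h.dg_le hW (by omega)) (by simpa [sum_range_succ] using hcard)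
      (h.dg_pair_le hW (by omega)) (h.dg_triple_le hW (by omega)) (h.dg_quad_le hW le_rfl)
      (fun v A B hv hA hB hc => ?_) (fun A B hA hB hc => ?_) fun A B hA hB hd hpos => ?_
    · have hcE : CompleteBetween E A B := fun a ha b hb => del_subset E v (hc a ha b hb)
      have hd := hc.disjoint (hE.del v)
      have hvA : v ∉ A := fun hv => by
        obtain ⟨b, hb⟩ := ne hB.ge
        simpa [mem_del] using hc v hv b hb
      have hvB : v ∉ B := fun hv => by
        obtain ⟨b, hb⟩ := ne hA.ge
        simpa [mem_del] using hc b hb v hv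
      have := h.card_le_bipartite (r := 4) (S := {v}) (s := (E \ del E v) ∪ between (del E v) A B)
        (hcE.subset_left h (ne hB.ge))
        (hcE.subset_right h (ne hA.ge)) (singleton_subset_iff.2 (h.mem_of_dg_pos (by omega))) hd
        (by simpa) (by simpa) (by simp)
        (by omega) (by omega) (by omega) (by omega) (by omega)
        (union_subset sdiff_subset ((between_subset _ A B).trans (del_subset E v)))
        (fun x y hxy => by
          rcases mem_union.1 hxy with hxy | hxy
          · simp [mem_del] at hxy
            have := hxy.2 hxy.1
            simp
            grind
          · exact .inr (.inr (mem_between hxy)))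
      rw [card_union_of_disjoint (sdiff_disjoint.mono_right (between_subset _ _ _)),
        card_between_of_completeBetween hd hc, hA, hB, card_sdiff_of_subset (del_subset E v)] at this
      have h1 := card_del_add_dg E v
      rw [show #E - #(del E v) = 5 by omega] at this
      norm_num [Nat.choose] at this
    · have hd := hc.disjoint hE
      have := h.card_le_bipartite (r := 5) (S := ∅) (hc.subset_left h (ne (by omega)))
        (hc.subset_right h (ne hA.ge)) (empty_subset _) hd (by simp) (by simp) (by simp)
        (by omega) (by omega) (by omega) (by omega) (by omega) (between_subset E A B)
        (fun x y hxy => .inr (.inr (mem_between hxy)))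
      rw [card_between_of_completeBetween hd hc, hA, hB] at this
      norm_num [Nat.choose] at this
    · have := h.card_le_bipartite (r := 5) (S := ∅)
        (fun x hx => h.mem_of_dg_pos (hpos x (mem_union_left _ hx)))
        (fun x hx => h.mem_of_dg_pos (hpos x (mem_union_right _ hx)))
        (empty_subset _) hd (by simp) (by simp) (by simp)
        (by omega) (by omega) (by omega) (by omega) (by omega) (between_subset E A B)
        (fun x y hxy => .inr (.inr (mem_between hxy)))
      rw [card_between hd, hA, hB] at this
      have h2 : (#A + #B - 5).choose 2 = 3 := by rw [hA, hB]; rfl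
      norm_num [Nat.choose] at this
      exact_mod_cast this

/-- On `t + 1` vertices all degrees are at most `t`, so every vertex can be coned off in turn. This
covers the range in which the only member of the family is edgeless. -/
lemma tIndep_of_card_le {t : ℕ} {W : Finset ℕ} {E : Finset (Sym2 ℕ)} (hE : NoLoop E)
    (hW : ∀ x y, s(x, y) ∈ E → x ∈ W) (ht : #W ≤ t + 1) : TIndep t E := by
  induction t generalizing W E with
  | zero =>
    have : E = ∅ := by
      rw [eq_empty_iff_forall_notMem]
      intro e
      induction e with | _ x y =>
      intro he
      have hx := hW x y he
      have hy := hW y x (by rw [Sym2.eq_swap]; exact he)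
      obtain rfl := card_le_one.1 ht x hx y hy
      exact hE _ he
    rw [this]
    exact tIndep_empty _
  | succ t ih =>
    rcases W.eq_empty_or_nonempty with rfl | ⟨v, hv⟩
    · have : E = ∅ := by
        rw [eq_empty_iff_forall_notMem]
        intro e
        induction e with | _ x y => exact fun he => absurd (hW x y he) (notMem_empty _)
      rw [this]
      exact tIndep_empty _
    · have hc := card_erase_of_mem hv
      refine TIndep.cone hE (v := v) ?_ (ih (W := W.erase v) (hE.del v) ?_ (by omega))
      · refine le_trans (card_le_card fun y hy => ?_) (hc.trans_le (by omega))
        refine mem_erase.2 ⟨?_, hW y v (by rw [Sym2.eq_swap]; exact mem_nb.1 hy)⟩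
        rintro rfl
        exact hE _ (mem_nb.1 hy)
      · intro x y hxy
        rw [mem_del] at hxy
        refine mem_erase.2 ⟨?_, hW x y hxy.1⟩
        rintro rfl
        exact hxy.2 (by simp)

lemma indep_of_tIndep {V : Type u} [Fintype V] {t : ℕ} {p : V → Fin t → ℝ} (hp : IsGeneric p)
    {ι : V ↪ ℕ} {X : Finset (Sym2 V)} (hX : (X : Set (Sym2 V)) ⊆ completeEdges V)
    (hT : TIndep t (X.image (Sym2.map ι))) : (symTensorMatroid p).Indep (X : Set (Sym2 V)) := by
  obtain ⟨q, hq⟩ := hT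
  rw [symTensorMatroid, linearMatroid_indep_iff, linearIndepOn_symTensor_iff]
  refine ⟨hX, ?_⟩
  refine hp.linearIndepOn_edgeMat (Set.toFinite _) (q := fun v => q (ι v)) ?_
  have hcomp : edgeMat (fun v => q (ι v)) = edgeMat q ∘ Sym2.map ι := by
    ext e : 1
    induction e with | _ x y => rfl
  rw [hcomp]
  have := hq.comp (fun e : (X : Set (Sym2 V)) => (⟨Sym2.map ι e.1, by
    rw [coe_image]
    exact Set.mem_image_of_mem _ e.2⟩ : ((X.image (Sym2.map ι) : Finset _) : Set (Sym2 ℕ)))) (by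
      intro e f hef
      exact Subtype.ext (Sym2.map.injective ι.injective (congrArg Subtype.val hef)))
  exact this

open Classical in
/-- A `𝒞_t`-independent graph is independent in the symmetric `t`-tensor matroid. -/
theorem CIndependent.indep {V : Type u} [Fintype V] {t : ℕ} (ht : 1 ≤ t) (ht5 : t ≤ 5)
    {G : SimpleGraph V} (hG : CIndependent t G) {p : V → Fin t → ℝ} (hp : IsGeneric p) :
    (symTensorMatroid p).Indep G.edgeSet := by
  let ι : V ↪ ℕ := (Fintype.equivFin V).toEmbedding.trans Fin.valEmbedding
  have hι : Function.Injective (Sym2.map ι) := Sym2.map.injective ι.injective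
  set E : Finset (Sym2 ℕ) := G.edgeFinset.image (Sym2.map ι) with hEdef
  have mem : ∀ x y, s(x, y) ∈ E → ∃ a b, G.Adj a b ∧ ι a = x ∧ ι b = y := by
    intro x y hxy
    obtain ⟨e, he, h⟩ := mem_image.1 hxy
    induction e with | _ a b =>
    rw [SimpleGraph.mem_edgeFinset, SimpleGraph.mem_edgeSet] at he
    rcases Sym2.eq_iff.1 h with ⟨h1, h2⟩ | ⟨h1, h2⟩
    · exact ⟨a, b, he, h1, h2⟩
    · exact ⟨b, a, he.symm, h2, h1⟩
  have hE : NoLoop E := by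
    intro v hv
    obtain ⟨a, b, hab, h1, h2⟩ := mem _ _ hv
    exact hab.ne (ι.injective (h1.trans h2.symm))
  have hsupp : ∀ x y, s(x, y) ∈ E → x ∈ univ.map ι := by
    intro x y hxy
    obtain ⟨a, b, hab, rfl, rfl⟩ := mem _ _ hxy
    simp
  have hT : TIndep t E := by
    by_cases hn : Fintype.card V ≤ t + 1
    · exact tIndep_of_card_le hE hsupp (by rwa [card_map])
    · refine Sparse.tIndep (W := univ.map ι) ⟨hE, hsupp, ?_⟩ (by rw [card_map, card_univ]; omega)
        ht ht5
      rintro R c ⟨m, hm, F, φ, hφ, hc, hF⟩ s hs hR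
      have hfit : Fits (univ : Finset V) (fun x y => R (ι x) (ι y)) t c :=
        ⟨m, by rw [hm, card_map], F, fun x => φ ⟨ι x, by simp⟩, fun x y hxy => by
          have := hφ hxy
          simpa using this, hc, fun x y h => hF _ _ h⟩
      have := hG.card_le hfit (G.edgeFinset.filter fun e => Sym2.map ι e ∈ s) (by
        intro x y hxy
        simp only [mem_filter, SimpleGraph.mem_edgeFinset, SimpleGraph.mem_edgeSet,
          Sym2.map_mk] at hxy
        exact ⟨hxy.1, hR _ _ hxy.2⟩)
      refine le_trans ?_ this
      rw [Nat.cast_le, ← card_image_of_injective _ hι]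
      refine card_le_card fun e he => ?_
      obtain ⟨f, hf, rfl⟩ := mem_image.1 (hs he)
      exact mem_image_of_mem _ (mem_filter.2 ⟨hf, he⟩)
  have := indep_of_tIndep hp (by simp) hT
  rwa [SimpleGraph.coe_edgeFinset] at this

/-! ### Rank bounds in abstract symmetric tensor matroids -/

/-- The rank of a set in a matroid, as a natural number. -/
noncomputable def Matroid.natRk {α : Type u} (M : Matroid α) (X : Set α) : ℕ := (M.eRk X).toNat

namespace Matroid

lemma natRk_closure {α : Type u} (M : Matroid α) (X : Set α) :
    M.natRk (M.closure X) = M.natRk X := by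
  rw [natRk, eRk_closure_eq, natRk]

variable {α : Type u} [Finite α] (M : Matroid α)

lemma coe_natRk (X : Set α) : (M.natRk X : ℕ∞) = M.eRk X :=
  ENat.natCast_toNat (((M.eRk_le_encard X).trans_lt (Set.toFinite X).encard_lt_top).ne)

lemma natRk_mono {X Y : Set α} (h : X ⊆ Y) : M.natRk X ≤ M.natRk Y := by
  have := M.eRk_mono h
  rw [← coe_natRk, ← coe_natRk] at this
  exact_mod_cast this

lemma natRk_union_le (X Y : Set α) : M.natRk (X ∪ Y) ≤ M.natRk X + Y.ncard := by
  have := M.eRk_union_le_eRk_add_encard X Y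
  rw [← coe_natRk, ← coe_natRk, ← (Set.toFinite Y).cast_ncard_eq] at this
  exact_mod_cast this

lemma natRk_inter_add_natRk_union_le (X Y : Set α) :
    M.natRk (X ∩ Y) + M.natRk (X ∪ Y) ≤ M.natRk X + M.natRk Y := by
  have := M.eRk_inter_add_eRk_union_le X Y
  simp only [← coe_natRk] at this
  exact_mod_cast this

variable {M}

lemma Indep.ncard_le_natRk {I X : Set α} (hI : M.Indep I) (hIX : I ⊆ X) :
    I.ncard ≤ M.natRk X := by
  have := hI.encard_le_eRk_of_subset hIX
  rw [← coe_natRk, ← (Set.toFinite I).cast_ncard_eq] at this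
  exact_mod_cast this

end Matroid

/-- The edges of the complete graph that meet `S`. -/
def starSet {V : Type u} (S : Finset V) : Set (Sym2 V) := {e | e ∈ completeEdges V ∧ ∃ x ∈ S, x ∈ e}

lemma mk_mem_starSet {V : Type u} {S : Finset V} {x y : V} :
    s(x, y) ∈ starSet S ↔ x ≠ y ∧ (x ∈ S ∨ y ∈ S) := by
  simp only [starSet, Set.mem_ofPred_eq, SimpleGraph.mem_edgeSet, SimpleGraph.top_adj,
    Sym2.mem_iff]
  grind

namespace IsAbstractSymTensorMatroid

variable {V : Type u} {t : ℕ} {M : Matroid (Sym2 V)}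

/-- The star circuits say that `t` edges at `v` span every edge at `v`. -/
lemma mem_closure [DecidableEq V] (h : IsAbstractSymTensorMatroid t M) {v : V} {U : Finset V} (hv : v ∉ U)
    (hU : t ≤ #U) {x : V} (hx : x ≠ v) : s(v, x) ∈ M.closure ((fun u => s(v, u)) '' (U : Set V)) := by
  have ground : ∀ y, y ≠ v → s(v, y) ∈ M.E := fun y hy => by
    rw [h.ground_eq]
    simpa using hy.symm
  by_cases hxU : x ∈ U
  · refine M.mem_closure_of_mem' ⟨x, hxU, rfl⟩ (ground x hx)
  · obtain ⟨U', hU', hc⟩ := exists_subset_card_eq hU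
    have hxU' : x ∉ U' := fun hm => hxU (hU' hm)
    have hC := h.isCircuit_star v (insert x U')
      (by simp only [mem_insert, not_or]; exact ⟨hx.symm, fun hm => hv (hU' hm)⟩)
      (by rw [card_insert_of_notMem hxU', hc])
    have := hC.mem_closure_sdiff_singleton_of_mem (e := s(v, x)) ⟨x, by simp, rfl⟩
    refine M.closure_subset_closure ?_ this
    rintro _ ⟨⟨y, hy, rfl⟩, hne⟩
    simp only [coe_insert, Set.mem_insert_iff, mem_coe] at hy
    rcases hy with rfl | hy
    · exact absurd rfl hne
    · exact ⟨y, hU' hy, rfl⟩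

lemma natRk_ground [Fintype V] (h : IsAbstractSymTensorMatroid t M) : M.natRk M.E = (t + 1).choose 2 := by
  have := h.rank_eq
  rw [← M.eRk_ground, ← M.coe_natRk] at this
  exact_mod_cast this

lemma natRk_le [Fintype V] (h : IsAbstractSymTensorMatroid t M) (X : Set (Sym2 V)) :
    M.natRk X ≤ (t + 1).choose 2 := by
  have := M.eRk_le_eRank X
  rw [h.rank_eq, ← M.coe_natRk] at this
  exact_mod_cast this

/-- Adding `v` to `S` costs at most `t - #S`: the edges from `v` to `S` are already present, and `t
- #S` further ones complete them to `t` edges at `v`, which span the rest of its star. -/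
lemma natRk_starSet_le [Fintype V] [DecidableEq V] (h : IsAbstractSymTensorMatroid t M)
    (hn : t + 1 ≤ Fintype.card V) (S : Finset V) (hS : #S ≤ t) :
    M.natRk (starSet S) + (t + 1 - #S).choose 2 ≤ (t + 1).choose 2 := by
  induction S using Finset.induction_on with
  | empty =>
    have : starSet (∅ : Finset V) = ∅ := by
      ext e
      simp [starSet]
    simp [this, Matroid.natRk]
  | insert v S hv ih =>
    rw [card_insert_of_notMem hv] at hS ⊢
    have ih := ih (by omega)
    obtain ⟨U, hSU, hUv, hU⟩ := exists_subsuperset_card_eq (s := S) (t := univ.erase v) (n := t)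
      (by intro x hx; simp; rintro rfl; exact hv hx) (by omega)
      (by rw [card_erase_of_mem (mem_univ _), card_univ]; omega)
    have hvU : v ∉ U := fun hm => by simpa using hUv hm
    have hsub : starSet (insert v S) ⊆
        M.closure (starSet S ∪ (fun u => s(v, u)) '' ((U \ S : Finset V) : Set V)) := by
      have hUsub : (fun u => s(v, u)) '' (U : Set V) ⊆
          starSet S ∪ (fun u => s(v, u)) '' ((U \ S : Finset V) : Set V) := by
        rintro _ ⟨u, hu, rfl⟩
        by_cases huS : u ∈ S
        · refine .inl (mk_mem_starSet.2 ⟨?_, .inr huS⟩)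
          rintro rfl
          exact hv huS
        · exact .inr ⟨u, by simpa using ⟨hu, huS⟩, rfl⟩
      intro e
      induction e with | _ x y =>
      intro he
      rw [mk_mem_starSet] at he
      obtain ⟨hne, he⟩ := he
      have hg : s(x, y) ∈ M.E := by rw [h.ground_eq]; simpa using hne
      by_cases hin : x ∈ S ∨ y ∈ S
      · exact M.mem_closure_of_mem' (.inl (mk_mem_starSet.2 ⟨hne, hin⟩)) hg
      · push Not at hin
        simp only [mem_insert, hin.1, hin.2, or_false] at he
        refine M.closure_subset_closure hUsub ?_
        rcases he with rfl | rfl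
        · exact h.mem_closure hvU hU.ge hne.symm
        · rw [Sym2.eq_swap]
          exact h.mem_closure hvU hU.ge hne
    have h1 := M.natRk_mono hsub
    rw [M.natRk_closure] at h1
    have h2 := M.natRk_union_le (starSet S) ((fun u => s(v, u)) '' ((U \ S : Finset V) : Set V))
    have h3 : ((fun u => s(v, u)) '' ((U \ S : Finset V) : Set V)).ncard ≤ t - #S := by
      refine (Set.ncard_image_le (Set.toFinite _)).trans ?_
      rw [Set.ncard_coe_finset, card_sdiff_of_subset hSU, hU]
    have h4 : (t + 1 - #S).choose 2 = (t - #S) + (t + 1 - (#S + 1)).choose 2 := by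
      rw [show t + 1 - #S = (t - #S) + 1 by omega, Nat.choose_succ_succ' _ 1,
        show t + 1 - (#S + 1) = t - #S by omega, Nat.choose_one_right]
    omega

/-- Each vertex outside `S` already has `t` edges into `S`, so the closure is everything. -/
lemma natRk_starSet_eq [Fintype V] [DecidableEq V] (h : IsAbstractSymTensorMatroid t M)
    (S : Finset V) (hS : t ≤ #S) :
    M.natRk (starSet S) = (t + 1).choose 2 := by
  refine le_antisymm (h.natRk_le _) ?_
  rw [← h.natRk_ground, ← M.natRk_closure (starSet S)]
  refine M.natRk_mono fun e => ?_
  induction e with | _ x y =>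
  intro he
  have hne : x ≠ y := by rw [h.ground_eq] at he; simpa using he
  by_cases hx : x ∈ S
  · exact M.mem_closure_of_mem' (mk_mem_starSet.2 ⟨hne, .inl hx⟩) he
  · refine M.closure_subset_closure ?_ (h.mem_closure hx hS hne.symm)
    rintro _ ⟨u, hu, rfl⟩
    refine mk_mem_starSet.2 ⟨?_, .inr hu⟩
    rintro rfl
    exact hx hu

end IsAbstractSymTensorMatroid

lemma two_mul_choose_two (m : ℕ) : (2 * (m.choose 2 : ℕ) : ℤ) = m * (m - 1) := by
  induction m with
  | zero => simp
  | succ m ih =>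
    rw [Nat.choose_succ_succ' _ 1, Nat.choose_one_right]
    push_cast
    linarith

/-- The image of the edges of `F` under `ψ`. -/
def CGraph.edgeImage {V : Type u} {n t : ℕ} (F : CGraph n t) (ψ : F.Vertex → V) : Set (Sym2 V) :=
  {e | ∃ x y, F.graph.Adj x y ∧ e = s(ψ x, ψ y)}

/-- For empty `S` and `r = t` this says that the rank of `F` is at most its weight. The set `S`
collects the apexes of the cones peeled off so far, so that the cone case of the induction only
moves one vertex into `S`. -/
lemma IsAbstractSymTensorMatroid.natRk_edgeImage_le {V : Type u} [Fintype V] [DecidableEq V]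
    {t : ℕ} {M : Matroid (Sym2 V)} (h : IsAbstractSymTensorMatroid t M)
    (hn : t + 1 ≤ Fintype.card V) {n r : ℕ} (F : CGraph n r) (S : Finset V) (ψ : F.Vertex → V)
    (hψ : Function.Injective ψ) (hS : ∀ x, ψ x ∉ S) (hr : r + #S = t) :
    (M.natRk (starSet S ∪ F.edgeImage ψ) : ℤ) + ((r + 1).choose 2 : ℕ) ≤
      F.weight + ((t + 1).choose 2 : ℕ) := by
  induction F generalizing S with
  | empty n r =>
    have h0 : CGraph.edgeImage (.empty n r) ψ = ∅ := by
      ext e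
      simp only [CGraph.edgeImage, Set.mem_ofPred_eq, Set.mem_empty_iff_false, iff_false]
      rintro ⟨x, y, hxy, -⟩
      exact hxy
    have := h.natRk_starSet_le hn S (by omega)
    rw [show t + 1 - #S = r + 1 by omega] at this
    rw [h0, Set.union_empty, CGraph.weight]
    omega
  | complete n hn3 =>
    have := h.natRk_le (starSet S ∪ CGraph.edgeImage (.complete n hn3) ψ)
    simp only [CGraph.weight]
    norm_num
    omega
  | @cone n r hr2 hn2 G ih =>
    let ψ' : G.Vertex → V := fun x => ψ (.inl x)
    let v : V := ψ (.inr (0 : Fin 1))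
    have hvS : v ∉ S := hS _
    have := ih (insert v S) ψ' (fun x y hxy => Sum.inl_injective (hψ hxy)) (by
      intro x hx
      rcases mem_insert.1 hx with hx | hx
      · cases hψ hx
      · exact hS _ hx) (by rw [card_insert_of_notMem hvS]; omega)
    have hsub : starSet S ∪ CGraph.edgeImage (.cone hr2 hn2 G) ψ ⊆
        starSet (insert v S) ∪ G.edgeImage ψ' := by
      rintro e (⟨he, x, hx, hxe⟩ | ⟨x, y, hxy, rfl⟩)
      · exact .inl ⟨he, x, mem_insert_of_mem hx, hxe⟩
      · change (graphJoin G.graph (⊤ : SimpleGraph (Fin 1))).Adj x y at hxy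
        have hne : ψ x ≠ ψ y := fun h => hxy.ne (hψ h)
        rcases x with x | x
        · rcases y with y | y
          · refine .inr ⟨x, y, ?_, rfl⟩
            simpa [graphJoin, completeBipartiteGraph] using hxy
          · rw [Subsingleton.elim y (0 : Fin 1)] at hne ⊢
            exact .inl (mk_mem_starSet.2 ⟨hne, .inr (mem_insert_self _ _)⟩)
        · rw [Subsingleton.elim x (0 : Fin 1)] at hne ⊢
          exact .inl (mk_mem_starSet.2 ⟨hne, .inl (mem_insert_self _ _)⟩)
    have h1 := M.natRk_mono hsub
    simp only [CGraph.weight]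
    have h2 : (r + 1 + 1).choose 2 = (r + 1) + (r + 1).choose 2 := by
      rw [Nat.choose_succ_succ' _ 1, Nat.choose_one_right]
    rw [h2]
    push_cast
    omega
  | bipartite n r a b ha har hb hbr hab habn =>
    have hψ' : Function.Injective fun x : Fin a ⊕ Fin b => ψ (.inl x) :=
      fun x y hxy => Sum.inl_injective (hψ hxy)
    set A : Finset V := univ.image fun i : Fin a => ψ (.inl (.inl i)) with hA
    set B : Finset V := univ.image fun i : Fin b => ψ (.inl (.inr i)) with hB
    have cA : #A = a := by
      rw [hA, card_image_of_injective _ (fun x y hxy => Sum.inl_injective (hψ' hxy))]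
      simp
    have cB : #B = b := by
      rw [hB, card_image_of_injective _ (fun x y hxy => Sum.inr_injective (hψ' hxy))]
      simp
    have dAB : Disjoint A B := by
      rw [disjoint_left]
      intro x hx hx'
      obtain ⟨i, -, rfl⟩ := mem_image.1 hx
      obtain ⟨j, -, hj⟩ := mem_image.1 hx'
      cases hψ' hj
    have dAS : Disjoint S A := by
      rw [disjoint_right]
      intro x hx
      obtain ⟨i, -, rfl⟩ := mem_image.1 hx
      exact hS _
    have dBS : Disjoint S B := by
      rw [disjoint_right]
      intro x hx
      obtain ⟨i, -, rfl⟩ := mem_image.1 hx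
      exact hS _
    -- Submodularity is applied to the edges meeting `S ∪ A` and those meeting `S ∪ B`; since `a + b
    -- ≥ r`, their union has full rank.
    have hsub : starSet S ∪ CGraph.edgeImage (.bipartite n r a b ha har hb hbr hab habn) ψ ⊆
        starSet (S ∪ A) ∩ starSet (S ∪ B) := by
      rintro e (⟨he, x, hx, hxe⟩ | ⟨x, y, hxy, rfl⟩)
      · exact ⟨⟨he, x, mem_union_left _ hx, hxe⟩, ⟨he, x, mem_union_left _ hx, hxe⟩⟩
      · change (completeBipartiteGraph (Fin a) (Fin b) ⊕g
          (⊥ : SimpleGraph (Fin (n - a - b)))).Adj x y at hxy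
        have hne : ψ x ≠ ψ y := fun h => hxy.ne (hψ h)
        have memA : ∀ i : Fin a, ψ (.inl (.inl i)) ∈ A := fun i =>
          mem_image_of_mem _ (mem_univ _)
        have memB : ∀ i : Fin b, ψ (.inl (.inr i)) ∈ B := fun i =>
          mem_image_of_mem (fun i : Fin b => ψ (.inl (.inr i))) (mem_univ _)
        rcases x with (x | x) | x <;> rcases y with (y | y) | y <;>
          simp [completeBipartiteGraph] at hxy
        · exact ⟨mk_mem_starSet.2 ⟨hne, .inl (mem_union_right _ (memA x))⟩,
            mk_mem_starSet.2 ⟨hne, .inr (mem_union_right _ (memB y))⟩⟩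
        · exact ⟨mk_mem_starSet.2 ⟨hne, .inr (mem_union_right _ (memA y))⟩,
            mk_mem_starSet.2 ⟨hne, .inl (mem_union_right _ (memB x))⟩⟩
    have hsub' : starSet ((S ∪ A) ∪ B) ⊆ starSet (S ∪ A) ∪ starSet (S ∪ B) := by
      rintro e ⟨he, x, hx, hxe⟩
      rcases mem_union.1 hx with hx | hx
      · exact .inl ⟨he, x, hx, hxe⟩
      · exact .inr ⟨he, x, mem_union_right _ hx, hxe⟩
    have h1 := M.natRk_mono hsub
    have h2 := M.natRk_mono hsub'
    rw [h.natRk_starSet_eq _ (by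
      rw [card_union_of_disjoint (disjoint_union_left.2 ⟨dBS, dAB⟩), card_union_of_disjoint dAS]
      omega)] at h2
    have h3 := M.natRk_inter_add_natRk_union_le (starSet (S ∪ A)) (starSet (S ∪ B))
    have cSA : #(S ∪ A) = #S + a := by rw [card_union_of_disjoint dAS, cA]
    have cSB : #(S ∪ B) = #S + b := by rw [card_union_of_disjoint dBS, cB]
    have h4 := h.natRk_starSet_le hn (S ∪ A) (by omega)
    have h5 := h.natRk_starSet_le hn (S ∪ B) (by omega)
    rw [cSA, show t + 1 - (#S + a) = r + 1 - a by omega] at h4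
    rw [cSB, show t + 1 - (#S + b) = r + 1 - b by omega] at h5
    simp only [CGraph.weight]
    have key : ((r + 1).choose 2 : ℤ) =
        a * b - ((a + b - r).choose 2 : ℕ) + ((r + 1 - a).choose 2 : ℕ)
          + ((r + 1 - b).choose 2 : ℕ) := by
      have e1 := two_mul_choose_two (r + 1)
      have e2 := two_mul_choose_two (a + b - r)
      have e3 := two_mul_choose_two (r + 1 - a)
      have e4 := two_mul_choose_two (r + 1 - b)
      rw [Nat.cast_sub (by omega)] at e2 e3 e4
      push_cast at *
      nlinarith
    omega

lemma CGraph.finite_and_card : ∀ {n t : ℕ} (F : CGraph n t), Finite F.Vertex ∧ Nat.card F.Vertex = n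
  | _, _, .empty n _ => ⟨inferInstanceAs (Finite (Fin n)), Nat.card_fin n⟩
  | _, _, .complete n _ => ⟨inferInstanceAs (Finite (Fin n)), Nat.card_fin n⟩
  | _, _, .cone _ _ G => by
    obtain ⟨h1, h2⟩ := G.finite_and_card
    exact ⟨inferInstanceAs (Finite (G.Vertex ⊕ Fin 1)), by
      change Nat.card (G.Vertex ⊕ Fin 1) = _
      rw [Nat.card_sum, h2, Nat.card_fin]⟩
  | _, _, .bipartite n _ a b _ _ _ _ _ h =>
    ⟨inferInstanceAs (Finite ((Fin a ⊕ Fin b) ⊕ Fin (n - a - b))), by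
      change Nat.card ((Fin a ⊕ Fin b) ⊕ Fin (n - a - b)) = _
      simp only [Nat.card_sum, Nat.card_fin]
      omega⟩

lemma CGraph.eq_empty_of_le {n t : ℕ} (F : CGraph n t) (h : n ≤ t + 1) : F = .empty n t := by
  cases F with
  | empty => rfl
  | complete => omega
  | cone => omega
  | bipartite => omega

lemma cIndependent_of_card_le {V : Type u} [Fintype V] {t : ℕ} (G : SimpleGraph V)
    (h : Fintype.card V ≤ t + 1) : CIndependent t G := by
  rintro H F ⟨f⟩
  obtain rfl := F.eq_empty_of_le h
  have : H.edgeSet = ∅ := by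
    ext e
    induction e with | _ x y =>
    simp only [SimpleGraph.Subgraph.mem_edgeSet, Set.mem_empty_iff_false, iff_false]
    intro hxy
    have hxy' : H.coe.Adj ⟨x, hxy.fst_mem⟩ ⟨y, hxy.snd_mem⟩ := hxy
    exact f.toHom.map_adj hxy'
  rw [this]
  simp [CGraph.weight]

open Classical in
/-- A graph that is independent in some abstract symmetric `t`-tensor matroid is
`𝒞_t`-independent. -/
theorem IsAbstractSymTensorMatroid.cIndependent {V : Type u} [Fintype V] {t : ℕ}
    {M : Matroid (Sym2 V)} (h : IsAbstractSymTensorMatroid t M) (hn : t + 1 ≤ Fintype.card V)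
    {G : SimpleGraph V} (hG : M.Indep G.edgeSet) : CIndependent t G := by
  rintro H F ⟨f⟩
  obtain ⟨hfin, hcard⟩ := F.finite_and_card
  have := Fintype.ofFinite F.Vertex
  rw [Nat.card_eq_fintype_card] at hcard
  let e₀ : V ≃ F.Vertex := Fintype.equivOfCardEq hcard.symm
  let g : V → F.Vertex := fun v => if hv : v ∈ H.verts then f ⟨v, hv⟩ else e₀ v
  have hg : ∀ v (hv : v ∈ H.verts), g v = f ⟨v, hv⟩ := fun v hv => by simp [g, hv]
  -- The embedding of `H` in `F` is extended to a bijection of all vertices, so that the inverse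
  -- places the whole of `F` on `V`.
  obtain ⟨e, he⟩ := exists_equiv_extend_of_card_eq (t := (univ : Finset F.Vertex))
    (s := H.verts.toFinset) (f := g) (by rw [card_univ, hcard]) (subset_univ _) (by
      intro x hx y hy hxy
      simp only [Set.coe_toFinset] at hx hy
      rw [hg x hx, hg y hy] at hxy
      simpa using f.injective hxy)
  have hle := h.natRk_edgeImage_le hn F ∅ (fun x => e.symm ⟨x, mem_univ x⟩)
    (fun x y hxy => by simpa using hxy) (by simp) (by simp)
  have hH : M.Indep H.edgeSet := hG.subset H.edgeSet_subset
  have hsub : H.edgeSet ⊆ starSet ∅ ∪ F.edgeImage fun x => e.symm ⟨x, mem_univ x⟩ := by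
    intro a
    induction a with | _ x y =>
    intro hxy
    rw [SimpleGraph.Subgraph.mem_edgeSet] at hxy
    have hx := hxy.fst_mem
    have hy := hxy.snd_mem
    have hxy' : H.coe.Adj ⟨x, hx⟩ ⟨y, hy⟩ := hxy
    have back : ∀ v (hv : v ∈ H.verts), e.symm ⟨f ⟨v, hv⟩, mem_univ _⟩ = v := fun v hv => by
      rw [Equiv.symm_apply_eq]
      exact Subtype.ext (by rw [he v (by simpa using hv), hg v hv])
    refine .inr ⟨f ⟨x, hx⟩, f ⟨y, hy⟩, f.toHom.map_adj hxy', ?_⟩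
    simp only [back x hx, back y hy]
  have := hH.ncard_le_natRk hsub
  omega

/-! ### The generic symmetric tensor matroid is an abstract one -/

open Classical in
lemma indep_symTensorMatroid_of_card_le {V : Type u} [Fintype V] {t : ℕ} {p : V → Fin t → ℝ}
    (hp : IsGeneric p) {X : Set (Sym2 V)} (hX : X ⊆ completeEdges V) {U : Finset V}
    (hU : #U ≤ t + 1) (hXU : ∀ x y, s(x, y) ∈ X → x ∈ U) : (symTensorMatroid p).Indep X := by
  let ι : V ↪ ℕ := (Fintype.equivFin V).toEmbedding.trans Fin.valEmbedding
  have hι := Sym2.map.injective ι.injective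
  have := indep_of_tIndep (X := X.toFinset) (ι := ι) hp (by simpa using hX)
    (tIndep_of_card_le (W := U.map ι) ?_ ?_ (by rwa [card_map]))
  · rwa [Set.coe_toFinset] at this
  · intro v hv
    obtain ⟨e, he, h⟩ := mem_image.1 hv
    induction e with | _ x y =>
    have hne : x ≠ y := SimpleGraph.top_adj _ _ |>.1 (SimpleGraph.mem_edgeSet _ |>.1
      (hX (Set.mem_toFinset.1 he)))
    rcases Sym2.eq_iff.1 h with ⟨h1, h2⟩ | ⟨h1, h2⟩ <;> exact hne (ι.injective (h1.trans h2.symm))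
  · intro x y hxy
    obtain ⟨e, he, h⟩ := mem_image.1 hxy
    induction e with | _ a b =>
    have he : s(a, b) ∈ X := by simpa using he
    rcases Sym2.eq_iff.1 h with ⟨rfl, -⟩ | ⟨-, rfl⟩
    · exact mem_map_of_mem _ (hXU a b he)
    · exact mem_map_of_mem _ (hXU b a (by rw [Sym2.eq_swap]; exact he))

/-- The edge vectors span at most the symmetric matrices. -/
lemma ncard_le_of_linearIndepOn_edgeMat {V : Type u} {t : ℕ} {p : V → Fin t → ℝ}
    {X : Set (Sym2 V)} (hX : X.Finite) (h : LinearIndepOn ℝ (edgeMat p) X) :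
    X.ncard ≤ (t + 1).choose 2 := by
  have := hX.fintype
  let L : (Sym2 (Fin t) → ℝ) →ₗ[ℝ] (Fin t × Fin t → ℝ) :=
    LinearMap.funLeft ℝ ℝ fun x : Fin t × Fin t => s(x.1, x.2)
  have hL : ∀ e, ∃ g, L g = edgeMat p e := by
    intro e
    induction e with | _ i j =>
    refine ⟨Sym2.lift ⟨fun a b => p i a * p j b + p j a * p i b, fun a b => by ring⟩, ?_⟩
    ext x
    rfl
  choose g hg using hL
  have h' : LinearIndependent ℝ (fun e : X => g e) := by
    refine LinearIndependent.of_comp L ?_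
    have : (L ∘ fun e : X => g e) = fun e : X => edgeMat p e := by
      ext e : 1
      exact hg e
    rw [this]
    exact h
  have := h'.fintype_card_le_finrank
  rwa [Module.finrank_fintype_fun_eq_card, Sym2.card, Fintype.card_fin,
    ← Set.toFinset_card, ← Set.ncard_eq_toFinset_card'] at this

/-- The edge vectors of a star at `v` are images of points of `ℝᵗ` under one linear map, so more
than `t` of them are dependent. -/
lemma not_linearIndepOn_edgeMat_star {V : Type u} {t : ℕ} (p : V → Fin t → ℝ) (v : V)
    {U : Finset V} (hU : t < #U) :
    ¬ LinearIndepOn ℝ (edgeMat p) ((fun u => s(v, u)) '' (U : Set V)) := by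
  intro h
  let L : (Fin t → ℝ) →ₗ[ℝ] (Fin t × Fin t → ℝ) :=
    { toFun := fun x ab => p v ab.1 * x ab.2 + x ab.1 * p v ab.2
      map_add' := fun x y => by ext; simp; ring
      map_smul' := fun c x => by ext; simp; ring }
  have h1 := h.comp (fun u : (U : Set V) => (⟨s(v, u.1), Set.mem_image_of_mem _ u.2⟩ :
    ((fun u => s(v, u)) '' (U : Set V) : Set (Sym2 V)))) (by
      intro a b hab
      exact Subtype.ext (Sym2.congr_right.1 (congrArg Subtype.val hab)))
  have h2 : LinearIndependent ℝ fun u : (U : Set V) => p u := by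
    refine LinearIndependent.of_comp L ?_
    exact h1
  have := h2.fintype_card_le_finrank
  rw [Module.finrank_fintype_fun_eq_card, Fintype.card_fin] at this
  simp only [SetLike.coe_sort_coe, Fintype.card_coe] at this
  omega

theorem isAbstractSymTensorMatroid_symTensorMatroid {V : Type u} [Fintype V] {t : ℕ}
    (hn : t + 1 ≤ Fintype.card V) {p : V → Fin t → ℝ} (hp : IsGeneric p) :
    IsAbstractSymTensorMatroid t (symTensorMatroid p) where
  ground_eq := rfl
  rank_eq := by
    classical
    apply le_antisymm
    · obtain ⟨B, hB⟩ := (symTensorMatroid p).exists_isBase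
      rw [← hB.encard_eq_eRank, ← (Set.toFinite B).cast_ncard_eq, Nat.cast_le]
      exact ncard_le_of_linearIndepOn_edgeMat (Set.toFinite B)
        ((linearIndepOn_symTensor_iff p B).1 hB.indep.2)
    · obtain ⟨U, -, hU⟩ := exists_subset_card_eq (s := (univ : Finset V)) (n := t + 1)
        (by simpa using hn)
      have hmem : ∀ x y, s(x, y) ∈ U.offDiag.image Sym2.mk.uncurry → x ∈ U ∧ x ≠ y := by
        intro x y hxy
        obtain ⟨z, hz, h⟩ := mem_image.1 hxy
        rw [mem_offDiag] at hz
        rcases Sym2.eq_iff.1 h with ⟨rfl, rfl⟩ | ⟨rfl, rfl⟩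
        · exact ⟨hz.1, hz.2.2⟩
        · exact ⟨hz.2.1, hz.2.2.symm⟩
      have hI : (symTensorMatroid p).Indep (U.offDiag.image Sym2.mk.uncurry : Finset (Sym2 V)) := by
        refine indep_symTensorMatroid_of_card_le hp ?_ hU.le fun x y hxy => (hmem x y hxy).1
        intro e
        induction e with | _ x y =>
        intro he
        simpa using (hmem x y he).2
      have := hI.encard_le_eRank
      rwa [Set.encard_coe_eq_coe_finsetCard, Sym2.card_image_offDiag, hU] at this
  isCircuit_star := by
    classical
    intro v U hv hU
    have hE : (fun u => s(v, u)) '' (U : Set V) ⊆ (symTensorMatroid p).E := by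
      rintro _ ⟨u, hu, rfl⟩
      change s(v, u) ∈ completeEdges V
      simp only [SimpleGraph.mem_edgeSet, SimpleGraph.top_adj]
      rintro rfl
      exact hv hu
    rw [Matroid.isCircuit_iff_dep_forall_sdiff_singleton_indep]
    refine ⟨(Matroid.not_indep_iff hE).1 fun h => not_linearIndepOn_edgeMat_star p v
      (by omega : t < #U) ((linearIndepOn_symTensor_iff p _).1 h.2), ?_⟩
    rintro _ ⟨u, hu, rfl⟩
    refine indep_symTensorMatroid_of_card_le hp (Set.sdiff_subset.trans hE)
      (U := insert v (U.erase u)) ?_ ?_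
    · rw [card_insert_of_notMem (by simp [hv]), card_erase_of_mem hu]
      omega
    · rintro x y ⟨⟨w, hw, h⟩, hne⟩
      rw [← h] at hne
      rcases Sym2.eq_iff.1 h with ⟨rfl, rfl⟩ | ⟨rfl, rfl⟩
      · simp
      · refine mem_insert_of_mem (mem_erase.2 ⟨?_, hw⟩)
        rintro rfl
        exact hne rfl

/-! ### Duality between rigidity and symmetric tensors -/

lemma linearMatroid_spanning_iff {α : Type u} {W : Type v} [AddCommGroup W] [Module ℝ W]
    {E : Set α} {hE : E.Finite} {f : α → W} {Y : Set α} (hY : Y ⊆ E) :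
    (linearMatroid E hE f).Spanning Y ↔ ∀ e ∈ E, f e ∈ Submodule.span ℝ (f '' Y) := by
  set M := linearMatroid E hE f
  rw [Matroid.spanning_iff_exists_isBase_subset (show Y ⊆ M.E from hY)]
  constructor
  · rintro ⟨B, hB, hBY⟩ e he
    by_contra hne
    have hne' : f e ∉ Submodule.span ℝ (f '' B) := fun h =>
      hne (Submodule.span_mono (Set.image_mono hBY) h)
    have heB : e ∉ B := fun h => hne' (Submodule.subset_span ⟨e, h, rfl⟩)
    have hins : M.Indep (insert e B) :=
      ⟨Set.insert_subset he hB.subset_ground, hB.indep.2.insert hne'⟩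
    exact heB (hB.mem_of_insert_indep hins)
  · intro h
    obtain ⟨I, hI⟩ := M.exists_isBasis Y hY
    refine ⟨I, hI.indep.isBase_of_forall_insert ?_, hI.subset⟩
    rintro e ⟨he, heI⟩ hins
    have hspan : f '' Y ⊆ (Submodule.span ℝ (f '' I) : Set W) := by
      rintro _ ⟨y, hy, rfl⟩
      by_contra hne
      have hins : M.Indep (insert y I) :=
        ⟨Set.insert_subset (hY hy) hI.indep.subset_ground, hI.indep.2.insert hne⟩
      exact hne (Submodule.subset_span ⟨y, hI.mem_of_insert_indep hy hins, rfl⟩)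
    have := hins.2.notMem_span (Set.mem_insert e I)
    rw [Set.insert_sdiff_self_of_notMem heI] at this
    exact this (Submodule.span_le.2 hspan (h e he))

/-- If the linear relations between the vectors `f e` are the evaluations of linear functionals at
the vectors `g e`, then a set spans for `f` exactly if its complement is independent for `g`. -/
lemma forall_mem_span_iff_linearIndepOn {α W U : Type*} [Fintype α] [AddCommGroup W] [Module ℝ W]
    [AddCommGroup U] [Module ℝ U] {E X Y : Set α} {f : α → W} {g : α → U}
    (hf : ∀ e ∉ E, f e = 0)
    (hfg : ∀ ω : α → ℝ, ∑ e, ω e • f e = 0 ↔ ∃ φ : Module.Dual ℝ U, ∀ e ∈ E, ω e = φ (g e))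
    (hXY : X ∪ Y = E) (hd : Disjoint X Y) :
    (∀ e ∈ E, f e ∈ Submodule.span ℝ (f '' Y)) ↔ LinearIndepOn ℝ g X := by
  classical
  have hXE : X ⊆ E := hXY ▸ Set.subset_union_left
  have hYE : Y ⊆ E := hXY ▸ Set.subset_union_right
  constructor
  · intro h
    rw [linearIndepOn_iff_notMem_span]
    intro e he hmem
    have h1 := h e (hXE he)
    rw [← Set.coe_toFinset Y, Submodule.mem_span_image_finset_iff_exists_fun] at h1
    obtain ⟨c, hc⟩ := h1
    -- Writing `f e` in terms of `Y` is a relation with coefficient 1 at `e` and 0 on the rest of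
    -- `X`. The functional behind it separates `g e` from the other `g a`.
    obtain ⟨φ, hφ⟩ := (hfg fun a => (if a = e then 1 else 0) -
        if ha : a ∈ Y.toFinset then c ⟨a, ha⟩ else 0).1 (by
      simp only [sub_smul, sum_sub_distrib, ite_smul, one_smul, zero_smul, sum_ite_eq', mem_univ,
        if_true]
      rw [← hc, sub_eq_zero, ← sum_subset (subset_univ Y.toFinset) fun x _ hx => by simp [hx],
        ← sum_coe_sort Y.toFinset]
      exact sum_congr rfl fun x _ => by rw [dif_pos x.2])
    have h0 : ∀ x ∈ Submodule.span ℝ (g '' (X \ {e})), φ x = 0 := by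
      intro x hx
      induction hx using Submodule.span_induction with
      | mem x hx =>
        obtain ⟨a, ⟨haX, hae⟩, rfl⟩ := hx
        have haY : a ∉ Y := Set.disjoint_left.1 hd haX
        rw [← hφ a (hXE haX)]
        simp [haY, show a ≠ e from hae]
      | zero => exact map_zero φ
      | add x y _ _ hx hy => rw [map_add, hx, hy, add_zero]
      | smul r x _ hx => rw [map_smul, hx, smul_zero]
    have h2 := h0 _ hmem
    have heY : e ∉ Y := Set.disjoint_left.1 hd he
    rw [← hφ e (hXE he)] at h2
    simp [heY] at h2
  · intro h e he
    by_cases heY : e ∈ Y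
    · exact Submodule.subset_span ⟨e, heY, rfl⟩
    have heX : e ∈ X := by
      rw [← hXY] at he
      exact he.resolve_right heY
    -- Conversely, a functional that vanishes on `X` except at `e` is a relation expressing `f e`
    -- through `Y`.
    obtain ⟨φ, hφe, hφ⟩ := Submodule.exists_le_ker_of_notMem (h.notMem_span heX)
    have hrel := (hfg fun a => φ (g a)).2 ⟨φ, fun _ _ => rfl⟩
    rw [← add_sum_erase _ _ (mem_univ e)] at hrel
    have hsum : ∑ a ∈ univ.erase e, φ (g a) • f a ∈ Submodule.span ℝ (f '' Y) := by
      refine Submodule.sum_mem _ fun a ha => ?_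
      by_cases haE : a ∈ E
      · rw [← hXY] at haE
        rcases haE with haX | haY
        · have : φ (g a) = 0 :=
            hφ (Submodule.subset_span ⟨a, ⟨haX, (mem_erase.1 ha).1⟩, rfl⟩)
          rw [this, zero_smul]
          exact Submodule.zero_mem _
        · exact Submodule.smul_mem _ _ (Submodule.subset_span ⟨a, haY, rfl⟩)
      · rw [hf a haE, smul_zero]
        exact Submodule.zero_mem _
    have : f e = -(φ (g e))⁻¹ • ∑ a ∈ univ.erase e, φ (g a) • f a := by
      rw [← eq_neg_iff_add_eq_zero] at hrel
      rw [neg_smul, ← smul_neg, ← hrel, smul_smul, inv_mul_cancel₀ hφe, one_smul]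
    rw [this]
    exact Submodule.smul_mem _ _ hsum

lemma rigidityRow_apply {V : Type u} [Fintype V] [DecidableEq V] {d : ℕ} (q : V → Fin d → ℝ)
    (e : Sym2 V) (i : V) :
    rigidityRow q e i = ∑ j, if e = s(i, j) then q i - q j else 0 := by
  induction e with | _ a b =>
  have hrow : rigidityRow q s(a, b) i =
      (if i = a then q a - q b else 0) + if i = b then q b - q a else 0 := by
    simp only [rigidityRow, Sym2.lift_mk, Pi.add_apply, Pi.single_apply]
    congr
  have hsum : ∀ j, (if s(a, b) = s(i, j) then q i - q j else 0) =
      (if i = a then if j = b then q a - q b else 0 else 0) +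
        if i = b then if j = a then q b - q a else 0 else 0 := by
    intro j
    by_cases hia : i = a <;> by_cases hib : i = b <;> by_cases hja : j = a <;>
      by_cases hjb : j = b <;> simp_all <;> grind
  rw [hrow, sum_congr rfl fun j _ => hsum j, sum_add_distrib]
  split_ifs <;> simp

lemma sum_smul_rigidityRow_eq_zero_iff {V : Type u} [Fintype V] {d : ℕ}
    (q : V → Fin d → ℝ) (ω : Sym2 V → ℝ) :
    ∑ e, ω e • rigidityRow q e = 0 ↔ ∀ i, ∑ j, ω s(i, j) • (q i - q j) = 0 := by
  classical
  have key : ∀ i, (∑ e, ω e • rigidityRow q e) i = ∑ j, ω s(i, j) • (q i - q j) := by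
    intro i
    simp only [Finset.sum_apply, Pi.smul_apply, rigidityRow_apply, smul_sum]
    rw [sum_comm]
    refine sum_congr rfl fun j _ => ?_
    simp
  constructor
  · intro h i
    rw [← key, h]
    rfl
  · intro h
    ext1 i
    rw [key, h]
    rfl

/-! ### Gale duality: stresses as symmetric forms. -/

lemma dotProduct_edgeMat {V : Type u} {t : ℕ} {p : V → Fin t → ℝ} (S : Fin t × Fin t → ℝ)
    (i j : V) :
    S ⬝ᵥ edgeMat p s(i, j) = (fun b => ∑ a, (S (a, b) + S (b, a)) * p i a) ⬝ᵥ p j := by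
  simp only [dotProduct, edgeMat_mk, Fintype.sum_prod_type, mul_add, sum_add_distrib, sum_mul,
    add_mul]
  congr 1
  · rw [sum_comm]
    simp only [mul_assoc]
  · refine sum_congr rfl fun a _ => sum_congr rfl fun b _ => ?_
    ring

/-- `p` is a Gale dual of the affine point configuration `q`: its coordinate functions form a basis
of the space of affine dependencies of `q`. -/
structure IsGaleDual {V : Type u} [Fintype V] {d t : ℕ} (q : V → Fin d → ℝ)
    (p : V → Fin t → ℝ) : Prop where
  exists_iff : ∀ y : V → ℝ, (∑ j, y j • q j = 0 ∧ ∑ j, y j = 0) ↔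
    ∃ s : Fin t → ℝ, ∀ j, y j = s ⬝ᵥ p j
  eq_zero : ∀ s : Fin t → ℝ, (∀ j, s ⬝ᵥ p j = 0) → s = 0

namespace IsGaleDual

variable {V : Type u} [Fintype V] {d t : ℕ} {q : V → Fin d → ℝ} {p : V → Fin t → ℝ}

/-- For fixed `i` the weights are a linear functional of `p j`, hence an affine dependency of `q`.
-/
lemma stress (h : IsGaleDual q p) (S : Fin t × Fin t → ℝ) (i : V) :
    ∑ j, (S ⬝ᵥ edgeMat p s(i, j)) • (q i - q j) = 0 := by
  obtain ⟨h1, h2⟩ := (h.exists_iff fun j => S ⬝ᵥ edgeMat p s(i, j)).2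
    ⟨_, fun j => dotProduct_edgeMat S i j⟩
  simp only [smul_sub, sum_sub_distrib, h1, ← sum_smul, h2, zero_smul, sub_zero]

/-- The diagonal is filled in so that rows of `Ω` sum to zero; equilibrium makes them affine
dependencies, so `Ω i j = s i ⬝ᵥ p j`. By symmetry of `Ω` the components of `s` are affine
dependencies as well, so `Ω` is a bilinear form in `p i` and `p j`. -/
lemma exists_form (h : IsGaleDual q p) {ω : Sym2 V → ℝ}
    (hω : ∀ i, ∑ j, ω s(i, j) • (q i - q j) = 0) :
    ∃ S : Fin t × Fin t → ℝ, (∀ a b, S (a, b) = S (b, a)) ∧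
      ∀ i j, i ≠ j → ω s(i, j) = S ⬝ᵥ edgeMat p s(i, j) := by
  classical
  let Ω : V → V → ℝ := fun i j => ω s(i, j) - if i = j then ∑ k, ω s(i, k) else 0
  have hsymm : ∀ i j, Ω i j = Ω j i := by
    intro i j
    by_cases hij : i = j
    · rw [hij]
    · simp only [Ω, if_neg hij, if_neg (Ne.symm hij), Sym2.eq_swap]
  have hrow : ∀ i, ∑ j, Ω i j • q j = 0 ∧ ∑ j, Ω i j = 0 := by
    intro i
    have := hω i
    simp only [smul_sub, sum_sub_distrib, ← sum_smul] at this
    constructor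
    · simp only [Ω, sub_smul, sum_sub_distrib, ite_smul, zero_smul, sum_ite_eq, mem_univ, if_true]
      rw [← neg_sub, this, neg_zero]
    · simp [Ω, sum_sub_distrib]
  choose s hs using fun i => (h.exists_iff (Ω i)).1 (hrow i)
  have hcol : ∀ a, ∑ i, s i a • q i = 0 ∧ ∑ i, s i a = 0 := by
    have hq : ∀ k, (fun a => ∑ i, s i a * q i k) = 0 := by
      intro k
      refine h.eq_zero _ fun j => ?_
      have h1 := congrFun (hrow j).1 k
      simp only [Finset.sum_apply, Pi.smul_apply, smul_eq_mul, Pi.zero_apply] at h1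
      rw [← h1]
      simp only [fun i => hsymm j i, hs, dotProduct, sum_mul]
      rw [sum_comm]
      exact sum_congr rfl fun i _ => sum_congr rfl fun a _ => by ring
    have h1 : (fun a => ∑ i, s i a) = 0 := by
      refine h.eq_zero _ fun j => ?_
      rw [← (hrow j).2]
      simp only [fun i => hsymm j i, hs, dotProduct, sum_mul]
      rw [sum_comm]
    intro a
    refine ⟨?_, congrFun h1 a⟩
    ext k
    simpa using congrFun (hq k) a
  choose S hS using fun a => (h.exists_iff fun i => s i a).1 (hcol a)
  have hΩ : ∀ i j, Ω i j = ∑ a, ∑ b, S b a * p i a * p j b := by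
    intro i j
    rw [hs i j]
    simp only [dotProduct, hS, sum_mul]
    rw [sum_comm]
  have hΩ' : ∀ i j, Ω i j = ∑ a, ∑ b, S a b * p j a * p i b := by
    intro i j
    rw [hΩ i j, sum_comm]
    exact sum_congr rfl fun a _ => sum_congr rfl fun b _ => by ring
  -- One factor 2 comes from symmetrising, the other from the two terms of `edgeMat`.
  refine ⟨fun x => (S x.1 x.2 + S x.2 x.1) / 4, fun a b => by ring, fun i j hij => ?_⟩
  have h1 : ω s(i, j) = Ω i j := by simp [Ω, hij]
  have h2 : Ω i j = (Ω i j + Ω i j + (Ω j i + Ω j i)) / 4 := by rw [hsymm j i]; ring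
  rw [h1, h2]
  nth_rewrite 1 [hΩ i j]
  nth_rewrite 1 [hΩ' i j]
  nth_rewrite 1 [hΩ j i]
  nth_rewrite 1 [hΩ' j i]
  simp only [dotProduct, edgeMat_mk, Fintype.sum_prod_type, ← sum_add_distrib, sum_div]
  exact sum_congr rfl fun a _ => sum_congr rfl fun b _ => by ring

/-- Diagonal values vanish too, because each row sums to zero; then the form is zero on a spanning
family. -/
lemma eq_zero_of_forall_edge (h : IsGaleDual q p) {S : Fin t × Fin t → ℝ}
    (hS : ∀ a b, S (a, b) = S (b, a)) (h0 : ∀ i j, i ≠ j → S ⬝ᵥ edgeMat p s(i, j) = 0) :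
    S = 0 := by
  have hall : ∀ i j, S ⬝ᵥ edgeMat p s(i, j) = 0 := by
    classical
    intro i j
    by_cases hij : i = j
    · subst hij
      have := ((h.exists_iff fun j => S ⬝ᵥ edgeMat p s(i, j)).2
        ⟨_, fun j => dotProduct_edgeMat S i j⟩).2
      rwa [sum_eq_single i (fun j _ hj => h0 i j (Ne.symm hj)) (by simp)] at this
    · exact h0 i j hij
  have h1 : ∀ b, (fun a => S (a, b) + S (b, a)) = 0 := by
    intro b
    refine h.eq_zero _ fun i => ?_
    exact congrFun (h.eq_zero _ fun j => (dotProduct_edgeMat S i j).symm.trans (hall i j)) b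
  ext ⟨a, b⟩
  have := congrFun (h1 b) a
  simp only [Pi.zero_apply] at this ⊢
  have := hS a b
  linarith

end IsGaleDual

lemma rigidityRow_eq_zero {V : Type u} {d : ℕ} (q : V → Fin d → ℝ) {e : Sym2 V}
    (he : e ∉ completeEdges V) : rigidityRow q e = 0 := by
  induction e with | _ a b =>
  have : a = b := by
    by_contra h
    exact he (by simpa using h)
  simp [rigidityRow, this]

lemma IsGaleDual.sum_smul_rigidityRow_eq_zero_iff {V : Type u} [Fintype V] {d t : ℕ}
    {q : V → Fin d → ℝ} {p : V → Fin t → ℝ} (h : IsGaleDual q p) (ω : Sym2 V → ℝ) :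
    ∑ e, ω e • rigidityRow q e = 0 ↔ ∃ S : Fin t × Fin t → ℝ, (∀ a b, S (a, b) = S (b, a)) ∧
      ∀ e ∈ completeEdges V, ω e = S ⬝ᵥ edgeMat p e := by
  rw [_root_.sum_smul_rigidityRow_eq_zero_iff]
  constructor
  · intro hω
    obtain ⟨S, hS, h1⟩ := h.exists_form hω
    refine ⟨S, hS, fun e => ?_⟩
    induction e with | _ i j => exact fun he => h1 i j (by simpa using he)
  · rintro ⟨S, -, hS⟩ i
    rw [← h.stress S i]
    refine sum_congr rfl fun j _ => ?_
    by_cases hij : i = j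
    · simp [hij]
    · rw [hS s(i, j) (by simpa using hij)]

lemma IsGaleDual.spanning_iff {V : Type u} [Fintype V] {d t : ℕ} {q : V → Fin d → ℝ}
    {p : V → Fin t → ℝ} (h : IsGaleDual q p) (G : SimpleGraph V) :
    (rigidityMatroid q).Spanning G.edgeSet ↔ LinearIndepOn ℝ (edgeMat p) Gᶜ.edgeSet := by
  classical
  rw [rigidityMatroid, linearMatroid_spanning_iff (SimpleGraph.edgeSet_mono le_top)]
  refine forall_mem_span_iff_linearIndepOn (fun e he => rigidityRow_eq_zero q he) ?_ ?_ ?_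
  · intro ω
    rw [h.sum_smul_rigidityRow_eq_zero_iff]
    constructor
    · rintro ⟨S, -, hS⟩
      exact ⟨dotProductBilin ℝ ℝ S, hS⟩
    · rintro ⟨φ, hφ⟩
      have hφ' : ∀ e, φ (edgeMat p e) =
          (fun x : Fin t × Fin t => (φ (Pi.single x 1) + φ (Pi.single x.swap 1)) / 2) ⬝ᵥ
            edgeMat p e := by
        intro e
        have h1 : φ (edgeMat p e) = ∑ x, φ (Pi.single x 1) * edgeMat p e x := by
          conv_lhs => rw [pi_eq_sum_univ' (edgeMat p e), map_sum]
          refine sum_congr rfl fun x _ => ?_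
          rw [map_smul, smul_eq_mul, mul_comm]
        have h2 : φ (edgeMat p e) = ∑ x : Fin t × Fin t, φ (Pi.single x.swap 1) * edgeMat p e x := by
          rw [h1, ← (Equiv.prodComm (Fin t) (Fin t)).sum_comp]
          refine sum_congr rfl fun x _ => ?_
          induction e with | _ i j =>
          simp only [Equiv.prodComm_apply, edgeMat_mk, Prod.fst_swap, Prod.snd_swap]
          ring
        have h3 : φ (edgeMat p e) = (φ (edgeMat p e) + φ (edgeMat p e)) / 2 := by ring
        rw [h3]
        nth_rewrite 1 [h1]
        rw [h2, ← sum_add_distrib, sum_div]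
        exact sum_congr rfl fun x _ => by ring
      refine ⟨_, ?_, fun e he => (hφ e he).trans (hφ' e)⟩
      intro a b
      simp only [Prod.swap_prod_mk]
      ring
  · rw [Set.union_comm, ← SimpleGraph.edgeSet_sup, sup_compl_eq_top]
  · rw [SimpleGraph.disjoint_edgeSet]
    exact disjoint_compl_left

/-- Symmetric matrices. -/
def symmForms (t : ℕ) : Submodule ℝ (Fin t × Fin t → ℝ) where
  carrier := {S | ∀ a b, S (a, b) = S (b, a)}
  add_mem' hS hT a b := by simp only [Pi.add_apply, hS a b, hT a b]
  zero_mem' _ _ := rfl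
  smul_mem' c S hS a b := by simp only [Pi.smul_apply, hS a b]

/-- Rank and nullity, with the stress space identified with the symmetric forms. The rank is thus
the same at every `q` possessing a Gale dual in `ℝᵗ`. -/
lemma IsGaleDual.finrank_span_add {V : Type u} [Fintype V] {d t : ℕ} {q : V → Fin d → ℝ}
    {p : V → Fin t → ℝ} (h : IsGaleDual q p) :
    Module.finrank ℝ (Submodule.span ℝ (rigidityRow q '' completeEdges V)) +
      Module.finrank ℝ (symmForms t) = (completeEdges V).ncard := by
  classical
  let T := Fintype.linearCombination ℝ fun e : completeEdges V => rigidityRow q e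
  let L : symmForms t →ₗ[ℝ] (completeEdges V → ℝ) :=
    { toFun := fun S e => S.1 ⬝ᵥ edgeMat p e
      map_add' := fun S T => by ext; simp [add_dotProduct]
      map_smul' := fun c S => by ext; simp [smul_dotProduct] }
  have hL : Function.Injective L := by
    rw [injective_iff_map_eq_zero]
    rintro ⟨S, hS⟩ h0
    refine Subtype.ext (h.eq_zero_of_forall_edge hS fun i j hij => ?_)
    exact congrFun h0 ⟨s(i, j), by simpa using hij⟩
  have hrange : L.range = T.ker := by
    ext ω
    let ω' : Sym2 V → ℝ := fun e => if he : e ∈ completeEdges V then ω ⟨e, he⟩ else 0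
    have hω' : ∀ e : completeEdges V, ω' e = ω e := fun e => by
      simp only [ω', dif_pos e.2]
    have h1 : T ω = ∑ e, ω' e • rigidityRow q e := by
      rw [Fintype.linearCombination_apply,
        ← sum_subset (subset_univ (completeEdges V).toFinset)
          (fun e _ he => by rw [rigidityRow_eq_zero q (by simpa using he), smul_zero])]
      rw [sum_subtype (completeEdges V).toFinset (fun e => Set.mem_toFinset)
        (fun e => ω' e • rigidityRow q e)]
      exact sum_congr rfl fun e _ => by rw [hω']
    rw [LinearMap.mem_ker, h1, h.sum_smul_rigidityRow_eq_zero_iff]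
    constructor
    · rintro ⟨⟨S, hS⟩, rfl⟩
      exact ⟨S, hS, fun e he => hω' ⟨e, he⟩⟩
    · rintro ⟨S, hS, hSω⟩
      exact ⟨⟨S, hS⟩, funext fun e => ((hω' e).symm.trans (hSω e e.2)).symm⟩
  have h2 := T.finrank_range_add_finrank_ker
  rw [← hrange, LinearMap.finrank_range_of_inj hL, Fintype.range_linearCombination,
    Module.finrank_fintype_fun_eq_card, ← Nat.card_eq_fintype_card, Nat.card_coe_set_eq] at h2
  rwa [Set.image_eq_range]

lemma IsGeneric.linearIndepOn_rigidityRow {V : Type u} [Fintype V] {d : ℕ} {q q₀ : V → Fin d → ℝ}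
    (hq : IsGeneric q) {s : Set (Sym2 V)} (h : LinearIndepOn ℝ (rigidityRow q₀) s) :
    LinearIndepOn ℝ (rigidityRow q) s := by
  classical
  let P : Sym2 V → V × Fin d → MvPolynomial (V × Fin d) ℚ := fun e x =>
    ∑ j, if e = s(x.1, j) then .X (x.1, x.2) - .X (j, x.2) else 0
  have key : ∀ r : V → Fin d → ℝ, LinearIndepOn ℝ (rigidityRow r) s ↔
      LinearIndepOn ℝ (fun a k => MvPolynomial.aeval (fun x : V × Fin d => r x.1 x.2) (P a k)) s := by
    intro r
    have h1 := ((LinearEquiv.curry ℝ ℝ V (Fin d)).symm.toLinearMap.linearIndependent_iff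
        (v := fun a : s => rigidityRow r a) (LinearEquiv.ker _))
    have h2 : ((LinearEquiv.curry ℝ ℝ V (Fin d)).symm.toLinearMap ∘
        fun a : s => rigidityRow r a) =
        fun a : s => fun k => MvPolynomial.aeval (fun x : V × Fin d => r x.1 x.2) (P a k) := by
      funext a k
      change rigidityRow r a k.1 k.2 = _
      rw [rigidityRow_apply, Finset.sum_apply, map_sum]
      refine sum_congr rfl fun j _ => ?_
      split_ifs <;> simp
    rw [h2] at h1
    exact h1.symm
  rw [key] at h ⊢
  exact linearIndepOn_of_algebraicIndependent P (Set.toFinite s) h hq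

lemma finrank_span_image_eq_ncard {α W : Type*} [AddCommGroup W] [Module ℝ W] {f : α → W}
    {s : Set α} (hs : s.Finite) (h : LinearIndepOn ℝ f s) :
    Module.finrank ℝ (Submodule.span ℝ (f '' s)) = s.ncard := by
  have := hs.fintype
  rw [Set.image_eq_range, finrank_span_eq_card (R := ℝ) (b := fun x : s => f x) h,
    ← Nat.card_eq_fintype_card, Nat.card_coe_set_eq]

/-- Spanning sets of a rigidity matroid remain spanning at generic points, provided that the rank
is the generic one. -/
lemma IsGeneric.spanning_of_spanning {V : Type u} [Fintype V] {d t : ℕ} {q q₀ : V → Fin d → ℝ}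
    {p p₀ : V → Fin t → ℝ} (hq : IsGeneric q) (h : IsGaleDual q p) (h₀ : IsGaleDual q₀ p₀)
    {Y : Set (Sym2 V)} (hY : (rigidityMatroid q₀).Spanning Y) :
    (rigidityMatroid q).Spanning Y := by
  have hYE : Y ⊆ completeEdges V := hY.subset_ground
  obtain ⟨B, hB, hBY⟩ := (Matroid.spanning_iff_exists_isBase_subset hY.subset_ground).1 hY
  have hBE : B ⊆ completeEdges V := hB.subset_ground
  have hspan₀ := (linearMatroid_spanning_iff (hE := Set.toFinite _) (f := rigidityRow q₀) hBE).1
    hB.spanning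
  have e₀ : Submodule.span ℝ (rigidityRow q₀ '' B) =
      Submodule.span ℝ (rigidityRow q₀ '' completeEdges V) := by
    refine le_antisymm (Submodule.span_mono (Set.image_mono hBE)) (Submodule.span_le.2 ?_)
    rintro _ ⟨e, he, rfl⟩
    exact hspan₀ e he
  -- A base at `q₀` stays independent at the generic `q`, and equality of the ranks makes it a base
  -- there.
  have hBi : LinearIndepOn ℝ (rigidityRow q) B := hq.linearIndepOn_rigidityRow hB.indep.2
  have c₀ := finrank_span_image_eq_ncard (Set.toFinite B) hB.indep.2
  have c := finrank_span_image_eq_ncard (Set.toFinite B) hBi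
  have r := h.finrank_span_add
  have r₀ := h₀.finrank_span_add
  rw [e₀] at c₀
  have e : Submodule.span ℝ (rigidityRow q '' B) =
      Submodule.span ℝ (rigidityRow q '' completeEdges V) :=
    Submodule.eq_of_le_of_finrank_eq (Submodule.span_mono (Set.image_mono hBE)) (by omega)
  rw [rigidityMatroid, linearMatroid_spanning_iff hYE]
  intro a ha
  refine Submodule.span_mono (Set.image_mono hBY) ?_
  rw [e]
  exact Submodule.subset_span ⟨a, ha, rfl⟩

/-! ### Existence of Gale duals. -/

/-- The map sending `y` to `(∑ yⱼ qⱼ, ∑ yⱼ)`. -/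
def affineSum {V : Type u} [Fintype V] {d : ℕ} (q : V → Fin d → ℝ) :
    (V → ℝ) →ₗ[ℝ] (Fin d → ℝ) × ℝ :=
  (Fintype.linearCombination ℝ q).prod (Fintype.linearCombination ℝ fun _ => (1 : ℝ))

lemma mem_ker_affineSum {V : Type u} [Fintype V] {d : ℕ} {q : V → Fin d → ℝ} {y : V → ℝ} :
    y ∈ (affineSum q).ker ↔ ∑ j, y j • q j = 0 ∧ ∑ j, y j = 0 := by
  simp [affineSum, LinearMap.ker_prod, Fintype.linearCombination_apply]

/-- Generic points are affinely spanning, because the vertices of a simplex are. -/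
lemma IsGeneric.range_affineSum {V : Type u} [Fintype V] {d : ℕ} {q : V → Fin d → ℝ}
    (hq : IsGeneric q) (hd : d + 1 ≤ Fintype.card V) : (affineSum q).range = ⊤ := by
  classical
  let P : V → Option (Fin d) → MvPolynomial (V × Fin d) ℚ := fun v k =>
    k.elim 1 fun k => .X (v, k)
  obtain ⟨ι⟩ : Nonempty (Option (Fin d) ↪ V) :=
    Function.Embedding.nonempty_of_card_le (by simpa using hd)
  let q₀ : V → Fin d → ℝ := fun v k => if v = ι (some k) then 1 else 0
  have h₀ : LinearIndepOn ℝ (fun v k => MvPolynomial.aeval (fun x : V × Fin d => q₀ x.1 x.2) (P v k))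
      (Set.range ι) := by
    rw [linearIndepOn_range_iff ι.injective, Fintype.linearIndependent_iff]
    intro c hc
    have h1 : ∀ k, c (some k) = 0 := by
      intro k
      have := congrFun hc (some k)
      simpa [P, q₀] using this
    have h2 := congrFun hc none
    intro k
    cases k with
    | none => simpa [P, Fintype.sum_option, h1] using h2
    | some k => exact h1 k
  have h := linearIndepOn_of_algebraicIndependent P (Set.toFinite _) h₀ hq
  rw [linearIndepOn_range_iff ι.injective] at h
  have h' : LinearIndependent ℝ fun k : Option (Fin d) => (q (ι k), (1 : ℝ)) := by
    let L : (Fin d → ℝ) × ℝ →ₗ[ℝ] (Option (Fin d) → ℝ) :=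
      { toFun := fun x k => k.elim x.2 x.1
        map_add' := fun x y => by ext k; cases k <;> rfl
        map_smul' := fun c x => by ext k; cases k <;> rfl }
    refine LinearIndependent.of_comp L ?_
    convert h using 1
    ext k l
    cases l <;> simp [P, L]
  have hspan := h'.span_eq_top_of_card_eq_finrank (by simp)
  rw [eq_top_iff, ← hspan, Submodule.span_le]
  rintro _ ⟨k, rfl⟩
  exact ⟨Pi.single (ι k) 1, by simp [affineSum]⟩

lemma IsGeneric.exists_isGaleDual {V : Type u} [Fintype V] {d t : ℕ} {q : V → Fin d → ℝ}
    (hq : IsGeneric q) (hn : Fintype.card V = d + t + 1) :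
    ∃ p : V → Fin t → ℝ, IsGaleDual q p := by
  have h1 := (affineSum q).finrank_range_add_finrank_ker
  rw [hq.range_affineSum (by omega), finrank_top] at h1
  simp only [Module.finrank_prod, Module.finrank_fintype_fun_eq_card, Fintype.card_fin,
    Module.finrank_self] at h1
  have hk : Module.finrank ℝ (affineSum q).ker = t := by omega
  let b := Module.finBasisOfFinrankEq ℝ (affineSum q).ker hk
  have hcoe : ∀ (s : Fin t → ℝ) j, s ⬝ᵥ (fun a => (b a : V → ℝ) j) =
      ((∑ a, s a • b a : (affineSum q).ker) : V → ℝ) j := by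
    intro s j
    simp [dotProduct]
  refine ⟨fun j a => (b a : V → ℝ) j, ⟨fun y => ?_, fun s hs => ?_⟩⟩
  · rw [← mem_ker_affineSum]
    constructor
    · intro hy
      refine ⟨b.repr ⟨y, hy⟩, fun j => ?_⟩
      rw [hcoe, b.sum_repr]
    · rintro ⟨s, hs⟩
      have : y = ((∑ a, s a • b a : (affineSum q).ker) : V → ℝ) := by
        ext j
        rw [hs, hcoe]
      rw [this]
      exact Subtype.mem _
  · have h0 : (∑ a, s a • b a : (affineSum q).ker) = 0 := by
      ext j
      rw [← hcoe, hs]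
      rfl
    ext a
    exact Fintype.linearIndependent_iff.1 b.linearIndependent s h0 a

lemma IsGeneric.eq_zero_of_forall_dotProduct {V : Type u} [Fintype V] {t : ℕ} {p : V → Fin t → ℝ}
    (hp : IsGeneric p) (hn : t ≤ Fintype.card V) {s : Fin t → ℝ} (hs : ∀ j, s ⬝ᵥ p j = 0) :
    s = 0 := by
  obtain ⟨U, -, hU⟩ := exists_subset_card_eq (s := (univ : Finset V)) (n := t) (by simpa using hn)
  have hspan := (hp.linearIndepOn_of_card_le U hU.le).span_eq_top_of_card_eq_finrank' (by simp [hU])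
  have : ∀ x : Fin t → ℝ, s ⬝ᵥ x = 0 := by
    intro x
    have hx : x ∈ Submodule.span ℝ (Set.range fun u : (U : Set V) => p u) := hspan ▸ trivial
    induction hx using Submodule.span_induction with
    | mem x hx =>
      obtain ⟨u, rfl⟩ := hx
      exact hs u
    | zero => simp
    | add x y _ _ hx hy => rw [dotProduct_add, hx, hy, add_zero]
    | smul c x _ hx => rw [dotProduct_smul, hx, smul_zero]
  exact dotProduct_self_eq_zero.1 (this s)

/-- A Gale dual sums to zero, which generic points need not do. Rescaling by the coefficients of a
nowhere zero linear dependency repairs this and does not affect independence of edge vectors. -/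
lemma IsGeneric.exists_smul_isGaleDual {V : Type u} [Fintype V] {d t : ℕ} {p : V → Fin t → ℝ}
    (hp : IsGeneric p) (hn : Fintype.card V = d + t + 1) :
    ∃ c : V → ℝ, (∀ v, c v ≠ 0) ∧ ∃ q : V → Fin d → ℝ, IsGaleDual q fun v => c v • p v := by
  classical
  -- Each `p v` is a combination of `t` other points, so no coordinate vanishes on all dependencies;
  -- finitely many nonzero functionals are then nonzero simultaneously at some dependency.
  obtain ⟨c, hc, hc0⟩ := Module.Dual.exists_forall_mem_ne_zero_of_forall_exists
    (Fintype.linearCombination ℝ p).ker (fun v : V => LinearMap.proj (φ := fun _ => ℝ) v) (by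
      intro v
      obtain ⟨U, hUv, hU⟩ := exists_subset_card_eq (s := (univ : Finset V).erase v) (n := t)
        (by rw [card_erase_of_mem (mem_univ v), card_univ]; omega)
      have hvU : v ∉ U := fun h => by simpa using hUv h
      have hspan := (hp.linearIndepOn_of_card_le U hU.le).span_eq_top_of_card_eq_finrank'
        (by simp [hU])
      have hv : p v ∈ Submodule.span ℝ (p '' (U : Set V)) := by
        rw [Set.image_eq_range]
        exact hspan ▸ trivial
      rw [Submodule.mem_span_image_finset_iff_exists_fun] at hv
      obtain ⟨a, ha⟩ := hv
      refine ⟨fun w => (if w = v then 1 else 0) - if hw : w ∈ U then a ⟨w, hw⟩ else 0, ?_, ?_⟩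
      · rw [LinearMap.mem_ker, Fintype.linearCombination_apply]
        simp only [sub_smul, sum_sub_distrib, ite_smul, one_smul, zero_smul, sum_ite_eq', mem_univ,
          if_true]
        rw [← ha, sub_eq_zero, ← sum_subset (subset_univ U) fun x _ hx => by simp [hx],
          ← sum_coe_sort U]
        exact sum_congr rfl fun x _ => by rw [dif_pos x.2]
      · simp [hvU])
  rw [LinearMap.mem_ker, Fintype.linearCombination_apply] at hc
  refine ⟨c, hc0, ?_⟩
  let D : (Fin t → ℝ) →ₗ[ℝ] (V → ℝ) :=
    { toFun := fun s j => s ⬝ᵥ (c j • p j)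
      map_add' := fun x y => funext fun j => add_dotProduct _ _ _
      map_smul' := fun r x => funext fun j => smul_dotProduct _ _ _ }
  have hD : Function.Injective D := by
    rw [injective_iff_map_eq_zero]
    intro s hs
    refine hp.eq_zero_of_forall_dotProduct (by omega) fun j => ?_
    have := congrFun hs j
    simp only [D, LinearMap.coe_mk, AddHom.coe_mk, dotProduct_smul, smul_eq_mul,
      Pi.zero_apply, mul_eq_zero] at this
    exact this.resolve_left (hc0 j)
  let T₁ : (V → ℝ) →ₗ[ℝ] ℝ := Fintype.linearCombination ℝ fun _ => (1 : ℝ)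
  have hT₁ : ∀ y, T₁ y = ∑ j, y j := fun y => by simp [T₁, Fintype.linearCombination_apply]
  have hDT : D.range ≤ T₁.ker := by
    rintro _ ⟨s, rfl⟩
    rw [LinearMap.mem_ker, hT₁]
    change ∑ j, s ⬝ᵥ (c j • p j) = 0
    rw [← dotProduct_sum, hc, dotProduct_zero]
  have hsurj : T₁.range = ⊤ := by
    rw [LinearMap.range_eq_top]
    have : Nonempty V := Fintype.card_pos_iff.1 (by omega)
    intro r
    exact ⟨Pi.single (Classical.arbitrary V) r, by rw [hT₁]; simp⟩
  have hker : Module.finrank ℝ T₁.ker = d + t := by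
    have := T₁.finrank_range_add_finrank_ker
    rw [hsurj, finrank_top, Module.finrank_self, Module.finrank_fintype_fun_eq_card] at this
    omega
  -- The quotient of the sum-zero vectors by the prescribed dependencies has dimension `d`. The
  -- points `q j` are images of unit vectors under an extension of the quotient map to all of `ℝ^V`.
  let R : Submodule ℝ T₁.ker := D.range.comap T₁.ker.subtype
  have hR : Module.finrank ℝ R = t := by
    rw [LinearEquiv.finrank_eq (Submodule.comapSubtypeEquivOfLe hDT),
      LinearMap.finrank_range_of_inj hD]
    simp
  have hquot : Module.finrank ℝ (T₁.ker ⧸ R) = Module.finrank ℝ (Fin d → ℝ) := by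
    have := R.finrank_quotient_add_finrank
    rw [Module.finrank_fintype_fun_eq_card, Fintype.card_fin]
    omega
  let e := LinearEquiv.ofFinrankEq _ _ hquot
  obtain ⟨A, hA⟩ := LinearMap.exists_extend (e.toLinearMap ∘ₗ R.mkQ)
  have hAq : ∀ y : V → ℝ, ∑ j, y j • A (Pi.single j 1) = A y := by
    intro y
    conv_rhs => rw [pi_eq_sum_univ' y, map_sum]
    exact sum_congr rfl fun j _ => by rw [map_smul]
  refine ⟨fun j => A (Pi.single j 1), ⟨fun y => ?_, fun s hs => hD ?_⟩⟩
  · rw [hAq]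
    constructor
    · rintro ⟨h1, h2⟩
      rw [← hT₁] at h2
      have h3 : e (R.mkQ ⟨y, h2⟩) = 0 := by
        rw [← h1]
        exact (LinearMap.congr_fun hA ⟨y, h2⟩).symm
      rw [LinearEquiv.map_eq_zero_iff, Submodule.mkQ_apply, Submodule.Quotient.mk_eq_zero] at h3
      obtain ⟨s, hs⟩ := h3
      exact ⟨s, fun j => (congrFun hs j).symm⟩
    · rintro ⟨s, hs⟩
      have hyD : D s = y := funext fun j => (hs j).symm
      have h2 : y ∈ T₁.ker := hDT ⟨s, hyD⟩
      refine ⟨?_, by rw [← hT₁]; exact h2⟩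
      have h3 : A y = e (R.mkQ ⟨y, h2⟩) := LinearMap.congr_fun hA ⟨y, h2⟩
      rw [h3, LinearEquiv.map_eq_zero_iff, Submodule.mkQ_apply, Submodule.Quotient.mk_eq_zero]
      exact ⟨s, hyD⟩
  · rw [map_zero]
    exact funext hs

lemma linearIndepOn_edgeMat_smul {V : Type u} {t : ℕ} {p : V → Fin t → ℝ} {c : V → ℝ}
    (hc : ∀ v, c v ≠ 0) {X : Set (Sym2 V)} (h : LinearIndepOn ℝ (edgeMat p) X) :
    LinearIndepOn ℝ (edgeMat fun v => c v • p v) X := by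
  let w : Sym2 V → ℝ := Sym2.lift ⟨fun a b => c a * c b, fun a b => mul_comm _ _⟩
  have hw : ∀ e, w e ≠ 0 := by
    intro e
    induction e with | _ a b => exact mul_ne_zero (hc a) (hc b)
  have := h.units_smul fun e : X => Units.mk0 (w e) (hw e)
  rw [LinearIndepOn]
  convert this using 1
  funext ⟨e, he⟩ x
  induction e with | _ a b =>
  change c a * p a x.1 * (c b * p b x.2) + c b * p b x.1 * (c a * p a x.2) =
    c a * c b * (p a x.1 * p b x.2 + p b x.1 * p a x.2)
  ring

/-! ### The main theorem -/

lemma indep_symTensorMatroid_iff_cIndependent {V : Type u} [Fintype V] {t : ℕ} (ht1 : 1 ≤ t)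
    (ht5 : t ≤ 5) {p : V → Fin t → ℝ} (hp : IsGeneric p) (G : SimpleGraph V) :
    (symTensorMatroid p).Indep G.edgeSet ↔ CIndependent t G := by
  refine ⟨fun h => ?_, fun h => h.indep ht1 ht5 hp⟩
  by_cases hn : t + 1 ≤ Fintype.card V
  · exact (isAbstractSymTensorMatroid_symTensorMatroid hn hp).cIndependent hn h
  · exact cIndependent_of_card_le G (by omega)

/-- Two dual pairs are used. The generic `q` has a dual `p'`, from which independence passes to the
generic `p`; a rescaling of `p` is dual to some `q₀`, from which spanning passes to `q`. -/
lemma spanning_rigidityMatroid_iff_cIndependent {V : Type u} [Fintype V] {d t : ℕ} (ht1 : 1 ≤ t)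
    (ht5 : t ≤ 5) (hn : Fintype.card V = d + t + 1) {q : V → Fin d → ℝ} (hq : IsGeneric q)
    (G : SimpleGraph V) : (rigidityMatroid q).Spanning G.edgeSet ↔ CIndependent t Gᶜ := by
  obtain ⟨p', hp'⟩ := hq.exists_isGaleDual hn
  obtain ⟨p, hp⟩ := exists_isGeneric V t
  rw [← indep_symTensorMatroid_iff_cIndependent ht1 ht5 hp, symTensorMatroid,
    linearMatroid_indep_iff, linearIndepOn_symTensor_iff]
  constructor
  · intro h
    exact ⟨SimpleGraph.edgeSet_mono le_top,
      hp.linearIndepOn_edgeMat (Set.toFinite _) ((hp'.spanning_iff G).1 h)⟩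
  · rintro ⟨-, h⟩
    obtain ⟨c, hc, q₀, hq₀⟩ := hp.exists_smul_isGaleDual hn
    exact hq.spanning_of_spanning hp' hq₀
      ((hq₀.spanning_iff G).2 (linearIndepOn_edgeMat_smul hc h))

/-- An independent set contains no loops, so it is the edge set of a graph; `𝒞_t`-independence links
the two matroids. -/
lemma IsAbstractSymTensorMatroid.weakLE {V : Type u} [Fintype V] {t : ℕ} (ht1 : 1 ≤ t)
    (ht5 : t ≤ 5) (hn : t + 1 ≤ Fintype.card V) {M : Matroid (Sym2 V)}
    (h : IsAbstractSymTensorMatroid t M) {p : V → Fin t → ℝ} (hp : IsGeneric p) :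
    WeakLE M (symTensorMatroid p) := by
  refine ⟨h.ground_eq, fun I hI => ?_⟩
  have hIE : I ⊆ completeEdges V := h.ground_eq ▸ hI.subset_ground
  have hedge : (SimpleGraph.fromEdgeSet I).edgeSet = I := by
    rw [SimpleGraph.edgeSet_fromEdgeSet]
    refine sdiff_eq_left.2 (Set.disjoint_left.2 fun e he hd => ?_)
    exact SimpleGraph.not_isDiag_of_mem_edgeSet _ (hIE he) hd
  rw [← hedge] at hI ⊢
  exact (h.cIndependent hn hI).indep ht1 ht5 hp

lemma WeakLE.antisymm {α : Type u} {M N : Matroid α} (h : WeakLE M N) (h' : WeakLE N M) : M = N :=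
  Matroid.ext_indep h.1 fun I _ => ⟨h.2 I, h'.2 I⟩

theorem theorem3p6 (t : ℕ) (ht1 : 1 ≤ t) (ht5 : t ≤ 5) (V : Type*) [Fintype V] :
    -- independence in the generic symmetric `t`-tensor matroid
    (∀ p : V → Fin t → ℝ, IsGeneric p → ∀ G : SimpleGraph V,
      (symTensorMatroid p).Indep G.edgeSet ↔ CIndependent t G) ∧
    -- generic rigidity in `ℝᵈ` for graphs on `n = d + t + 1` vertices
    (∀ d : ℕ, Fintype.card V = d + t + 1 →
      ∀ q : V → Fin d → ℝ, IsGeneric q → ∀ G : SimpleGraph V,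
        (rigidityMatroid q).Spanning G.edgeSet ↔ CIndependent t Gᶜ) ∧
    -- the symmetric `t`-tensor matroid is the unique maximal (indeed the greatest) abstract one
    (t + 1 ≤ Fintype.card V → ∀ p : V → Fin t → ℝ, IsGeneric p →
      (∀ M : Matroid (Sym2 V), IsAbstractSymTensorMatroid t M → WeakLE M (symTensorMatroid p)) ∧
      ∀ M : Matroid (Sym2 V),
        IsWeakMaximal (IsAbstractSymTensorMatroid t) M ↔ M = symTensorMatroid p) := by
  refine ⟨fun p hp G => indep_symTensorMatroid_iff_cIndependent ht1 ht5 hp G,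
    fun d hn q hq G => spanning_rigidityMatroid_iff_cIndependent ht1 ht5 hn hq G,
    fun hn p hp => ⟨fun M hM => hM.weakLE ht1 ht5 hn hp, fun M => ⟨fun hM => ?_, ?_⟩⟩⟩
  · exact (hM.2 _ (isAbstractSymTensorMatroid_symTensorMatroid hn hp)
      (hM.1.weakLE ht1 ht5 hn hp)).symm
  · rintro rfl
    exact ⟨isAbstractSymTensorMatroid_symTensorMatroid hn hp, fun N hN hle =>
      (hN.weakLE ht1 ht5 hn hp).antisymm hle⟩
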